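/- Let $M$ be a non-empty compact (smooth, without boundary) quaternionic Kähler manifold of dimension $4n$, $n\ge 1$, with metric $g$ and Levi-Civita connection $\nabla$. That is, $\mathrm{End}(TM)$ has a rank 3 subbundle $S^2H$ which is locally trivialized by triples $(I,J,K)$ of $g$-orthogonal almost complex structures with $I^2=J^2=K^2=-1=IJK$; for $n>1$ this subbundle is parallel; for $n=1$ the manifold, oriented so that the 2-forms $g(A\cdot,\cdot)$, $A\in S^2H$, are the anti-self-dual ones, is self-dual and Einstein. As usual, the scalar curvature $s$ is assumed to be non-zero. Put $\nu=\frac{s}{4n(n+2)}$ and let $L=I\otimes I+J\otimes J+K\otimes K$ act on bilinear forms by $(LB)(X,Y)=B(IX,IY)+B(JX,JY)+B(KX,KY)$, which does not depend on the choice of $(I,J,K)$. Then: 1. There is no globally defined smooth 1-form $\varphi$ on $M$ such that $$\nabla\varphi=\tfrac12\bigl((-1+L)\,\varphi\otimes\varphi-\nu g\bigr)+\Phi$$ for some 2-form $\Phi$ on $M$ that is Hermitian with respect to each of the local almost complex structures $I,J,K$. 2. Consequently there is no globally defined smooth 1-form $\varphi$ on $M$ such that near every point $S^2H$ is trivialized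 by a hypercomplex structure (a triple $(I,J,K)$ as above with $I,J,K$ integrable) whose Lee form is $\varphi$, where the Lee form of $I$ is $X\mapsto\frac12\operatorname{trace}\{Y\mapsto I(\nabla_Y I)X\}$ and the Lee form of a hypercomplex structure is the common Lee form of $I$, $J$ and $K$. -/

import Mathlib

open Bundle FiberBundle VectorField Module Set
open scoped Manifold ContDiff Topology InnerProductSpace

noncomputable section

namespace QuatKaehler

/-! ## The Levi-Civita connection of a Riemannian metric -/

section LeviCivita

set_option linter.unusedSectionVars false

variable {E : Type*} [NormedAddCommGroup E] [NormedSpace ℝ E] [FiniteDimensional ℝ E]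
  {H : Type*} [TopologicalSpace H] (I : ModelWithCorners ℝ E H)
  {M : Type*} [TopologicalSpace M] [ChartedSpace H M] [IsManifold I ∞ M]
  [RiemannianBundle (fun x : M ↦ TangentSpace I x)]

instance finiteDimensional_tangentSpace (x : M) : FiniteDimensional ℝ (TangentSpace I x) :=
  inferInstanceAs (FiniteDimensional ℝ E)

/-- The right hand side of the Koszul formula for `g(∇_X Y, Z)`. -/
def koszul (X Y Z : Π x : M, TangentSpace I x) (x : M) : ℝ :=
  (1 / 2) * (d% (fun y ↦ ⟪Y y, Z y⟫_ℝ) x (X x) + d% (fun y ↦ ⟪X y, Z y⟫_ℝ) x (Y x)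
    - d% (fun y ↦ ⟪X y, Y y⟫_ℝ) x (Z x)
    + ⟪mlieBracket I X Y x, Z x⟫_ℝ - ⟪mlieBracket I X Z x, Y x⟫_ℝ
    - ⟪mlieBracket I Y Z x, X x⟫_ℝ)

variable {I}
variable {X X' Y Y' Z Z' : Π x : M, TangentSpace I x} {x : M} {f : M → ℝ}

lemma fun_inner_smul_left :
    (fun y ↦ ⟪(f • X) y, Y y⟫_ℝ) = fun y ↦ f y * ⟪X y, Y y⟫_ℝ := by
  funext y; simp [real_inner_smul_left]

lemma fun_inner_smul_right :
    (fun y ↦ ⟪X y, (f • Y) y⟫_ℝ) = fun y ↦ f y * ⟪X y, Y y⟫_ℝ := by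
  funext y; simp [real_inner_smul_right]

lemma fun_inner_add_left :
    (fun y ↦ ⟪(X + X') y, Y y⟫_ℝ) = fun y ↦ ⟪X y, Y y⟫_ℝ + ⟪X' y, Y y⟫_ℝ := by
  funext y; simp [inner_add_left]

lemma fun_inner_add_right :
    (fun y ↦ ⟪X y, (Y + Y') y⟫_ℝ) = fun y ↦ ⟪X y, Y y⟫_ℝ + ⟪X y, Y' y⟫_ℝ := by
  funext y; simp [inner_add_right]

variable [IsContMDiffRiemannianBundle I ∞ E (fun x : M ↦ TangentSpace I x)]

lemma mdiff_inner (hX : MDiffAt (T% X) x) (hY : MDiffAt (T% Y) x) :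
    MDiffAt (fun y ↦ ⟪X y, Y y⟫_ℝ) x :=
  MDifferentiableAt.inner_bundle (F := E) (E := fun x : M ↦ TangentSpace I x) hX hY

lemma koszul_tensorial_left (hY : MDiffAt (T% Y) x) (hZ : MDiffAt (T% Z) x) :
    TensorialAt I E (fun X ↦ koszul I X Y Z x) x where
  smul {f X} hf hX := by
    simp only [koszul, mlieBracket_smul_left hf hX, fun_inner_smul_left,
      mvfderiv_fun_mul hf (mdiff_inner hX hY), mvfderiv_fun_mul hf (mdiff_inner hX hZ)]
    simp [inner_add_left, real_inner_smul_left, real_inner_smul_right]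
    rw [real_inner_comm (Y x) (X x), real_inner_comm (Z x) (X x)]
    ring
  add {X X'} hX hX' := by
    simp only [koszul, mlieBracket_add_left hX hX', fun_inner_add_left,
      mvfderiv_fun_add (mdiff_inner hX hY) (mdiff_inner hX' hY),
      mvfderiv_fun_add (mdiff_inner hX hZ) (mdiff_inner hX' hZ)]
    simp [inner_add_left, inner_add_right]
    ring

lemma koszul_tensorial_right (hX : MDiffAt (T% X) x) (hY : MDiffAt (T% Y) x) :
    TensorialAt I E (fun Z ↦ koszul I X Y Z x) x where
  smul {f Z} hf hZ := by
    simp only [koszul, mlieBracket_smul_right hf hZ, fun_inner_smul_right,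
      mvfderiv_fun_mul hf (mdiff_inner hX hZ), mvfderiv_fun_mul hf (mdiff_inner hY hZ)]
    simp [inner_add_left, real_inner_smul_left, real_inner_smul_right]
    rw [real_inner_comm (Z x) (X x), real_inner_comm (Z x) (Y x)]
    ring
  add {Z Z'} hZ hZ' := by
    simp only [koszul, mlieBracket_add_right hZ hZ', fun_inner_add_right,
      mvfderiv_fun_add (mdiff_inner hX hZ) (mdiff_inner hX hZ'),
      mvfderiv_fun_add (mdiff_inner hY hZ) (mdiff_inner hY hZ')]
    simp [inner_add_left, inner_add_right]
    ring

lemma koszul_smul_middle (hf : MDiffAt f x) (hX : MDiffAt (T% X) x) (hY : MDiffAt (T% Y) x)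
    (hZ : MDiffAt (T% Z) x) :
    koszul I X (f • Y) Z x = f x * koszul I X Y Z x + d% f x (X x) * ⟪Y x, Z x⟫_ℝ := by
  simp only [koszul, mlieBracket_smul_right hf hY, mlieBracket_smul_left hf hY,
    fun_inner_smul_right, fun_inner_smul_left,
    mvfderiv_fun_mul hf (mdiff_inner hX hY), mvfderiv_fun_mul hf (mdiff_inner hY hZ)]
  simp [inner_add_left, real_inner_smul_left, real_inner_smul_right]
  rw [real_inner_comm (Y x) (X x)]
  ring

lemma koszul_add_middle (hX : MDiffAt (T% X) x) (hY : MDiffAt (T% Y) x)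
    (hY' : MDiffAt (T% Y') x) (hZ : MDiffAt (T% Z) x) :
    koszul I X (Y + Y') Z x = koszul I X Y Z x + koszul I X Y' Z x := by
  simp only [koszul, mlieBracket_add_right hY hY', mlieBracket_add_left hY hY',
    fun_inner_add_right, fun_inner_add_left,
    mvfderiv_fun_add (mdiff_inner hX hY) (mdiff_inner hX hY'),
    mvfderiv_fun_add (mdiff_inner hY hZ) (mdiff_inner hY' hZ)]
  simp [inner_add_left, inner_add_right]
  ring

variable (I) in
open Classical in
/-- The bilinear form `(u, w) ↦ g(∇_u Y, w)` at `x`, for a vector field `Y` that is differentiable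
at `x` (and zero otherwise). -/
def leviCivitaForm (Y : Π x : M, TangentSpace I x) (x : M) :
    TangentSpace I x →L[ℝ] TangentSpace I x →L[ℝ] ℝ :=
  if hY : MDiffAt (T% Y) x then
    TensorialAt.mkHom₂ (F := E) (F' := E) (fun X Z ↦ koszul I X Y Z x) x
      (fun _ hZ ↦ koszul_tensorial_left hY hZ) (fun _ hX ↦ koszul_tensorial_right hX hY)
  else 0

lemma leviCivitaForm_apply (hX : MDiffAt (T% X) x) (hY : MDiffAt (T% Y) x)
    (hZ : MDiffAt (T% Z) x) :
    leviCivitaForm I Y x (X x) (Z x) = koszul I X Y Z x := by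
  rw [leviCivitaForm, dif_pos hY]
  exact TensorialAt.mkHom₂_apply (F := E) (F' := E) (Φ := fun X Z ↦ koszul I X Y Z x) _ _ hX hZ

lemma leviCivitaForm_extend (hY : MDiffAt (T% Y) x) (u w : TangentSpace I x) :
    leviCivitaForm I Y x u w = koszul I (extend E u) Y (extend E w) x := by
  rw [leviCivitaForm, dif_pos hY]
  rfl

variable (I) in
/-- The endomorphism `u ↦ ∇_u Y` of the tangent space at `x`. -/
def leviCivitaFun (Y : Π x : M, TangentSpace I x) (x : M) :
    TangentSpace I x →L[ℝ] TangentSpace I x :=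
  ∑ i, ((leviCivitaForm I Y x).flip (stdOrthonormalBasis ℝ (TangentSpace I x) i)).smulRight
    (stdOrthonormalBasis ℝ (TangentSpace I x) i)

lemma inner_leviCivitaFun (u w : TangentSpace I x) :
    ⟪leviCivitaFun I Y x u, w⟫_ℝ = leviCivitaForm I Y x u w := by
  set b := stdOrthonormalBasis ℝ (TangentSpace I x) with hb
  conv_rhs => rw [← b.sum_repr w]
  simp only [leviCivitaFun, ← hb, sum_apply,
    ContinuousLinearMap.smulRight_apply, ContinuousLinearMap.flip_apply, sum_inner,
    real_inner_smul_left, map_sum, map_smul, smul_eq_mul, b.repr_apply_apply]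
  exact Finset.sum_congr rfl fun i _ ↦ mul_comm _ _

variable (I M) in
/-- The Levi-Civita connection; `leviCivita I M Y x u` is `(∇_u Y)(x)`. -/
def leviCivita : CovariantDerivative I E (fun x : M ↦ TangentSpace I x) where
  toFun := leviCivitaFun I
  isCovariantDerivativeOnUniv :=
    { add := by
        intro Y Y' x hY hY' _
        ext u : 1
        refine ext_inner_right ℝ fun w ↦ ?_
        simp only [add_apply, inner_add_left, inner_leviCivitaFun]
        rw [leviCivitaForm_extend hY, leviCivitaForm_extend hY',
          leviCivitaForm_extend (mdifferentiableAt_add_section hY hY'),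
          koszul_add_middle (mdifferentiableAt_extend ..) hY hY' (mdifferentiableAt_extend ..)]
      leibniz := by
        intro Y f x hY hf _
        ext u : 1
        refine ext_inner_right ℝ fun w ↦ ?_
        simp only [add_apply, inner_add_left, inner_leviCivitaFun,
          smul_apply, real_inner_smul_left,
          ContinuousLinearMap.smulRight_apply]
        rw [leviCivitaForm_extend hY, leviCivitaForm_extend (hf.smul_section hY),
          koszul_smul_middle hf (mdifferentiableAt_extend ..) hY (mdifferentiableAt_extend ..)]
        simp }

lemma inner_leviCivita (hX : MDiffAt (T% X) x) (hY : MDiffAt (T% Y) x) (hZ : MDiffAt (T% Z) x) :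
    ⟪leviCivita I M Y x (X x), Z x⟫_ℝ = koszul I X Y Z x :=
  (inner_leviCivitaFun _ _).trans (leviCivitaForm_apply hX hY hZ)

/-- The Levi-Civita connection is torsion-free. -/
lemma leviCivita_torsion : (leviCivita I M).torsion = 0 := by
  rw [CovariantDerivative.torsion_eq_zero_iff]
  intro X Y x hX hY
  refine ext_inner_right ℝ fun w ↦ ?_
  have hw : MDiffAt (T% (extend E w)) x := mdifferentiableAt_extend ..
  have h1 := inner_leviCivita hX hY hw
  have h2 := inner_leviCivita hY hX hw
  have h3 : mlieBracket I Y X x = - mlieBracket I X Y x := mlieBracket_swap_apply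
  have h4 : (fun y ↦ ⟪X y, Y y⟫_ℝ) = (fun y ↦ ⟪Y y, X y⟫_ℝ) := by
    funext y; exact real_inner_comm _ _
  simp only [extend_apply_self] at h1 h2
  rw [inner_sub_left, h1, h2, koszul, koszul, h3, h4]
  simp
  ring

/-- The Levi-Civita connection is compatible with the metric. -/
lemma leviCivita_metric (hY : MDiffAt (T% Y) x) (hZ : MDiffAt (T% Z) x) (u : TangentSpace I x) :
    d% (fun y ↦ ⟪Y y, Z y⟫_ℝ) x u =
      ⟪leviCivita I M Y x u, Z x⟫_ℝ + ⟪Y x, leviCivita I M Z x u⟫_ℝ := by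
  have hu : MDiffAt (T% (extend E u)) x := mdifferentiableAt_extend ..
  have h1 := inner_leviCivita hu hY hZ
  have h2 := inner_leviCivita hu hZ hY
  have h3 : mlieBracket I Z Y x = - mlieBracket I Y Z x := mlieBracket_swap_apply
  have h4 : (fun y ↦ ⟪Z y, Y y⟫_ℝ) = (fun y ↦ ⟪Y y, Z y⟫_ℝ) := by
    funext y; exact real_inner_comm _ _
  simp only [extend_apply_self] at h1 h2
  rw [real_inner_comm _ (Y x), h1, h2, koszul, koszul, h3, h4]
  simp
  ring

end LeviCivita

/-! ## Tensor calculus -/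

section Tensors

variable {E : Type*} [NormedAddCommGroup E] [NormedSpace ℝ E] [FiniteDimensional ℝ E]
  {H : Type*} [TopologicalSpace H] (I : ModelWithCorners ℝ E H)
  {M : Type*} [TopologicalSpace M] [ChartedSpace H M] [IsManifold I ∞ M]

/-- Smooth 1-forms. -/
def SmoothForm (φ : Π x : M, TangentSpace I x →L[ℝ] ℝ) : Prop :=
  ContMDiff I (I.prod 𝓘(ℝ, E →L[ℝ] ℝ)) ∞ (fun x ↦ TotalSpace.mk' (E →L[ℝ] ℝ) x (φ x))

/-- Fields of endomorphisms of the tangent bundle that are smooth on `U`. -/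
def SmoothEndOn (U : Set M) (A : Π x : M, TangentSpace I x →L[ℝ] TangentSpace I x) : Prop :=
  ContMDiffOn I (I.prod 𝓘(ℝ, E →L[ℝ] E)) ∞ (fun x ↦ TotalSpace.mk' (E →L[ℝ] E) x (A x)) U

/-- Integrability on `U` of an almost complex structure `A`: its Nijenhuis tensor vanishes. -/
def IntegrableOn (U : Set M) (A : Π x : M, TangentSpace I x →L[ℝ] TangentSpace I x) : Prop :=
  ∀ X Y : Π x : M, TangentSpace I x, CMDiff[U] ∞ (T% X) → CMDiff[U] ∞ (T% Y) → ∀ x ∈ U,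
    mlieBracket I (fun y ↦ A y (X y)) (fun y ↦ A y (Y y)) x
      - A x (mlieBracket I (fun y ↦ A y (X y)) Y x)
      - A x (mlieBracket I X (fun y ↦ A y (Y y)) x)
      - mlieBracket I X Y x = 0

variable [RiemannianBundle (fun x : M ↦ TangentSpace I x)]
  [IsContMDiffRiemannianBundle I ∞ E (fun x : M ↦ TangentSpace I x)]

/-- `covDerivForm I φ x u v` is `(∇_u φ)(v) = u(φ(V)) - φ(∇_u V)`, where `V` extends `v`. -/
def covDerivForm (φ : Π x : M, TangentSpace I x →L[ℝ] ℝ) (x : M) (u v : TangentSpace I x) : ℝ :=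
  d% (fun y ↦ φ y (extend E v y)) x u - φ x (leviCivita I M (extend E v) x u)

/-- `covDerivEnd I A x v` is the endomorphism `u ↦ (∇_u A)(v) = ∇_u (A V) - A (∇_u V)`, where `V`
extends `v`. -/
def covDerivEnd (A : Π x : M, TangentSpace I x →L[ℝ] TangentSpace I x) (x : M)
    (v : TangentSpace I x) : TangentSpace I x →L[ℝ] TangentSpace I x :=
  leviCivita I M (fun y ↦ A y (extend E v y)) x - A x ∘L leviCivita I M (extend E v) x

/-- The Lee form `v ↦ (1/2) trace {u ↦ A (∇_u A) v}` of an almost complex structure `A`. -/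
def leeForm (A : Π x : M, TangentSpace I x →L[ℝ] TangentSpace I x) (x : M)
    (v : TangentSpace I x) : ℝ :=
  (1 / 2) * LinearMap.trace ℝ (TangentSpace I x)
    (A x ∘L covDerivEnd I A x v : TangentSpace I x →L[ℝ] TangentSpace I x)

/-- The curvature `R(u, v) w = ∇_U ∇_V W - ∇_V ∇_U W - ∇_[U, V] W` at `x`, where `U`, `V`, `W`
extend `u`, `v`, `w`. -/
def curvature (x : M) (u v w : TangentSpace I x) : TangentSpace I x :=
  leviCivita I M (fun y ↦ leviCivita I M (extend E w) y (extend E v y)) x u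
    - leviCivita I M (fun y ↦ leviCivita I M (extend E w) y (extend E u y)) x v
    - leviCivita I M (extend E w) x (mlieBracket I (extend E u) (extend E v) x)

/-- The Ricci tensor `Ric(v, w) = trace {u ↦ R(u, v) w}`. -/
def ricci (x : M) (v w : TangentSpace I x) : ℝ :=
  ∑ i, ⟪curvature I x (stdOrthonormalBasis ℝ (TangentSpace I x) i) v w,
    stdOrthonormalBasis ℝ (TangentSpace I x) i⟫_ℝ

/-- The scalar curvature, the metric trace of the Ricci tensor. -/
def scalarCurvature (x : M) : ℝ :=
  ∑ i, ricci I x (stdOrthonormalBasis ℝ (TangentSpace I x) i)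
    (stdOrthonormalBasis ℝ (TangentSpace I x) i)

variable (M) in
/-- Einstein metrics: the Ricci tensor is a constant multiple of the metric. -/
def IsEinstein : Prop :=
  ∃ c : ℝ, ∀ (x : M) (u v : TangentSpace I x), ricci I x u v = c * ⟪u, v⟫_ℝ

/-- The Weyl tensor, in dimension `4`: the curvature tensor `g(R(u, v) w, z)` minus its Ricci
part. -/
def weyl₄ (x : M) (u v w z : TangentSpace I x) : ℝ :=
  ⟪curvature I x u v w, z⟫_ℝ
    - (1 / 2) * (⟪v, w⟫_ℝ * ricci I x u z + ricci I x v w * ⟪u, z⟫_ℝ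
        - ⟪u, w⟫_ℝ * ricci I x v z - ricci I x u w * ⟪v, z⟫_ℝ)
    + scalarCurvature I x / 6 * (⟪v, w⟫_ℝ * ⟪u, z⟫_ℝ - ⟪u, w⟫_ℝ * ⟪v, z⟫_ℝ)

end Tensors

/-! ## Quaternionic Kähler manifolds -/

section Quaternionic

/-- Three orthogonal endomorphisms with `J₁² = J₂² = J₃² = -1 = J₁ J₂ J₃`. -/
structure IsQuaternionicTriple {V : Type*} [NormedAddCommGroup V] [InnerProductSpace ℝ V]
    (J₁ J₂ J₃ : V →L[ℝ] V) : Prop where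
  sq₁ : ∀ v, J₁ (J₁ v) = -v
  sq₂ : ∀ v, J₂ (J₂ v) = -v
  sq₃ : ∀ v, J₃ (J₃ v) = -v
  prod : ∀ v, J₁ (J₂ (J₃ v)) = -v
  orth₁ : ∀ u v, ⟪J₁ u, J₁ v⟫_ℝ = ⟪u, v⟫_ℝ
  orth₂ : ∀ u v, ⟪J₂ u, J₂ v⟫_ℝ = ⟪u, v⟫_ℝ
  orth₃ : ∀ u v, ⟪J₃ u, J₃ v⟫_ℝ = ⟪u, v⟫_ℝ

variable {n : ℕ} {M : Type*} [TopologicalSpace M]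
  [ChartedSpace (EuclideanSpace ℝ (Fin (4 * n))) M] [IsManifold (𝓡 (4 * n)) ∞ M]
  [RiemannianBundle (fun x : M ↦ TangentSpace (𝓡 (4 * n)) x)]

/-- `(J₁, J₂, J₃)` is a quaternionic triple at `x` that spans `Q x`. -/
def IsFrameAt
    (Q : Π x : M, Submodule ℝ (TangentSpace (𝓡 (4 * n)) x →L[ℝ] TangentSpace (𝓡 (4 * n)) x))
    (x : M) (J₁ J₂ J₃ : TangentSpace (𝓡 (4 * n)) x →L[ℝ] TangentSpace (𝓡 (4 * n)) x) : Prop :=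
  IsQuaternionicTriple J₁ J₂ J₃ ∧ Q x = Submodule.span ℝ {J₁, J₂, J₃}

/-- `(J₁, J₂, J₃)` is, on `U`, a smooth almost hypercomplex structure that is orthogonal and
trivializes `Q`. -/
structure IsLocalFrame
    (Q : Π x : M, Submodule ℝ (TangentSpace (𝓡 (4 * n)) x →L[ℝ] TangentSpace (𝓡 (4 * n)) x))
    (U : Set M)
    (J₁ J₂ J₃ : Π x : M, TangentSpace (𝓡 (4 * n)) x →L[ℝ] TangentSpace (𝓡 (4 * n)) x) :
    Prop where
  smooth₁ : SmoothEndOn (𝓡 (4 * n)) U J₁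
  smooth₂ : SmoothEndOn (𝓡 (4 * n)) U J₂
  smooth₃ : SmoothEndOn (𝓡 (4 * n)) U J₃
  frame : ∀ x ∈ U, IsFrameAt Q x (J₁ x) (J₂ x) (J₃ x)

/-- An almost quaternionic Hermitian structure: a subbundle `Q` of the endomorphism bundle of the
tangent bundle that is locally trivialized by orthogonal almost hypercomplex structures. -/
def IsAlmostQuaternionicHermitian
    (Q : Π x : M, Submodule ℝ (TangentSpace (𝓡 (4 * n)) x →L[ℝ] TangentSpace (𝓡 (4 * n)) x)) :
    Prop :=
  ∀ x : M, ∃ U : Set M, IsOpen U ∧ x ∈ U ∧ ∃ J₁ J₂ J₃, IsLocalFrame Q U J₁ J₂ J₃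

/-- The operator `L = J₁ ⊗ J₁ + J₂ ⊗ J₂ + J₃ ⊗ J₃` on bilinear forms. -/
def opL {V : Type*} (J₁ J₂ J₃ : V → V) (B : V → V → ℝ) (u v : V) : ℝ :=
  B (J₁ u) (J₁ v) + B (J₂ u) (J₂ v) + B (J₃ u) (J₃ v)

variable [IsContMDiffRiemannianBundle (𝓡 (4 * n)) ∞ (EuclideanSpace ℝ (Fin (4 * n)))
  (fun x : M ↦ TangentSpace (𝓡 (4 * n)) x)]

/-- The bundle `Q` is parallel: covariant derivatives of its local sections are sections of it. -/
def IsParallel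
    (Q : Π x : M, Submodule ℝ (TangentSpace (𝓡 (4 * n)) x →L[ℝ] TangentSpace (𝓡 (4 * n)) x)) :
    Prop :=
  ∀ (U : Set M) (A : Π x : M, TangentSpace (𝓡 (4 * n)) x →L[ℝ] TangentSpace (𝓡 (4 * n)) x),
    IsOpen U → SmoothEndOn (𝓡 (4 * n)) U A → (∀ x ∈ U, A x ∈ Q x) →
    ∀ x ∈ U, ∀ u : TangentSpace (𝓡 (4 * n)) x, ∃ B ∈ Q x, ∀ v : TangentSpace (𝓡 (4 * n)) x,
      covDerivEnd (𝓡 (4 * n)) A x v u = B v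

/-- Self-duality of a `4`-dimensional Riemannian manifold. In dimension `4` a choice of `Q` is the
same as a choice of orientation, for which the 2-forms `g(A ·, ·)`, `A ∈ Q x`, are the anti-self-dual
ones; the condition is that the Weyl tensor, as an operator on 2-forms, annihilates them. -/
def IsSelfDual
    (Q : Π x : M, Submodule ℝ (TangentSpace (𝓡 (4 * n)) x →L[ℝ] TangentSpace (𝓡 (4 * n)) x)) :
    Prop :=
  ∀ x : M, ∀ A ∈ Q x, ∀ u v : TangentSpace (𝓡 (4 * n)) x,
    ∑ i, ∑ j, weyl₄ (𝓡 (4 * n)) x (stdOrthonormalBasis ℝ (TangentSpace (𝓡 (4 * n)) x) i)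
        (stdOrthonormalBasis ℝ (TangentSpace (𝓡 (4 * n)) x) j) u v *
      ⟪A (stdOrthonormalBasis ℝ (TangentSpace (𝓡 (4 * n)) x) i),
        stdOrthonormalBasis ℝ (TangentSpace (𝓡 (4 * n)) x) j⟫_ℝ = 0

/-- Quaternionic Kähler structures `Q` (the bundle `S²H`) on a `4n`-dimensional Riemannian
manifold, with non-zero scalar curvature: for `n > 1` the bundle `Q` is parallel, for `n = 1` the
manifold is self-dual and Einstein. -/
structure IsQuaternionicKahler
    (Q : Π x : M, Submodule ℝ (TangentSpace (𝓡 (4 * n)) x →L[ℝ] TangentSpace (𝓡 (4 * n)) x)) :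
    Prop where
  almostQuaternionicHermitian : IsAlmostQuaternionicHermitian Q
  parallel : 1 < n → IsParallel Q
  einstein : n = 1 → IsEinstein (𝓡 (4 * n)) M
  selfDual : n = 1 → IsSelfDual Q
  scalarCurvature_ne_zero : ∀ x : M, scalarCurvature (𝓡 (4 * n)) x ≠ 0

/-- The reduced scalar curvature `ν = s / (4n(n+2))`. -/
def reducedScalarCurvature (n : ℕ) {M : Type*} [TopologicalSpace M]
    [ChartedSpace (EuclideanSpace ℝ (Fin (4 * n))) M] [IsManifold (𝓡 (4 * n)) ∞ M]
    [RiemannianBundle (fun x : M ↦ TangentSpace (𝓡 (4 * n)) x)]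
    [IsContMDiffRiemannianBundle (𝓡 (4 * n)) ∞ (EuclideanSpace ℝ (Fin (4 * n)))
      (fun x : M ↦ TangentSpace (𝓡 (4 * n)) x)] (x : M) : ℝ :=
  scalarCurvature (𝓡 (4 * n)) x / (4 * n * (n + 2))

/-- `Φ` is a section of `S²E`: a 2-form that is Hermitian for each member of the quaternionic
triples spanning `Q`. -/
def IsHHermitianTwoForm
    (Q : Π x : M, Submodule ℝ (TangentSpace (𝓡 (4 * n)) x →L[ℝ] TangentSpace (𝓡 (4 * n)) x))
    (Φ : Π x : M, TangentSpace (𝓡 (4 * n)) x →L[ℝ] TangentSpace (𝓡 (4 * n)) x →L[ℝ] ℝ) : Prop :=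
  ∀ (x : M) (u v : TangentSpace (𝓡 (4 * n)) x), Φ x u v = -Φ x v u ∧
    ∀ J₁ J₂ J₃, IsFrameAt Q x J₁ J₂ J₃ →
      Φ x (J₁ u) (J₁ v) = Φ x u v ∧ Φ x (J₂ u) (J₂ v) = Φ x u v ∧ Φ x (J₃ u) (J₃ v) = Φ x u v

/-- The equation `∇φ = (1/2) ((-1 + L) φ ⊗ φ - ν g) + Φ` with a section `Φ` of `S²E`, on all of `M`.
The operator `L` does not depend on the triple `(J₁, J₂, J₃)` spanning `Q x`, and the equation makes
`Φ` as smooth as its other terms. -/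
def SolvesLeeEquation
    (Q : Π x : M, Submodule ℝ (TangentSpace (𝓡 (4 * n)) x →L[ℝ] TangentSpace (𝓡 (4 * n)) x))
    (φ : Π x : M, TangentSpace (𝓡 (4 * n)) x →L[ℝ] ℝ) : Prop :=
  ∃ Φ : Π x : M, TangentSpace (𝓡 (4 * n)) x →L[ℝ] TangentSpace (𝓡 (4 * n)) x →L[ℝ] ℝ,
    IsHHermitianTwoForm Q Φ ∧
    ∀ (x : M) (J₁ J₂ J₃ : TangentSpace (𝓡 (4 * n)) x →L[ℝ] TangentSpace (𝓡 (4 * n)) x),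
      IsFrameAt Q x J₁ J₂ J₃ → ∀ u v : TangentSpace (𝓡 (4 * n)) x,
        covDerivForm (𝓡 (4 * n)) φ x u v =
          (1 / 2) * (-(φ x u * φ x v) + opL J₁ J₂ J₃ (fun a b ↦ φ x a * φ x b) u v
            - reducedScalarCurvature n x * ⟪u, v⟫_ℝ) + Φ x u v

/-- `Q` is locally trivialized by hypercomplex structures, all of which have Lee form `φ`. -/
def LocallyHypercomplexWithLeeForm
    (Q : Π x : M, Submodule ℝ (TangentSpace (𝓡 (4 * n)) x →L[ℝ] TangentSpace (𝓡 (4 * n)) x))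
    (φ : Π x : M, TangentSpace (𝓡 (4 * n)) x →L[ℝ] ℝ) : Prop :=
  ∀ x : M, ∃ U : Set M, IsOpen U ∧ x ∈ U ∧ ∃ J₁ J₂ J₃, IsLocalFrame Q U J₁ J₂ J₃ ∧
    IntegrableOn (𝓡 (4 * n)) U J₁ ∧ IntegrableOn (𝓡 (4 * n)) U J₂ ∧
    IntegrableOn (𝓡 (4 * n)) U J₃ ∧
    ∀ y ∈ U, ∀ v : TangentSpace (𝓡 (4 * n)) y, leeForm (𝓡 (4 * n)) J₁ y v = φ y v ∧
      leeForm (𝓡 (4 * n)) J₂ y v = φ y v ∧ leeForm (𝓡 (4 * n)) J₃ y v = φ y v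

end Quaternionic

end QuatKaehler

end

/-!
Both parts reduce to the same statement about the vector field `X` dual to `φ`. There are no `X` on
`M` and `ν` without zeros such that at each point, for some quaternionic triple `(I, J, K)`,
`2 g(∇_u X, u) = -g(X, u)² + g(X, I u)² + g(X, J u)² + g(X, K u)² - ν |u|²` for all `u`
(`not_exists_vectorField`). The trace of this identity is `div X = |X|² - 2 n ν`, so the set
`{ν > 0}` is open and closed. Where `|X|²` is maximal on it, `u = X` gives `|X|² (|X|² + ν) = 0`; so
`X = 0` on this set and therefore `ν = 0` there, which is impossible unless the set is empty. Then
`ν < 0` and `div X > 0` on all of `M`, in contradiction to the divergence theorem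
(`not_forall_divergence_pos`).

The divergence theorem is proved from the formula `w div X = ∑ ∂ᵢ (w Xⁱ)` in a chart, where
`w = √(det gᵢⱼ)` (`divergence_mul_density`), the change of variables between charts
(`integral_chartFun_eq`) and a partition of unity.

For the first part the identity is the restriction of the given equation to the diagonal. For the
second, let `(I, J, K)` be a hypercomplex structure spanning `S²H`, with Lee form `φ`. Then
`∇I = c J - b K`, `∇J = a K - c I`, `∇K = b I - a J` (for `n > 1` since `S²H` is parallel, for
`n = 1` by linear algebra), and the three Lee forms being `φ` means that `a = -φ ∘ I`, `b = -φ ∘ J`,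
`c = -φ ∘ K` (`IsQuaternionicTriple.connectionForms_eq`). Hence `[R(u, v), I] = C J - B K` with `B`
and `C` explicit in `∇φ` and `φ` (`curvature_endo_sub`), and cyclically with a third form `A`. The
curvature of a quaternionic Kähler manifold has `A(u, I u) = B(u, J u) = C(u, K u) = -ν |u|²`
(`CommutatorRelations.apply_self` for `n > 1`, `CommutatorRelations.apply_self_of_weyl` for
`n = 1`). The first of these reads
`(∇φ)(u, u) + (∇φ)(I u, I u) = φ(J u)² + φ(K u)² - ν |u|²`, and the three together give the
identity for `X`.
-/

noncomputable section

namespace QuatKaehler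

/-! ### Smoothness of Lie brackets and covariant derivatives -/

section Smoothness

set_option linter.unusedSectionVars false

variable {E : Type*} [NormedAddCommGroup E] [NormedSpace ℝ E] [FiniteDimensional ℝ E]
  {H : Type*} [TopologicalSpace H] {I : ModelWithCorners ℝ E H}
  {M : Type*} [TopologicalSpace M] [ChartedSpace H M]

lemma contMDiffAt_det {ι : Type*} [Fintype ι] [DecidableEq ι] {k : ℕ∞ω} {x : M}
    {G : M → Matrix ι ι ℝ} (hG : ∀ i j, CMDiffAt k (fun y ↦ G y i j) x) :
    CMDiffAt k (fun y ↦ (G y).det) x := by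
  simp only [Matrix.det_apply']
  refine ContMDiffAt.sum fun σ _ ↦ ?_
  exact contMDiffAt_const.mul (contMDiffAt_finsetProd fun i _ ↦ hG _ _)

variable [IsManifold I ∞ M]

lemma contMDiffAt_mvfderiv_apply {f : M → ℝ} {X : Π x : M, TangentSpace I x} {x : M}
    (hf : CMDiffAt ∞ f x) (hX : CMDiffAt ∞ (T% X) x) :
    CMDiffAt ∞ (fun y ↦ d% f y (X y)) x := by
  have h1 : CMDiffAt ∞ (fun y ↦ (⟨f y, mfderiv% f y (X y)⟩ : TangentBundle 𝓘(ℝ, ℝ) ℝ)) x :=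
    ContMDiffAt.clm_apply_of_inCoordinates (F₁ := E) (F₂ := ℝ) (E₁ := (TangentSpace I : M → Type _))
      (E₂ := (TangentSpace 𝓘(ℝ, ℝ) : ℝ → Type _)) (b₁ := id) (b₂ := f)
      (ϕ := fun y ↦ mfderiv% f y) (ContMDiffAt.mfderiv_const hf (m := ∞) (by simp)) hX hf
  exact (contMDiff_snd_tangentBundle_modelSpace ℝ 𝓘(ℝ, ℝ)).contMDiffAt.comp x h1

lemma contMDiffAt_mlieBracket {A B : Π x : M, TangentSpace I x} {x : M}
    (hA : CMDiffAt ∞ (T% A) x) (hB : CMDiffAt ∞ (T% B) x) :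
    CMDiffAt ∞ (T% (mlieBracket I A B)) x :=
  haveI : IsManifold I (((⊤ : ℕ∞) : ℕ∞ω) + 1) M := inferInstanceAs (IsManifold I ∞ M)
  have : IsManifold I (minSmoothness ℝ 2) M := by
    rw [minSmoothness_of_isRCLikeNormedField]; exact .of_le (n := ∞) ENat.LEInfty.out
  ContMDiffAt.mlieBracket_vectorField (n := ⊤) (m := ⊤) hA hB (by simp)

lemma eventually_mdifferentiableAt {X : Π x : M, TangentSpace I x} {x : M}
    (hX : CMDiffAt ∞ (T% X) x) : ∀ᶠ y in 𝓝 x, MDiffAt (T% X) y :=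
  ((contMDiffAt_iff_contMDiffAt_nhds (by simp)).1 (hX.of_le (by simp : (1 : ℕ∞ω) ≤ ∞))).mono
    fun _ h ↦ h.mdifferentiableAt (by simp)

lemma eventually_mdifferentiableAt_fun {f : M → ℝ} {x : M}
    (hf : CMDiffAt ∞ f x) : ∀ᶠ y in 𝓝 x, MDiffAt f y :=
  haveI : IsManifold I 1 M := .of_le (n := ∞) (by simp)
  ((contMDiffAt_iff_contMDiffAt_nhds (by simp)).1 (hf.of_le (by simp : (1 : ℕ∞ω) ≤ ∞))).mono
    fun _ h ↦ h.mdifferentiableAt (by simp)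

lemma mvfderiv_congr {f g : M → ℝ} {x : M} (h : f =ᶠ[𝓝 x] g) : d% f x = d% g x := by
  ext u
  exact congrArg (fun L : E →L[ℝ] ℝ ↦ L u) (h.mfderiv_eq (I := I) (I' := 𝓘(ℝ, ℝ)))

/-- The commutator of the derivations given by two vector fields is their Lie bracket. -/
lemma mvfderiv_mlieBracket {f : M → ℝ} {U V : Π x : M, TangentSpace I x} {x : M}
    (hf : CMDiffAt ∞ f x) (hU : CMDiffAt ∞ (T% U) x) (hV : CMDiffAt ∞ (T% V) x) :
    d% f x (mlieBracket I U V x) =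
      d% (fun y ↦ d% f y (V y)) x (U x) - d% (fun y ↦ d% f y (U y)) x (V x) := by
  have : IsManifold I (minSmoothness ℝ 2) M := by
    rw [minSmoothness_of_isRCLikeNormedField]; exact .of_le (n := ∞) ENat.LEInfty.out
  have : IsManifold I (minSmoothness ℝ 3) M := by
    rw [minSmoothness_of_isRCLikeNormedField]
    exact .of_le (n := ∞) ENat.LEInfty.out
  have bs : ∀ {Z : Π x : M, TangentSpace I x} {h : M → ℝ} {W : Π x : M, TangentSpace I x},
      CMDiffAt ∞ (T% Z) x → CMDiffAt ∞ h x → CMDiffAt ∞ (T% W) x →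
      mlieBracket I Z (h • W) =ᶠ[𝓝 x] (fun y ↦ d% h y (Z y)) • W + h • mlieBracket I Z W := by
    intro Z h W hZ hh hW
    filter_upwards [eventually_mdifferentiableAt hW, eventually_mdifferentiableAt_fun hh]
      with y h1 h2
    simp [mlieBracket_smul_right h2 h1]
    rfl
  have hb : ∀ {A B : Π x : M, TangentSpace I x}, CMDiffAt ∞ (T% A) x → CMDiffAt ∞ (T% B) x →
      CMDiffAt ∞ (T% (mlieBracket I A B)) x := contMDiffAt_mlieBracket
  have two : ∀ {A : Π x : M, TangentSpace I x}, CMDiffAt ∞ (T% A) x →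
      CMDiffAt (minSmoothness ℝ 2) (T% A) x := fun h ↦ h.of_le (by simpa using ENat.LEInfty.out)
  -- compare the Jacobi identities for `(U, V, W)` and `(U, V, f W)`
  have main : ∀ w : TangentSpace I x, (d% f x (mlieBracket I U V x) -
      (d% (fun y ↦ d% f y (V y)) x (U x) - d% (fun y ↦ d% f y (U y)) x (V x))) • w = 0 := by
    intro w
    set W := extend E w with hWdef
    have hW : CMDiffAt ∞ (T% W) x := contMDiffAt_extend ..
    have hWx : W x = w := extend_apply_self ..
    have hfW : CMDiffAt ∞ (T% (f • W)) x := hf.smul_section hW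
    have J0 := leibniz_identity_mlieBracket_apply (two hU) (two hV) (two hW)
    have J1 := leibniz_identity_mlieBracket_apply (two hU) (two hV) (two hfW)
    have md : ∀ {A : Π x : M, TangentSpace I x}, CMDiffAt ∞ (T% A) x → MDiffAt (T% A) x :=
      fun h ↦ h.mdifferentiableAt (by simp)
    have exp : ∀ {A B : Π x : M, TangentSpace I x}, CMDiffAt ∞ (T% A) x → CMDiffAt ∞ (T% B) x →
        mlieBracket I A (mlieBracket I B (f • W)) x =
          d% (fun y ↦ d% f y (B y)) x (A x) • w + d% f x (B x) • mlieBracket I A W x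
          + (d% f x (A x) • mlieBracket I B W x + f x • mlieBracket I A (mlieBracket I B W) x) := by
      intro A B hA hB
      have e := (bs hB hf hW)
      have e' := Filter.EventuallyEq.mlieBracket_vectorField_eq (I := I)
        (Filter.EventuallyEq.refl (𝓝 x) A) e
      refine e'.trans ?_
      have h1 := contMDiffAt_mvfderiv_apply hf hB
      rw [mlieBracket_add_right (md (h1.smul_section hW)) (md (hf.smul_section (hb hB hW))),
        (bs hA h1 hW).self_of_nhds, (bs hA hf (hb hB hW)).self_of_nhds]
      simp [hWx]
    rw [exp hU hV, exp hV hU, (bs (hb hU hV) hf hW).self_of_nhds, J0] at J1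
    simp only [Pi.add_apply, Pi.smul_apply', hWx, smul_add] at J1
    rw [sub_smul, sub_smul, sub_eq_zero]
    linear_combination (norm := module) -J1
  rcases subsingleton_or_nontrivial (TangentSpace I x) with hs | hs
  · simp [Subsingleton.elim (mlieBracket I U V x) 0, Subsingleton.elim (U x) 0,
      Subsingleton.elim (V x) 0]
  · obtain ⟨w, hw⟩ := exists_ne (0 : TangentSpace I x)
    exact sub_eq_zero.1 ((smul_eq_zero.1 (main w)).resolve_right hw)

variable
  [RiemannianBundle (fun x : M ↦ TangentSpace I x)]
  [IsContMDiffRiemannianBundle I ∞ E (fun x : M ↦ TangentSpace I x)]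

/-- A vector field is smooth as soon as its inner products with smooth vector fields are. -/
lemma contMDiffAt_of_forall_inner {X : Π x : M, TangentSpace I x} {x : M}
    (h : ∀ Z : Π x : M, TangentSpace I x, CMDiffAt ∞ (T% Z) x →
      CMDiffAt ∞ (fun y ↦ ⟪X y, Z y⟫_ℝ) x) : CMDiffAt ∞ (T% X) x := by
  classical
  let e := trivializationAt E (TangentSpace I : M → Type _) x
  let b := Module.finBasis ℝ E
  have hx : x ∈ e.baseSet := mem_baseSet_trivializationAt' x
  let s := e.localFrame b
  have hs (i) : CMDiffAt ∞ (T% (s i)) x := contMDiffAt_localFrame_of_mem ∞ e b i hx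
  let G : M → Matrix _ _ ℝ := fun y ↦ Matrix.gram ℝ (fun i ↦ s i y)
  have hG (i j) : CMDiffAt ∞ (fun y ↦ G y i j) x :=
    ContMDiffAt.inner_bundle (F := E) (E := fun x : M ↦ TangentSpace I x) (hs i) (hs j)
  have hdet : ∀ y ∈ e.baseSet, (G y).det ≠ 0 := by
    intro y hy
    refine (Matrix.det_gram_ne_zero_iff_linearIndependent).2 ?_
    exact (e.isLocalFrameOn_localFrame_baseSet I 1 b).linearIndependent hy
  rw [contMDiffAt_iff_localFrameCoeff b hx]
  intro i
  have key : ∀ y ∈ e.baseSet, LinearMap.piApply (e.localFrameCoeff I b i) X y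
      = (G y).det⁻¹ * ((G y).updateRow i (fun j ↦ ⟪X y, s j y⟫_ℝ)).det := by
    -- Cramer's rule for the Gram matrix
    intro y hy
    set c : _ → ℝ := fun i ↦ e.localFrameCoeff I b i y (X y) with hc
    have hX : X y = ∑ i, c i • s i y := e.eq_sum_localFrameCoeff_smul hy
    have : (fun j ↦ ⟪X y, s j y⟫_ℝ) = ∑ i, c i • (G y) i := by
      funext j
      rw [hX]
      simp [sum_inner, real_inner_smul_left, G, Matrix.gram]
    rw [this, Matrix.det_updateRow_sum, smul_eq_mul, mul_comm (c i),
      inv_mul_cancel_left₀ (hdet y hy)]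
    rfl
  refine ContMDiffAt.congr_of_eventuallyEq
    (f := fun y ↦ (G y).det⁻¹ * ((G y).updateRow i (fun j ↦ ⟪X y, s j y⟫_ℝ)).det) ?_
    (Filter.eventuallyEq_of_mem (e.open_baseSet.mem_nhds hx) key)
  refine ContMDiffAt.mul ?_ ?_
  · exact (contMDiffAt_det hG).inv₀ (hdet x hx)
  · refine contMDiffAt_det fun k j ↦ ?_
    by_cases hk : k = i
    · subst hk; simpa using h _ (hs j)
    · simpa [Matrix.updateRow_ne hk] using hG k j

lemma contMDiffAt_koszul {X Y Z : Π x : M, TangentSpace I x} {x : M}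
    (hX : CMDiffAt ∞ (T% X) x) (hY : CMDiffAt ∞ (T% Y) x) (hZ : CMDiffAt ∞ (T% Z) x) :
    CMDiffAt ∞ (koszul I X Y Z) x := by
  have hi : ∀ {A B : Π x : M, TangentSpace I x}, CMDiffAt ∞ (T% A) x → CMDiffAt ∞ (T% B) x →
      CMDiffAt ∞ (fun y ↦ ⟪A y, B y⟫_ℝ) x := fun hA hB ↦
    ContMDiffAt.inner_bundle (F := E) (E := fun x : M ↦ TangentSpace I x) hA hB
  unfold koszul
  refine contMDiffAt_const.mul (ContMDiffAt.sub (ContMDiffAt.sub (ContMDiffAt.add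
    (ContMDiffAt.sub (ContMDiffAt.add ?_ ?_) ?_) ?_) ?_) ?_)
  · exact contMDiffAt_mvfderiv_apply (hi hY hZ) hX
  · exact contMDiffAt_mvfderiv_apply (hi hX hZ) hY
  · exact contMDiffAt_mvfderiv_apply (hi hX hY) hZ
  · exact hi (contMDiffAt_mlieBracket hX hY) hZ
  · exact hi (contMDiffAt_mlieBracket hX hZ) hY
  · exact hi (contMDiffAt_mlieBracket hY hZ) hX

lemma contMDiffAt_leviCivita {V W : Π x : M, TangentSpace I x} {x : M}
    (hV : CMDiffAt ∞ (T% V) x) (hW : CMDiffAt ∞ (T% W) x) :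
    CMDiffAt ∞ (T% (fun y ↦ leviCivita I M W y (V y))) x := by
  refine contMDiffAt_of_forall_inner fun Z hZ ↦ ?_
  refine (contMDiffAt_koszul hV hW hZ).congr_of_eventuallyEq ?_
  filter_upwards [eventually_mdifferentiableAt hV, eventually_mdifferentiableAt hW,
    eventually_mdifferentiableAt hZ] with y h1 h2 h3
  exact inner_leviCivita h1 h2 h3

end Smoothness

/-! ### Symmetries of the curvature -/

section Curvature

set_option linter.unusedSectionVars false

variable {E : Type*} [NormedAddCommGroup E] [NormedSpace ℝ E] [FiniteDimensional ℝ E]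
  {H : Type*} [TopologicalSpace H] {I : ModelWithCorners ℝ E H}
  {M : Type*} [TopologicalSpace M] [ChartedSpace H M] [IsManifold I ∞ M]
  [RiemannianBundle (fun x : M ↦ TangentSpace I x)]
  [IsContMDiffRiemannianBundle I ∞ E (fun x : M ↦ TangentSpace I x)]

lemma leviCivita_congr {X Y : Π x : M, TangentSpace I x} {x : M} (hX : MDiffAt (T% X) x)
    (h : X =ᶠ[𝓝 x] Y) : leviCivita I M X x = leviCivita I M Y x :=
  (leviCivita I M).isCovariantDerivativeOnUniv.congr_of_eventuallyEq hX
    (hX.congr_of_eventuallyEq (h.mono fun y hy ↦ by simp [hy])) Filter.univ_mem h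

lemma leviCivita_add {X Y : Π x : M, TangentSpace I x} {x : M} (hX : MDiffAt (T% X) x)
    (hY : MDiffAt (T% Y) x) :
    leviCivita I M (X + Y) x = leviCivita I M X x + leviCivita I M Y x :=
  (leviCivita I M).isCovariantDerivativeOnUniv.add hX hY

lemma leviCivita_smul {X : Π x : M, TangentSpace I x} {f : M → ℝ} {x : M} (hf : MDiffAt f x)
    (hX : MDiffAt (T% X) x) (u : TangentSpace I x) :
    leviCivita I M (f • X) x u = f x • leviCivita I M X x u + d% f x u • X x := by
  rw [(leviCivita I M).isCovariantDerivativeOnUniv.leibniz hX hf]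
  rfl

lemma leviCivita_sub_swap {X Y : Π x : M, TangentSpace I x} {x : M} (hX : MDiffAt (T% X) x)
    (hY : MDiffAt (T% Y) x) :
    leviCivita I M Y x (X x) - leviCivita I M X x (Y x) = mlieBracket I X Y x :=
  (CovariantDerivative.torsion_eq_zero_iff _).1 leviCivita_torsion hX hY

/-- The curvature expression `∇_U ∇_V W - ∇_V ∇_U W - ∇_[U, V] W` of three vector fields. -/
def fieldCurvature (U V W : Π x : M, TangentSpace I x) (x : M) : TangentSpace I x :=
  leviCivita I M (fun y ↦ leviCivita I M W y (V y)) x (U x)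
    - leviCivita I M (fun y ↦ leviCivita I M W y (U y)) x (V x)
    - leviCivita I M W x (mlieBracket I U V x)

lemma curvature_eq (x : M) (u v w : TangentSpace I x) :
    curvature I x u v w = fieldCurvature (extend E u) (extend E v) (extend E w) x := by
  simp [curvature, fieldCurvature]

variable {U V W Z : Π x : M, TangentSpace I x} {x : M}

lemma inner_fieldCurvature (hU : CMDiffAt ∞ (T% U) x) (hV : CMDiffAt ∞ (T% V) x)
    (hW : CMDiffAt ∞ (T% W) x) (hZ : CMDiffAt ∞ (T% Z) x) :
    ⟪fieldCurvature U V W x, Z x⟫_ℝ = -⟪fieldCurvature U V Z x, W x⟫_ℝ := by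
  have md : ∀ {A : Π x : M, TangentSpace I x}, CMDiffAt ∞ (T% A) x → MDiffAt (T% A) x :=
    fun h ↦ h.mdifferentiableAt (by simp)
  have first : ∀ {A : Π x : M, TangentSpace I x},
      (fun y ↦ d% (fun y ↦ ⟪W y, Z y⟫_ℝ) y (A y)) =ᶠ[𝓝 x]
        fun y ↦ ⟪leviCivita I M W y (A y), Z y⟫_ℝ + ⟪W y, leviCivita I M Z y (A y)⟫_ℝ := by
    intro A
    filter_upwards [eventually_mdifferentiableAt hW, eventually_mdifferentiableAt hZ] with y h1 h2
    exact leviCivita_metric h1 h2 _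
  have second : ∀ {A B : Π x : M, TangentSpace I x}, CMDiffAt ∞ (T% A) x → CMDiffAt ∞ (T% B) x →
      d% (fun y ↦ d% (fun y ↦ ⟪W y, Z y⟫_ℝ) y (B y)) x (A x) =
        ⟪leviCivita I M (fun y ↦ leviCivita I M W y (B y)) x (A x), Z x⟫_ℝ
        + ⟪leviCivita I M W x (B x), leviCivita I M Z x (A x)⟫_ℝ
        + (⟪leviCivita I M W x (A x), leviCivita I M Z x (B x)⟫_ℝ
        + ⟪W x, leviCivita I M (fun y ↦ leviCivita I M Z y (B y)) x (A x)⟫_ℝ) := by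
    intro A B hA hB
    have h1 := md (contMDiffAt_leviCivita hB hW)
    have h2 := md (contMDiffAt_leviCivita hB hZ)
    rw [mvfderiv_congr first, mvfderiv_fun_add (mdiff_inner h1 (md hZ)) (mdiff_inner (md hW) h2)]
    rw [add_apply, leviCivita_metric h1 (md hZ), leviCivita_metric (md hW) h2]
  have key := mvfderiv_mlieBracket (ContMDiffAt.inner_bundle (F := E)
    (E := fun x : M ↦ TangentSpace I x) hW hZ) hU hV
  rw [second hU hV, second hV hU, leviCivita_metric (md hW) (md hZ)] at key
  simp only [fieldCurvature, inner_sub_left]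
  simp only [real_inner_comm _ (W x)] at *
  linarith

lemma inner_curvature_swap_right (x : M) (u v w z : TangentSpace I x) :
    ⟪curvature I x u v w, z⟫_ℝ = -⟪curvature I x u v z, w⟫_ℝ := by
  have h := inner_fieldCurvature (I := I) (contMDiffAt_extend I E u) (contMDiffAt_extend I E v)
    (contMDiffAt_extend I E w) (contMDiffAt_extend I E z)
  simpa [curvature_eq] using h

/-- The curvature is tensorial in its last argument. -/
lemma fieldCurvature_extend (u v : TangentSpace I x) (hW : CMDiffAt ∞ (T% W) x) :
    fieldCurvature (extend E u) (extend E v) W x = curvature I x u v (W x) := by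
  refine ext_inner_right ℝ fun z ↦ ?_
  have h := inner_fieldCurvature (I := I) (contMDiffAt_extend I E u) (contMDiffAt_extend I E v)
    hW (contMDiffAt_extend I E z)
  rw [inner_curvature_swap_right, curvature_eq]
  simpa using h

lemma curvature_swap (x : M) (u v w : TangentSpace I x) :
    curvature I x u v w = -curvature I x v u w := by
  simp only [curvature, mlieBracket_swap_apply (V := extend E v) (W := extend E u), map_neg]
  abel

lemma curvature_bianchi (x : M) (u v w : TangentSpace I x) :
    curvature I x u v w + curvature I x v w u + curvature I x w u v = 0 := by
  have hm : IsManifold I (minSmoothness ℝ 3) M := by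
    rw [minSmoothness_of_isRCLikeNormedField]
    exact .of_le (n := ∞) ENat.LEInfty.out
  have md : ∀ {A : Π x : M, TangentSpace I x}, CMDiffAt ∞ (T% A) x → MDiffAt (T% A) x :=
    fun h ↦ h.mdifferentiableAt (by simp)
  have key : ∀ {A B C : Π x : M, TangentSpace I x}, CMDiffAt ∞ (T% A) x → CMDiffAt ∞ (T% B) x →
      CMDiffAt ∞ (T% C) x →
      leviCivita I M (fun y ↦ leviCivita I M C y (B y)) x (A x) =
        leviCivita I M (fun y ↦ leviCivita I M B y (C y)) x (A x)
        + leviCivita I M A x (mlieBracket I B C x) + mlieBracket I A (mlieBracket I B C) x := by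
    intro A B C hA hB hC
    have h1 := md (contMDiffAt_leviCivita hB hC)
    have h2 := md (contMDiffAt_leviCivita hC hB)
    have h3 := md (contMDiffAt_mlieBracket hB hC)
    have e : (fun y ↦ leviCivita I M C y (B y)) =ᶠ[𝓝 x]
        (fun y ↦ leviCivita I M B y (C y)) + mlieBracket I B C := by
      filter_upwards [eventually_mdifferentiableAt hB, eventually_mdifferentiableAt hC] with y k1 k2
      rw [Pi.add_apply, ← leviCivita_sub_swap k1 k2]
      abel
    rw [leviCivita_congr h1 e, leviCivita_add h2 h3, add_apply, ← leviCivita_sub_swap (md hA) h3]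
    abel
  have hu : CMDiffAt ∞ (T% (extend E u)) x := contMDiffAt_extend I E u
  have hv : CMDiffAt ∞ (T% (extend E v)) x := contMDiffAt_extend I E v
  have hw : CMDiffAt ∞ (T% (extend E w)) x := contMDiffAt_extend I E w
  have two : ∀ {A : Π x : M, TangentSpace I x}, CMDiffAt ∞ (T% A) x →
      CMDiffAt (minSmoothness ℝ 2) (T% A) x := fun h ↦ h.of_le (by simpa using ENat.LEInfty.out)
  have J := leibniz_identity_mlieBracket_apply (two hu) (two hv) (two hw)
  have s1 : mlieBracket I (mlieBracket I (extend E u) (extend E v)) (extend E w) x =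
    - mlieBracket I (extend E w) (mlieBracket I (extend E u) (extend E v)) x :=
    mlieBracket_swap_apply
  have s2 : mlieBracket I (extend E u) (extend E w) = - mlieBracket I (extend E w) (extend E u) :=
    mlieBracket_swap
  have s3 : mlieBracket I (extend E v) (- mlieBracket I (extend E w) (extend E u)) x =
      - mlieBracket I (extend E v) (mlieBracket I (extend E w) (extend E u)) x := by
    have := mlieBracket_const_smul_right (I := I) (V := extend E v) (c := (-1 : ℝ))
      (md (contMDiffAt_mlieBracket hw hu))
    simpa using this
  rw [s1, s2, s3] at J
  simp only [curvature_eq, fieldCurvature]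
  rw [key hu hv hw, key hv hw hu, key hw hu hv, J]
  abel

end Curvature

/-! ### Derivatives of 1-forms and of endomorphism fields -/

section FormsAndEndomorphisms

set_option linter.unusedSectionVars false

variable {E : Type*} [NormedAddCommGroup E] [NormedSpace ℝ E] [FiniteDimensional ℝ E]
  {H : Type*} [TopologicalSpace H] {I : ModelWithCorners ℝ E H}
  {M : Type*} [TopologicalSpace M] [ChartedSpace H M] [IsManifold I ∞ M]

lemma SmoothForm.contMDiffAt_apply {φ : Π x : M, TangentSpace I x →L[ℝ] ℝ} (hφ : SmoothForm I φ)
    {X : Π x : M, TangentSpace I x} {x : M} (hX : CMDiffAt ∞ (T% X) x) :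
    CMDiffAt ∞ (fun y ↦ φ y (X y)) x := by
  have h := ContMDiffAt.clm_bundle_apply (F₁ := E) (F₂ := ℝ)
    (E₁ := fun x : M ↦ TangentSpace I x) (E₂ := Bundle.Trivial M ℝ) (b := id)
    (hφ x) hX
  exact (contMDiffAt_section (F := ℝ) (E := Bundle.Trivial M ℝ) _).1 h

lemma SmoothEndOn.contMDiffAt_apply {A : Π x : M, TangentSpace I x →L[ℝ] TangentSpace I x}
    {U : Set M} {x : M} (hA : SmoothEndOn I U A) (hU : U ∈ 𝓝 x)
    {X : Π x : M, TangentSpace I x} (hX : CMDiffAt ∞ (T% X) x) :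
    CMDiffAt ∞ (T% (fun y ↦ A y (X y))) x :=
  ContMDiffAt.clm_bundle_apply (F₁ := E) (F₂ := E)
    (E₁ := fun x : M ↦ TangentSpace I x) (E₂ := fun x : M ↦ TangentSpace I x) (b := id)
    (hA.contMDiffAt hU) hX

lemma SmoothEndOn.mdifferentiableAt_apply
    {A : Π x : M, TangentSpace I x →L[ℝ] TangentSpace I x}
    {U : Set M} {x : M} (hA : SmoothEndOn I U A) (hU : U ∈ 𝓝 x)
    {X : Π x : M, TangentSpace I x} (hX : MDiffAt (T% X) x) :
    MDiffAt (T% (fun y ↦ A y (X y))) x :=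
  MDifferentiableAt.clm_bundle_apply (F₁ := E) (F₂ := E)
    (E₁ := fun x : M ↦ TangentSpace I x) (E₂ := fun x : M ↦ TangentSpace I x) (b := id)
    ((hA.contMDiffAt hU).mdifferentiableAt (by simp)) hX

variable [RiemannianBundle (fun x : M ↦ TangentSpace I x)]

/-- The vector field `φ♯` dual to a 1-form: `⟪φ♯, v⟫ = φ v`. -/
def sharp (φ : Π x : M, TangentSpace I x →L[ℝ] ℝ) (x : M) : TangentSpace I x :=
  ∑ i, φ x (stdOrthonormalBasis ℝ (TangentSpace I x) i) • stdOrthonormalBasis ℝ (TangentSpace I x) i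

lemma inner_sharp (φ : Π x : M, TangentSpace I x →L[ℝ] ℝ) (x : M) (v : TangentSpace I x) :
    ⟪sharp φ x, v⟫_ℝ = φ x v := by
  conv_rhs => rw [← (stdOrthonormalBasis ℝ (TangentSpace I x)).sum_repr v]
  simp only [sharp, sum_inner, real_inner_smul_left, map_sum, map_smul, smul_eq_mul,
    OrthonormalBasis.repr_apply_apply]
  exact Finset.sum_congr rfl fun i _ ↦ mul_comm _ _

variable [IsContMDiffRiemannianBundle I ∞ E (fun x : M ↦ TangentSpace I x)]

lemma contMDiffAt_sharp {φ : Π x : M, TangentSpace I x →L[ℝ] ℝ} (hφ : SmoothForm I φ) (x : M) :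
    CMDiffAt ∞ (T% (sharp φ)) x := by
  refine contMDiffAt_of_forall_inner fun Z hZ ↦ ?_
  simpa only [inner_sharp] using hφ.contMDiffAt_apply hZ

lemma covDerivForm_eq {φ : Π x : M, TangentSpace I x →L[ℝ] ℝ} (hφ : SmoothForm I φ) (x : M)
    (u v : TangentSpace I x) :
    covDerivForm I φ x u v = ⟪leviCivita I M (sharp φ) x u, v⟫_ℝ := by
  have h := leviCivita_metric ((contMDiffAt_sharp hφ x).mdifferentiableAt (by simp))
    (mdifferentiableAt_extend I E v) u
  simp only [inner_sharp, extend_apply_self] at h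
  rw [covDerivForm, h]
  ring

/-- The product rule for the covariant derivative of `A S`. -/
lemma leviCivita_endo_apply {A : Π x : M, TangentSpace I x →L[ℝ] TangentSpace I x}
    {U : Set M} {x : M} (hA : SmoothEndOn I U A) (hU : U ∈ 𝓝 x)
    {S : Π x : M, TangentSpace I x} (hS : MDiffAt (T% S) x) (u : TangentSpace I x) :
    leviCivita I M (fun y ↦ A y (S y)) x u =
      covDerivEnd I A x (S x) u + A x (leviCivita I M S x u) := by
  have ht : TensorialAt I E
      (fun S ↦ leviCivita I M (fun y ↦ A y (S y)) x u - A x (leviCivita I M S x u)) x :=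
    { smul := by
        intro f S hf hS
        have e : (fun y ↦ A y ((f • S) y)) = f • (fun y ↦ A y (S y)) := by
          funext y; exact (A y).map_smul _ _
        rw [e, leviCivita_smul hf (hA.mdifferentiableAt_apply hU hS), leviCivita_smul hf hS,
          map_add, map_smul, map_smul, smul_sub]
        abel
      add := by
        intro S S' hS hS'
        have e : (fun y ↦ A y ((S + S') y)) = (fun y ↦ A y (S y)) + (fun y ↦ A y (S' y)) := by
          funext y; exact (A y).map_add _ _
        rw [e, leviCivita_add (hA.mdifferentiableAt_apply hU hS)
          (hA.mdifferentiableAt_apply hU hS'), leviCivita_add hS hS', add_apply, add_apply, map_add]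
        abel }
  have h := ht.pointwise hS (mdifferentiableAt_extend I E (S x)) (by simp)
  simp only [covDerivEnd, sub_apply, ContinuousLinearMap.comp_apply]
  rw [← h]
  abel

end FormsAndEndomorphisms

/-! ### The derivative of a determinant -/

section Determinant

lemma hasFDerivAt_det {F ι : Type*} [NormedAddCommGroup F] [NormedSpace ℝ F] [Fintype ι]
    [DecidableEq ι] {G : F → Matrix ι ι ℝ} {G' : ι → F →L[ℝ] (ι → ℝ)} {x : F}
    (hG : ∀ i, HasFDerivAt (fun y ↦ G y i) (G' i) x) (v : F) :
    DifferentiableAt ℝ (fun y ↦ (G y).det) x ∧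
      fderiv ℝ (fun y ↦ (G y).det) x v = ∑ i, ((G x).updateRow i (G' i v)).det := by
  let D : ContinuousMultilinearMap ℝ (fun _ : ι ↦ ι → ℝ) ℝ :=
    ⟨(Matrix.detRowAlternating (n := ι) (R := ℝ)).toMultilinearMap,
      Continuous.matrix_det (A := fun m : ι → ι → ℝ ↦ Matrix.of m) continuous_id⟩
  have h := HasFDerivAt.multilinear_comp D hG
  refine ⟨h.differentiableAt, ?_⟩
  rw [show fderiv ℝ (fun y ↦ (G y).det) x = _ from h.fderiv]
  simp only [sum_apply, ContinuousLinearMap.comp_apply]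
  rfl

/-- If the derivative of `G` has the form `Γ G + G Γᵀ`, the logarithmic derivative of `det G`
is twice the trace of `Γ`. -/
lemma sum_det_updateRow {ι : Type*} [Fintype ι] [DecidableEq ι] (G Γ : Matrix ι ι ℝ) :
    ∑ i, (G.updateRow i ((Γ * G + G * Γ.transpose) i)).det = 2 * Γ.trace * G.det := by
  have h : ∀ H : Matrix ι ι ℝ, ∑ i, (G.updateRow i (H i)).det = (H * G.adjugate).trace := by
    intro H
    refine Finset.sum_congr rfl fun i _ ↦ ?_
    rw [← Matrix.cramer_transpose_apply, Matrix.cramer_eq_adjugate_mulVec,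
      ← Matrix.adjugate_transpose,
      Matrix.diag_apply, Matrix.mul_apply, Matrix.mulVec, dotProduct]
    exact Finset.sum_congr rfl fun j _ ↦ by rw [Matrix.transpose_apply, mul_comm]
  rw [h, add_mul, Matrix.trace_add, mul_assoc, Matrix.mul_adjugate, mul_assoc,
    Matrix.trace_mul_comm G, mul_assoc, Matrix.adjugate_mul]
  simp
  ring

end Determinant

/-! ### Coordinate vector fields -/

section CoordinateFrame

set_option linter.unusedSectionVars false

variable {E : Type*} [NormedAddCommGroup E] [NormedSpace ℝ E] [FiniteDimensional ℝ E]
  {M : Type*} [TopologicalSpace M] [ChartedSpace E M] [IsManifold 𝓘(ℝ, E) ∞ M]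

/-- The frame of coordinate vector fields of the chart at `p`, extended by zero. -/
def coordFrame (p : M) (i : Fin (finrank ℝ E)) : Π x : M, TangentSpace 𝓘(ℝ, E) x :=
  (trivializationAt E (TangentSpace 𝓘(ℝ, E)) p).localFrame (finBasis ℝ E) i

/-- The coordinates of a tangent vector with respect to `coordFrame p`. -/
def coord (p : M) (i : Fin (finrank ℝ E)) (x : M) : TangentSpace 𝓘(ℝ, E) x →ₗ[ℝ] ℝ :=
  (trivializationAt E (TangentSpace 𝓘(ℝ, E)) p).localFrameCoeff 𝓘(ℝ, E) (finBasis ℝ E) i x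

variable {p x : M}

lemma contMDiffAt_coordFrame (hx : x ∈ (chartAt E p).source) (i : Fin (finrank ℝ E)) :
    CMDiffAt ∞ (T% (coordFrame p i)) x :=
  contMDiffAt_localFrame_of_mem ∞ (trivializationAt E (TangentSpace 𝓘(ℝ, E)) p)
    (finBasis ℝ E) i (by simpa using hx)

lemma contMDiffAt_coord (hx : x ∈ (chartAt E p).source) (i : Fin (finrank ℝ E))
    {X : Π x : M, TangentSpace 𝓘(ℝ, E) x} (hX : CMDiffAt ∞ (T% X) x) :
    CMDiffAt ∞ (fun y ↦ coord p i y (X y)) x :=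
  contMDiffAt_localFrameCoeff (e := trivializationAt E (TangentSpace 𝓘(ℝ, E)) p)
    (finBasis ℝ E) (by simpa using hx) hX i

lemma sum_coord_smul (hx : x ∈ (chartAt E p).source) (v : TangentSpace 𝓘(ℝ, E) x) :
    ∑ i, coord p i x v • coordFrame p i x = v := by
  have h := ((trivializationAt E (TangentSpace 𝓘(ℝ, E)) p).isLocalFrameOn_localFrame_baseSet
    𝓘(ℝ, E) 1 (finBasis ℝ E)).coeff_sum_eq (x := x) (extend E v) (by simpa using hx)
  rw [extend_apply_self] at h
  exact h.symm

lemma linearIndependent_coordFrame (hx : x ∈ (chartAt E p).source) :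
    LinearIndependent ℝ
      (fun i : Fin (finrank ℝ E) ↦ (coordFrame p i x : TangentSpace 𝓘(ℝ, E) x)) :=
  ((trivializationAt E (TangentSpace 𝓘(ℝ, E)) p).isLocalFrameOn_localFrame_baseSet
    𝓘(ℝ, E) 1 (finBasis ℝ E)).linearIndependent (by simpa using hx)

lemma coord_coordFrame (hx : x ∈ (chartAt E p).source) (i j : Fin (finrank ℝ E)) :
    coord p i x (coordFrame p j x) = if i = j then 1 else 0 := by
  have h := sum_coord_smul hx (coordFrame p j x)
  have h' : ∑ i, (coord p i x (coordFrame p j x) - if i = j then 1 else 0) •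
      coordFrame p i x = 0 := by
    simp [sub_smul, Finset.sum_sub_distrib, h]
  exact sub_eq_zero.1 (Fintype.linearIndependent_iff.1 (linearIndependent_coordFrame hx) _ h' i)

/-- The basis of coordinate vectors. -/
def coordBasis (hx : x ∈ (chartAt E p).source) :
    Basis (Fin (finrank ℝ E)) ℝ (TangentSpace 𝓘(ℝ, E) x) :=
  Basis.mk (linearIndependent_coordFrame hx) fun v _ ↦ by
    rw [← sum_coord_smul hx v]
    exact Submodule.sum_mem _ fun i _ ↦ Submodule.smul_mem _ _ (Submodule.subset_span ⟨i, rfl⟩)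

lemma trace_eq_sum_coord (hx : x ∈ (chartAt E p).source)
    (T : TangentSpace 𝓘(ℝ, E) x →L[ℝ] TangentSpace 𝓘(ℝ, E) x) :
    LinearMap.trace ℝ (TangentSpace 𝓘(ℝ, E) x) T = ∑ i, coord p i x (T (coordFrame p i x)) := by
  rw [LinearMap.trace_eq_matrix_trace ℝ (coordBasis hx), Matrix.trace]
  refine Finset.sum_congr rfl fun i _ ↦ ?_
  have hr : ∀ v, (coordBasis hx).repr v i = coord p i x v := by
    intro v
    conv_lhs => rw [← sum_coord_smul hx v]
    have : ∀ j, coordFrame p j x = coordBasis hx j := fun j ↦ by simp [coordBasis]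
    simp [this, Finsupp.single_apply]
  rw [Matrix.diag_apply, LinearMap.toMatrix_apply, hr]
  simp [coordBasis]

lemma coordFrame_eq (hx : x ∈ (chartAt E p).source) (i : Fin (finrank ℝ E)) :
    coordFrame p i x =
      mfderiv 𝓘(ℝ, E) 𝓘(ℝ, E) (chartAt E p).symm (chartAt E p x) (finBasis ℝ E i) := by
  have h := TangentBundle.symmL_trivializationAt (I := 𝓘(ℝ, E)) hx
  simp only [mfld_simps, mfderivWithin_univ] at h
  have h' := (trivializationAt E (TangentSpace 𝓘(ℝ, E)) p).localFrame_apply_of_mem_baseSet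
    (finBasis ℝ E) (i := i) (x := x) (by simpa using hx)
  rw [← h]
  refine h'.trans ?_
  simp only [Trivialization.basisAt, Basis.map_apply]
  exact (Trivialization.symmL_apply _ (by simpa using hx) _).symm

/-- On functions, `coordFrame p` acts by the partial derivatives in the chart at `p`. -/
lemma mvfderiv_coordFrame {f : M → ℝ} (hx : x ∈ (chartAt E p).source) (hf : MDiffAt f x)
    (i : Fin (finrank ℝ E)) :
    d% f x (coordFrame p i x) =
      fderiv ℝ (f ∘ (chartAt E p).symm) (chartAt E p x) (finBasis ℝ E i) := by
  have hy : chartAt E p x ∈ (chartAt E p).target := (chartAt E p).map_source hx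
  have hxy : (chartAt E p).symm (chartAt E p x) = x := (chartAt E p).left_inv hx
  have hs : MDiffAt (chartAt E p).symm (chartAt E p x) :=
    mdifferentiableAt_atlas_symm (chart_mem_atlas E p) hy
  have hc := mfderiv_comp (I := 𝓘(ℝ, E)) (I' := 𝓘(ℝ, E)) (I'' := 𝓘(ℝ, ℝ)) (chartAt E p x)
    (g := f) (by rwa [hxy]) hs
  rw [coordFrame_eq hx, ← mfderiv_eq_fderiv, hc]
  let g : M → E →L[ℝ] ℝ := fun z ↦ mfderiv 𝓘(ℝ, E) 𝓘(ℝ, ℝ) f z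
  exact congrArg (fun L : E →L[ℝ] ℝ ↦ L (mfderiv 𝓘(ℝ, E) 𝓘(ℝ, E) (chartAt E p).symm
    (chartAt E p x) (finBasis ℝ E i))) (congrArg g hxy).symm

/-- The coordinates of a tangent vector are the derivatives of the coordinate functions. -/
lemma mvfderiv_coord_chartAt {y : M} (hy : y ∈ (chartAt E p).source) (k : Fin (finrank ℝ E))
    (w : TangentSpace 𝓘(ℝ, E) y) :
    d% (fun z ↦ (finBasis ℝ E).coord k (chartAt E p z)) y w = coord p k y w := by
  have hd : MDiffAt (fun z ↦ (finBasis ℝ E).coord k (chartAt E p z)) y := by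
    have h1 : MDiffAt (chartAt E p) y := mdifferentiableAt_atlas (chart_mem_atlas E p) hy
    exact ((LinearMap.toContinuousLinearMap ((finBasis ℝ E).coord k)).mdifferentiableAt).comp y h1
  conv_lhs => rw [← sum_coord_smul hy w]
  rw [map_sum]
  simp only [map_smul, mvfderiv_coordFrame hy hd]
  have : ∀ l, fderiv ℝ ((fun z ↦ (finBasis ℝ E).coord k (chartAt E p z)) ∘ (chartAt E p).symm)
      (chartAt E p y) (finBasis ℝ E l) = if k = l then 1 else 0 := by
    intro l
    have e : ((fun z ↦ (finBasis ℝ E).coord k (chartAt E p z)) ∘ (chartAt E p).symm)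
        =ᶠ[𝓝 (chartAt E p y)]
        LinearMap.toContinuousLinearMap ((finBasis ℝ E).coord k) := by
      filter_upwards [(chartAt E p).open_target.mem_nhds ((chartAt E p).map_source hy)] with z hz
      simp [(chartAt E p).right_inv hz]
    rw [e.fderiv_eq, ContinuousLinearMap.fderiv]
    simp [Finsupp.single_apply, eq_comm]
  simp only [this]
  simp

/-- Coordinate vector fields commute. -/
lemma mlieBracket_coordFrame (hx : x ∈ (chartAt E p).source) (i j : Fin (finrank ℝ E)) :
    mlieBracket 𝓘(ℝ, E) (coordFrame p i) (coordFrame p j) x = 0 := by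
  set v := mlieBracket 𝓘(ℝ, E) (coordFrame p i) (coordFrame p j) x with hv
  have hsource := (chartAt E p).open_source.mem_nhds hx
  have h0 : ∀ k, coord p k x v = 0 := by
    intro k
    have hs : CMDiffAt ∞ (fun z ↦ (finBasis ℝ E).coord k (chartAt E p z)) x := by
      have h1 : CMDiffAt ∞ (chartAt E p) x := contMDiffAt_of_mem_maximalAtlas
        (IsManifold.chart_mem_maximalAtlas p) hx
      exact ((LinearMap.toContinuousLinearMap ((finBasis ℝ E).coord k)).contMDiff.contMDiffAt).comp
        x h1
    rw [← mvfderiv_coord_chartAt hx, hv, mvfderiv_mlieBracket hs (contMDiffAt_coordFrame hx i)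
      (contMDiffAt_coordFrame hx j)]
    have hc : ∀ l, d% (fun y ↦ d% (fun z ↦ (finBasis ℝ E).coord k (chartAt E p z)) y
        (coordFrame p l y)) x = 0 := by
      intro l
      have e : (fun y ↦ d% (fun z ↦ (finBasis ℝ E).coord k (chartAt E p z)) y
        (coordFrame p l y)) =ᶠ[𝓝 x] fun _ ↦ if k = l then (1 : ℝ) else 0 := by
        filter_upwards [hsource] with y hy
        rw [mvfderiv_coord_chartAt hy, coord_coordFrame hy]
      rw [mvfderiv_congr e]
      exact mvfderiv_const _
    rw [hc, hc]
    simp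
  rw [← sum_coord_smul hx v]
  simp [h0]

end CoordinateFrame

/-! ### The divergence of a vector field -/

section Divergence

set_option linter.unusedSectionVars false

variable {E : Type*} [NormedAddCommGroup E] [NormedSpace ℝ E] [FiniteDimensional ℝ E]
  {M : Type*} [TopologicalSpace M] [ChartedSpace E M] [IsManifold 𝓘(ℝ, E) ∞ M]
  [RiemannianBundle (fun x : M ↦ TangentSpace 𝓘(ℝ, E) x)]

/-- The Gram matrix of the coordinate frame. -/
def gramMatrix (p x : M) : Matrix (Fin (finrank ℝ E)) (Fin (finrank ℝ E)) ℝ :=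
  Matrix.gram ℝ fun i ↦ (coordFrame p i x : TangentSpace 𝓘(ℝ, E) x)

/-- The density of the Riemannian volume with respect to Lebesgue measure in the chart at `p`. -/
def density (p x : M) : ℝ := √(gramMatrix (E := E) p x).det

variable {p x : M}

lemma det_gramMatrix_pos (hx : x ∈ (chartAt E p).source) : 0 < (gramMatrix (E := E) p x).det := by
  have h1 : 0 ≤ (gramMatrix (E := E) p x).det := by
    have h := Matrix.posSemidef_gram ℝ fun i ↦ (coordFrame p i x : TangentSpace 𝓘(ℝ, E) x)
    exact h.det_nonneg
  have h2 : (gramMatrix (E := E) p x).det ≠ 0 := by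
    refine (Matrix.det_gram_ne_zero_iff_linearIndependent).2 ?_
    exact linearIndependent_coordFrame hx
  exact lt_of_le_of_ne h1 h2.symm

lemma density_pos (hx : x ∈ (chartAt E p).source) : 0 < density (E := E) p x :=
  Real.sqrt_pos.2 (det_gramMatrix_pos hx)

variable [IsContMDiffRiemannianBundle 𝓘(ℝ, E) ∞ E (fun x : M ↦ TangentSpace 𝓘(ℝ, E) x)]

lemma contMDiffAt_gramMatrix (hx : x ∈ (chartAt E p).source) (i j : Fin (finrank ℝ E)) :
    CMDiffAt ∞ (fun y ↦ gramMatrix (E := E) p y i j) x :=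
  ContMDiffAt.inner_bundle (F := E) (E := fun x : M ↦ TangentSpace 𝓘(ℝ, E) x)
    (contMDiffAt_coordFrame hx i) (contMDiffAt_coordFrame hx j)

lemma contMDiffAt_density (hx : x ∈ (chartAt E p).source) :
    CMDiffAt ∞ (density (E := E) p) x :=
  ContMDiffAt.comp x (g := fun t : ℝ ↦ √t)
    (Real.contDiffAt_sqrt (det_gramMatrix_pos hx).ne').contMDiffAt
    (contMDiffAt_det (contMDiffAt_gramMatrix hx))

/-- The divergence of a vector field, the trace of `u ↦ ∇_u X`. -/
def divergence (X : Π x : M, TangentSpace 𝓘(ℝ, E) x) (x : M) : ℝ :=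
  LinearMap.trace ℝ (TangentSpace 𝓘(ℝ, E) x)
    (leviCivita 𝓘(ℝ, E) M X x : TangentSpace 𝓘(ℝ, E) x →L[ℝ] TangentSpace 𝓘(ℝ, E) x)

variable {X Y : Π x : M, TangentSpace 𝓘(ℝ, E) x} {f : M → ℝ}

lemma divergence_congr (hX : MDiffAt (T% X) x) (h : X =ᶠ[𝓝 x] Y) :
    divergence X x = divergence Y x := by
  rw [divergence, leviCivita_congr hX h, divergence]

lemma divergence_zero : divergence (fun y : M ↦ (0 : TangentSpace 𝓘(ℝ, E) y)) x = 0 := by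
  have h0 : leviCivita 𝓘(ℝ, E) M (fun y : M ↦ (0 : TangentSpace 𝓘(ℝ, E) y)) x = 0 :=
    (leviCivita 𝓘(ℝ, E) M).isCovariantDerivativeOnUniv.zero (mem_univ x)
  rw [divergence, h0]
  exact map_zero _

lemma divergence_add (hX : MDiffAt (T% X) x) (hY : MDiffAt (T% Y) x) :
    divergence (X + Y) x = divergence X x + divergence Y x := by
  rw [divergence, leviCivita_add hX hY]
  exact map_add _ _ _

lemma divergence_smul (hf : MDiffAt f x) (hX : MDiffAt (T% X) x) :
    divergence (f • X) x = f x * divergence X x + d% f x (X x) := by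
  have h : ((leviCivita 𝓘(ℝ, E) M (f • X) x :
      TangentSpace 𝓘(ℝ, E) x →L[ℝ] TangentSpace 𝓘(ℝ, E) x) :
      TangentSpace 𝓘(ℝ, E) x →ₗ[ℝ] TangentSpace 𝓘(ℝ, E) x) =
      f x • ((leviCivita 𝓘(ℝ, E) M X x : TangentSpace 𝓘(ℝ, E) x →L[ℝ] TangentSpace 𝓘(ℝ, E) x) :
        TangentSpace 𝓘(ℝ, E) x →ₗ[ℝ] TangentSpace 𝓘(ℝ, E) x)
      + ((d% f x : TangentSpace 𝓘(ℝ, E) x →L[ℝ] ℝ) :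
        TangentSpace 𝓘(ℝ, E) x →ₗ[ℝ] ℝ).smulRight (X x) := by
    ext u
    exact leviCivita_smul hf hX u
  rw [divergence, h, map_add, map_smul, LinearMap.trace_smulRight]
  rfl

lemma contMDiffAt_divergence (hX : ∀ x, CMDiffAt ∞ (T% X) x) (x : M) :
    CMDiffAt ∞ (divergence X) x := by
  have hx := mem_chart_source E x
  have h : divergence X =ᶠ[𝓝 x] fun y ↦
      ∑ i, coord x i y (leviCivita 𝓘(ℝ, E) M X y (coordFrame x i y)) := by
    filter_upwards [(chartAt E x).open_source.mem_nhds hx] with y hy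
    exact trace_eq_sum_coord hy _
  refine ContMDiffAt.congr_of_eventuallyEq (ContMDiffAt.sum fun i _ ↦ ?_) h
  exact contMDiffAt_coord hx i (contMDiffAt_leviCivita (contMDiffAt_coordFrame hx i) (hX x))

/-- The logarithmic derivative of the volume density in a coordinate direction is the divergence
of the coordinate vector field. -/
lemma mvfderiv_density (hx : x ∈ (chartAt E p).source) (k : Fin (finrank ℝ E)) :
    d% (density (E := E) p) x (coordFrame p k x) =
      divergence (coordFrame p k) x * density (E := E) p x := by
  have md : ∀ {f : M → ℝ}, CMDiffAt ∞ f x → MDiffAt f x := fun h ↦ h.mdifferentiableAt (by simp)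
  have ms : ∀ i, MDiffAt (T% (coordFrame (E := E) p i)) x :=
    fun i ↦ (contMDiffAt_coordFrame hx i).mdifferentiableAt (by simp)
  have hsymm : (chartAt E p).symm (chartAt E p x) = x := (chartAt E p).left_inv hx
  have hdiff : ∀ {f : M → ℝ}, CMDiffAt ∞ f x →
      DifferentiableAt ℝ (f ∘ (chartAt E p).symm) (chartAt E p x) := by
    intro f hf
    have hs : MDiffAt (chartAt E p).symm (chartAt E p x) :=
      mdifferentiableAt_atlas_symm (chart_mem_atlas E p) ((chartAt E p).map_source hx)
    exact (MDifferentiableAt.comp _ (by rw [hsymm]; exact md hf) hs).differentiableAt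
  set y := chartAt E p x with hy
  set b := finBasis ℝ E k with hb
  set Γ : Matrix (Fin (finrank ℝ E)) (Fin (finrank ℝ E)) ℝ := Matrix.of fun i l ↦
    coord p l x (leviCivita 𝓘(ℝ, E) M (coordFrame p i) x (coordFrame p k x)) with hΓ
  have hder : ∀ i j, fderiv ℝ ((fun z ↦ gramMatrix (E := E) p z i j) ∘ (chartAt E p).symm) y b =
      (Γ * gramMatrix (E := E) p x + gramMatrix (E := E) p x * Γ.transpose) i j := by
    intro i j
    rw [← mvfderiv_coordFrame hx (md (contMDiffAt_gramMatrix hx i j))]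
    have h1 := leviCivita_metric (ms i) (ms j) (coordFrame p k x)
    refine h1.trans ?_
    rw [Matrix.add_apply, Matrix.mul_apply, Matrix.mul_apply]
    conv_lhs =>
      rw [← sum_coord_smul hx (leviCivita 𝓘(ℝ, E) M (coordFrame p i) x (coordFrame p k x)),
        ← sum_coord_smul hx (leviCivita 𝓘(ℝ, E) M (coordFrame p j) x (coordFrame p k x))]
    rw [sum_inner, inner_sum]
    simp only [real_inner_smul_left, real_inner_smul_right, hΓ, gramMatrix, Matrix.gram_apply,
      Matrix.of_apply, Matrix.transpose_apply]
    congr 1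
    exact Finset.sum_congr rfl fun _ _ ↦ mul_comm _ _
  have hG : ∀ i, HasFDerivAt (fun z ↦ gramMatrix (E := E) p ((chartAt E p).symm z) i)
      (ContinuousLinearMap.pi fun j ↦
        fderiv ℝ ((fun z ↦ gramMatrix (E := E) p z i j) ∘ (chartAt E p).symm) y) y := fun i ↦
    hasFDerivAt_pi.2 fun j ↦ (hdiff (contMDiffAt_gramMatrix hx i j)).hasFDerivAt
  obtain ⟨hd, hdet⟩ := hasFDerivAt_det hG b
  have hrow : ∀ i, (ContinuousLinearMap.pi fun j ↦
        fderiv ℝ ((fun z ↦ gramMatrix (E := E) p z i j) ∘ (chartAt E p).symm) y) b =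
      (Γ * gramMatrix (E := E) p x + gramMatrix (E := E) p x * Γ.transpose) i := by
    intro i; funext j; exact hder i j
  simp only [hrow, hsymm, sum_det_updateRow] at hdet
  have htrace : Γ.trace = divergence (coordFrame p k) x := by
    rw [divergence, trace_eq_sum_coord hx, Matrix.trace]
    refine Finset.sum_congr rfl fun i _ ↦ ?_
    have h1 := leviCivita_sub_swap (ms i) (ms k)
    rw [mlieBracket_coordFrame hx, sub_eq_zero] at h1
    rw [h1]
    rfl
  have hpos := det_gramMatrix_pos (E := E) hx
  have hw : fderiv ℝ (density (E := E) p ∘ (chartAt E p).symm) y b = _ :=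
    congrArg (fun L : E →L[ℝ] ℝ ↦ L b) (fderiv_sqrt hd (by rw [hsymm]; exact hpos.ne'))
  rw [mvfderiv_coordFrame hx (md (contMDiffAt_density hx)), hw, smul_apply, hdet, hsymm, htrace,
    density, smul_eq_mul]
  have hs := Real.sqrt_pos.2 hpos
  field_simp
  rw [Real.sq_sqrt hpos.le, mul_comm]

/-- In a chart, `w div X = ∑ ∂ᵢ (w Xⁱ)` with the volume density `w`; so `div X` integrates to zero
when `X` is supported in the chart. -/
lemma divergence_mul_density (hx : x ∈ (chartAt E p).source) (hX : CMDiffAt ∞ (T% X) x) :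
    divergence X x * density (E := E) p x =
      ∑ i, d% (fun y ↦ coord p i y (X y) * density (E := E) p y) x (coordFrame p i x) := by
  have md : ∀ {f : M → ℝ}, CMDiffAt ∞ f x → MDiffAt f x := fun h ↦ h.mdifferentiableAt (by simp)
  have ms : ∀ i, MDiffAt (T% (coordFrame (E := E) p i)) x :=
    fun i ↦ (contMDiffAt_coordFrame hx i).mdifferentiableAt (by simp)
  have hc := fun i ↦ md (contMDiffAt_coord hx i hX)
  have hsum : X =ᶠ[𝓝 x] fun y ↦ ∑ i, ((fun z ↦ coord p i z (X z)) • coordFrame p i) y := by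
    filter_upwards [(chartAt E p).open_source.mem_nhds hx] with y hy
    exact (sum_coord_smul hy (X y)).symm
  have hdiv : divergence X x =
      ∑ i, divergence ((fun z ↦ coord p i z (X z)) • coordFrame p i) x := by
    rw [divergence_congr (hX.mdifferentiableAt (by simp)) hsum]
    have : ∀ s : Finset (Fin (finrank ℝ E)),
        MDiffAt (T% fun y ↦ ∑ i ∈ s, ((fun z ↦ coord p i z (X z)) • coordFrame p i) y) x ∧
        divergence (fun y ↦ ∑ i ∈ s, ((fun z ↦ coord p i z (X z)) • coordFrame p i) y) x =
          ∑ i ∈ s, divergence ((fun z ↦ coord p i z (X z)) • coordFrame p i) x := by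
      intro s
      induction s using Finset.cons_induction with
      | empty =>
        simp only [Finset.sum_empty]
        refine ⟨?_, divergence_zero⟩
        exact (contMDiff_zeroSection ℝ (TangentSpace 𝓘(ℝ, E))).mdifferentiable (n := ∞) (by simp) x
      | cons a s ha ih =>
        have h1 := (hc a).smul_section (ms a)
        simp only [Finset.sum_cons]
        exact ⟨mdifferentiableAt_add_section h1 ih.1, (divergence_add h1 ih.1).trans (by rw [ih.2])⟩
    exact (this Finset.univ).2
  rw [hdiv, Finset.sum_mul]
  refine Finset.sum_congr rfl fun i _ ↦ ?_
  rw [divergence_smul (hc i) (ms i), mvfderiv_fun_mul (hc i) (md (contMDiffAt_density hx))]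
  simp only [add_apply, smul_apply, smul_eq_mul]
  rw [mvfderiv_density hx]
  ring

end Divergence

/-! ### Integration in charts -/

section Integration

open MeasureTheory

set_option linter.unusedSectionVars false

variable {E : Type*} [NormedAddCommGroup E] [NormedSpace ℝ E] [FiniteDimensional ℝ E]

/-- The integral of a directional derivative of a compactly supported function vanishes. -/
lemma integral_fderiv_eq_zero [MeasurableSpace E] [BorelSpace E] (μ : Measure E)
    [μ.IsAddHaarMeasure] {g : E → ℝ} (hg : ContDiff ℝ 1 g) (hs : HasCompactSupport g) (v : E) :
    Integrable (fun y ↦ fderiv ℝ g y v) μ ∧ ∫ y, fderiv ℝ g y v ∂μ = 0 := by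
  have hi : Integrable (fun y ↦ fderiv ℝ g y v) μ := by
    refine Continuous.integrable_of_hasCompactSupport ?_ (hs.fderiv_apply (𝕜 := ℝ) v)
    exact (hg.continuous_fderiv (by simp)).clm_apply continuous_const
  refine ⟨hi, ?_⟩
  have h := integral_mul_fderiv_eq_neg_fderiv_mul_of_integrable (μ := μ) (f := fun _ : E ↦ (1 : ℝ))
    (g := g) (v := v) (by simp) (by simpa using hi)
    (by simpa using hg.continuous.integrable_of_hasCompactSupport hs)
    (fun _ _ ↦ differentiableAt_const _) (fun _ _ ↦ (hg.differentiable (by simp)).differentiableAt)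
  simpa using h

variable {M : Type*} [TopologicalSpace M] [ChartedSpace E M] [IsManifold 𝓘(ℝ, E) ∞ M]
  [RiemannianBundle (fun x : M ↦ TangentSpace 𝓘(ℝ, E) x)]

/-- A function on `M`, multiplied by the volume density, in the chart at `p`, extended by zero. Its
integral over `E` is the Riemannian integral of the function over the domain of the chart. -/
def chartFun (p : M) (F : M → ℝ) : E → ℝ :=
  (chartAt E p).target.indicator fun y ↦
    F ((chartAt E p).symm y) * density (E := E) p ((chartAt E p).symm y)

lemma tsupport_chartFun_subset [T2Space M] [CompactSpace M] {p : M} {F : M → ℝ}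
    (hF : tsupport F ⊆ (chartAt E p).source) :
    IsCompact (tsupport (chartFun (E := E) p F)) ∧
      tsupport (chartFun (E := E) p F) ⊆ (chartAt E p).target := by
  have hK : IsCompact (chartAt E p '' tsupport F) :=
    (isClosed_tsupport F).isCompact.image_of_continuousOn ((chartAt E p).continuousOn.mono hF)
  have hsub : tsupport (chartFun (E := E) p F) ⊆ chartAt E p '' tsupport F := by
    refine closure_minimal (fun y hy ↦ ?_) hK.isClosed
    have hyt : y ∈ (chartAt E p).target := by
      by_contra h
      exact hy (indicator_of_notMem h _)
    refine ⟨(chartAt E p).symm y, subset_tsupport F fun h0 ↦ hy ?_, (chartAt E p).right_inv hyt⟩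
    simp [chartFun, h0]
  exact ⟨hK.of_isClosed_subset (isClosed_tsupport _) hsub,
    hsub.trans (by rintro _ ⟨x, hx, rfl⟩; exact (chartAt E p).map_source (hF hx))⟩

variable [IsContMDiffRiemannianBundle 𝓘(ℝ, E) ∞ E (fun x : M ↦ TangentSpace 𝓘(ℝ, E) x)]

lemma contDiff_chartFun [T2Space M] [CompactSpace M] {p : M} {F : M → ℝ}
    (hF : tsupport F ⊆ (chartAt E p).source)
    (hs : ∀ x ∈ (chartAt E p).source, CMDiffAt ∞ F x) : ContDiff ℝ 1 (chartFun (E := E) p F) := by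
  rw [contDiff_iff_contDiffAt]
  intro y
  by_cases hy : y ∈ (chartAt E p).target
  · have hx := (chartAt E p).map_target hy
    have h1 : CMDiffAt ∞ (fun x ↦ F x * density (E := E) p x) ((chartAt E p).symm y) :=
      (hs _ hx).mul (contMDiffAt_density hx)
    have h2 : CMDiffAt ∞ (chartAt E p).symm y :=
      contMDiffAt_symm_of_mem_maximalAtlas (IsManifold.chart_mem_maximalAtlas p) hy
    refine ContDiffAt.congr_of_eventuallyEq ((h1.comp y h2).contDiffAt.of_le (by simp)) ?_
    filter_upwards [(chartAt E p).open_target.mem_nhds hy] with z hz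
    simp [chartFun, hz]
  · have h : y ∉ tsupport (chartFun (E := E) p F) := fun h ↦ hy ((tsupport_chartFun_subset hF).2 h)
    exact (contDiffAt_const (c := (0 : ℝ))).congr_of_eventuallyEq
      (notMem_tsupport_iff_eventuallyEq.1 h)

/-- The volume densities of two charts differ by the Jacobian determinant of the transition map. -/
lemma density_eq_abs_det_mul {p q x : M} (hp : x ∈ (chartAt E p).source)
    (hq : x ∈ (chartAt E q).source) :
    density (E := E) p x =
      |(fderiv ℝ ((chartAt E q) ∘ (chartAt E p).symm) (chartAt E p x)).det| *
        density (E := E) q x := by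
  set T := fderiv ℝ ((chartAt E q) ∘ (chartAt E p).symm) (chartAt E p x) with hT
  have hsymm : (chartAt E p).symm (chartAt E p x) = x := (chartAt E p).left_inv hp
  have hd : DifferentiableAt ℝ ((chartAt E q) ∘ (chartAt E p).symm) (chartAt E p x) := by
    have hs : MDiffAt (chartAt E p).symm (chartAt E p x) :=
      mdifferentiableAt_atlas_symm (chart_mem_atlas E p) ((chartAt E p).map_source hp)
    have h1 : MDiffAt (chartAt E q) x := mdifferentiableAt_atlas (chart_mem_atlas E q) hq
    exact (MDifferentiableAt.comp _ (by rwa [hsymm]) hs).differentiableAt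
  set A := LinearMap.toMatrix (finBasis ℝ E) (finBasis ℝ E) (T : E →ₗ[ℝ] E) with hA
  have hcoord : ∀ i j, coord q j x (coordFrame p i x) = A j i := by
    intro i j
    have hm : MDiffAt (fun z ↦ (finBasis ℝ E).coord j (chartAt E q z)) x := by
      have h1 : MDiffAt (chartAt E q) x := mdifferentiableAt_atlas (chart_mem_atlas E q) hq
      exact ((LinearMap.toContinuousLinearMap ((finBasis ℝ E).coord j)).mdifferentiableAt).comp x h1
    rw [← mvfderiv_coord_chartAt hq, mvfderiv_coordFrame hp hm]
    have h2 := ((LinearMap.toContinuousLinearMap ((finBasis ℝ E).coord j)).hasFDerivAt.comp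
      (chartAt E p x) hd.hasFDerivAt).fderiv
    refine (congrArg (fun L : E →L[ℝ] ℝ ↦ L (finBasis ℝ E i)) h2).trans ?_
    simp [hA, LinearMap.toMatrix_apply, hT]
  have hgram : gramMatrix (E := E) p x = A.transpose * gramMatrix (E := E) q x * A := by
    ext i j
    have h1 : gramMatrix (E := E) p x i j = ⟪coordFrame p i x, coordFrame p j x⟫_ℝ := rfl
    have h2 : ∀ k l, gramMatrix (E := E) q x k l = ⟪coordFrame q k x, coordFrame q l x⟫_ℝ :=
      fun _ _ ↦ rfl
    rw [h1, ← sum_coord_smul hq (coordFrame p i x), ← sum_coord_smul hq (coordFrame p j x)]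
    simp only [hcoord, sum_inner, inner_sum, Matrix.mul_apply, Matrix.transpose_apply, h2,
      Finset.sum_mul, real_inner_smul_left, real_inner_smul_right]
    exact Finset.sum_congr rfl fun k _ ↦ Finset.sum_congr rfl fun l _ ↦ by ring
  have hdet : A.det = T.det := by
    rw [hA, LinearMap.det_toMatrix]
  rw [density, hgram, Matrix.det_mul, Matrix.det_mul, Matrix.det_transpose, hdet,
    show T.det * (gramMatrix (E := E) q x).det * T.det =
      T.det ^ 2 * (gramMatrix (E := E) q x).det by ring,
    Real.sqrt_mul (sq_nonneg _), Real.sqrt_sq_eq_abs, density]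

variable [MeasurableSpace E] [BorelSpace E] (μ : Measure E) [μ.IsAddHaarMeasure]

/-- The integral against the volume density does not depend on the chart. -/
lemma integral_chartFun_eq {p q : M} {F : M → ℝ}
    (hp : ∀ x, x ∉ (chartAt E p).source → F x = 0) (hq : ∀ x, x ∉ (chartAt E q).source → F x = 0) :
    ∫ y, chartFun (E := E) p F y ∂μ = ∫ y, chartFun (E := E) q F y ∂μ := by
  set T := (chartAt E p).symm.trans (chartAt E q) with hT
  have hs : ∀ y, y ∈ T.source ↔
      y ∈ (chartAt E p).target ∧ (chartAt E p).symm y ∈ (chartAt E q).source := by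
    intro y; simp [hT]
  have ht : ∀ y, y ∈ T.target ↔
      y ∈ (chartAt E q).target ∧ (chartAt E q).symm y ∈ (chartAt E p).source := by
    intro y; simp [hT]
  have hsm : MeasurableSet T.source := T.open_source.measurableSet
  have htm : MeasurableSet T.target := T.open_target.measurableSet
  have e1 : chartFun (E := E) p F = T.source.indicator fun y ↦
      F ((chartAt E p).symm y) * density (E := E) p ((chartAt E p).symm y) := by
    funext y
    by_cases h1 : y ∈ (chartAt E p).target
    · by_cases h2 : (chartAt E p).symm y ∈ (chartAt E q).source
      · simp [chartFun, h1, (hs y).2 ⟨h1, h2⟩]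
      · simp [chartFun, hq _ h2, indicator]
    · rw [chartFun, indicator_of_notMem h1, indicator_of_notMem fun h ↦ h1 ((hs y).1 h).1]
  have e2 : chartFun (E := E) q F = T.target.indicator fun y ↦
      F ((chartAt E q).symm y) * density (E := E) q ((chartAt E q).symm y) := by
    funext y
    by_cases h1 : y ∈ (chartAt E q).target
    · by_cases h2 : (chartAt E q).symm y ∈ (chartAt E p).source
      · simp [chartFun, h1, (ht y).2 ⟨h1, h2⟩]
      · simp [chartFun, hp _ h2, indicator]
    · rw [chartFun, indicator_of_notMem h1, indicator_of_notMem fun h ↦ h1 ((ht y).1 h).1]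
  rw [e1, e2, integral_indicator hsm, integral_indicator htm]
  have hd : ∀ y ∈ T.source, HasFDerivAt T (fderiv ℝ T y) y := by
    intro y hy
    obtain ⟨h1, h2⟩ := (hs y).1 hy
    have k1 : MDiffAt (chartAt E p).symm y := mdifferentiableAt_atlas_symm (chart_mem_atlas E p) h1
    have k2 : MDiffAt (chartAt E q) ((chartAt E p).symm y) :=
      mdifferentiableAt_atlas (chart_mem_atlas E q) h2
    exact (MDifferentiableAt.comp y k2 k1).differentiableAt.hasFDerivAt
  rw [integral_target_eq_integral_abs_det_fderiv_smul μ hd]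
  refine setIntegral_congr_fun hsm fun y hy ↦ ?_
  obtain ⟨h1, h2⟩ := (hs y).1 hy
  have k := density_eq_abs_det_mul ((chartAt E p).map_target h1) h2
  rw [(chartAt E p).right_inv h1] at k
  have hTy : (chartAt E q).symm (T y) = (chartAt E p).symm y := (chartAt E q).left_inv h2
  simp only [hTy, k, smul_eq_mul]
  have : fderiv ℝ T y = fderiv ℝ ((chartAt E q) ∘ (chartAt E p).symm) y := rfl
  rw [this]
  ring

variable [T2Space M] [CompactSpace M]

/-- The divergence theorem for vector fields supported in a chart. -/
lemma integral_chartFun_divergence {p : M} {Z : Π x : M, TangentSpace 𝓘(ℝ, E) x} {K : Set M}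
    (hZ : ∀ x, CMDiffAt ∞ (T% Z) x) (hK : IsClosed K) (hKs : K ⊆ (chartAt E p).source)
    (hZK : ∀ x, x ∉ K → Z x = 0) :
    ∫ y, chartFun (E := E) p (divergence Z) y ∂μ = 0 := by
  have hsupp : ∀ i, tsupport (fun x ↦ coord (E := E) p i x (Z x)) ⊆ (chartAt E p).source := by
    intro i
    refine (closure_minimal (fun x hx ↦ ?_) hK).trans hKs
    by_contra h
    exact hx (by simp [hZK x h])
  have hsm : ∀ i, ∀ x ∈ (chartAt E p).source, CMDiffAt ∞ (fun x ↦ coord (E := E) p i x (Z x)) x :=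
    fun i x hx ↦ contMDiffAt_coord hx i (hZ x)
  have hcd := fun i ↦ contDiff_chartFun (hsupp i) (hsm i)
  have hcs := fun i ↦ (tsupport_chartFun_subset (hsupp i)).1
  have hzero : ∀ x, x ∉ K → divergence Z x = 0 := by
    intro x hx
    have h : Z =ᶠ[𝓝 x] fun y ↦ (0 : TangentSpace 𝓘(ℝ, E) y) := by
      filter_upwards [hK.isOpen_compl.mem_nhds hx] with y hy using hZK y hy
    rw [divergence_congr ((hZ x).mdifferentiableAt (by simp)) h, divergence_zero]
  have key : chartFun (E := E) p (divergence Z) = fun y ↦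
      ∑ i, fderiv ℝ (chartFun (E := E) p fun x ↦ coord p i x (Z x)) y (finBasis ℝ E i) := by
    funext y
    by_cases hy : y ∈ (chartAt E p).target
    · have hx := (chartAt E p).map_target hy
      rw [chartFun, indicator_of_mem hy, divergence_mul_density hx (hZ _)]
      refine Finset.sum_congr rfl fun i _ ↦ ?_
      have hm : MDiffAt (fun x ↦ coord p i x (Z x) * density (E := E) p x) ((chartAt E p).symm y) :=
        ((hsm i _ hx).mul (contMDiffAt_density hx)).mdifferentiableAt (by simp)
      rw [mvfderiv_coordFrame hx hm, (chartAt E p).right_inv hy]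
      refine congrArg (fun L : E →L[ℝ] ℝ ↦ L (finBasis ℝ E i)) (Filter.EventuallyEq.fderiv_eq ?_)
      filter_upwards [(chartAt E p).open_target.mem_nhds hy] with z hz
      simp [chartFun, hz]
    · rw [chartFun, indicator_of_notMem hy]
      refine (Finset.sum_eq_zero fun i _ ↦ ?_).symm
      rw [fderiv_of_notMem_tsupport ℝ fun h ↦ hy ((tsupport_chartFun_subset (hsupp i)).2 h)]
      rfl
  rw [key, integral_finsetSum _ fun i _ ↦ (integral_fderiv_eq_zero μ (hcd i) (hcs i) _).1]
  exact Finset.sum_eq_zero fun i _ ↦ (integral_fderiv_eq_zero μ (hcd i) (hcs i) _).2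

end Integration

/-! ### The divergence theorem -/

section DivergenceTheorem

open MeasureTheory

set_option linter.unusedSectionVars false

variable {E : Type*} [NormedAddCommGroup E] [NormedSpace ℝ E] [FiniteDimensional ℝ E]
  {M : Type*} [TopologicalSpace M] [ChartedSpace E M] [IsManifold 𝓘(ℝ, E) ∞ M]
  [RiemannianBundle (fun x : M ↦ TangentSpace 𝓘(ℝ, E) x)]
  [IsContMDiffRiemannianBundle 𝓘(ℝ, E) ∞ E (fun x : M ↦ TangentSpace 𝓘(ℝ, E) x)]

lemma divergence_eq_sum_smul {ι : Type*} (s : Finset ι) {r : ι → M → ℝ}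
    {X : Π x : M, TangentSpace 𝓘(ℝ, E) x} (hr : ∀ i x, CMDiffAt ∞ (r i) x)
    (hs : ∀ x, ∑ i ∈ s, r i x = 1) (hX : ∀ x, CMDiffAt ∞ (T% X) x) (x : M) :
    divergence X x = ∑ i ∈ s, divergence (r i • X) x := by
  have md : ∀ i, MDiffAt (r i) x := fun i ↦ (hr i x).mdifferentiableAt (by simp)
  have hd : ∑ i ∈ s, d% (r i) x = 0 := by
    have h : ∀ t : Finset ι, MDiffAt (fun y ↦ ∑ i ∈ t, r i y) x ∧
        d% (fun y ↦ ∑ i ∈ t, r i y) x = ∑ i ∈ t, d% (r i) x := by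
      intro t
      induction t using Finset.cons_induction with
      | empty => simpa using ⟨mdifferentiableAt_const, mvfderiv_const _⟩
      | cons a t ha ih =>
        simp only [Finset.sum_cons]
        exact ⟨(md a).add ih.1, (mvfderiv_fun_add (md a) ih.1).trans (by rw [ih.2])⟩
    rw [← (h s).2]
    simp only [hs]
    exact mvfderiv_const _
  simp only [divergence_smul (md _) ((hX x).mdifferentiableAt (by simp)), Finset.sum_add_distrib,
    ← Finset.sum_mul, hs, one_mul]
  rw [← sum_apply, hd]
  simp

/-- On a compact manifold no vector field has everywhere positive divergence. The integral of
`div X = ∑ div (ρⱼ X)` is computed with a partition of unity `ρ` subordinate to the charts: the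
summand `ρᵢ div (ρⱼ X)` may be integrated in the chart `i` or in the chart `j`. -/
theorem not_forall_divergence_pos [T2Space M] [CompactSpace M] [Nonempty M]
    {X : Π x : M, TangentSpace 𝓘(ℝ, E) x} (hX : ∀ x, CMDiffAt ∞ (T% X) x) :
    ¬ ∀ x, 0 < divergence X x := by
  intro hpos
  let _ : MeasurableSpace E := borel E
  have : BorelSpace E := ⟨rfl⟩
  let μ : Measure E := Measure.addHaar
  obtain ⟨ρ, hρ⟩ := SmoothPartitionOfUnity.exists_isSubordinate_chartAt_source 𝓘(ℝ, E) M
  have hfin : {i | (Function.support (ρ i)).Nonempty}.Finite :=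
    ρ.locallyFinite.finite_nonempty_of_compact
  let s : Finset M := hfin.toFinset
  have hsum : ∀ x, ∑ i ∈ s, ρ i x = 1 := by
    intro x
    rw [← ρ.sum_eq_one (mem_univ x), finsum_eq_sum_of_support_subset]
    intro i hi
    simp only [s, Finite.coe_toFinset, mem_ofPred_eq]
    exact ⟨x, hi⟩
  have hr : ∀ i x, CMDiffAt ∞ (ρ i) x := fun i x ↦ (ρ i).contMDiff.contMDiffAt
  have hρX : ∀ i x, CMDiffAt ∞ (T% ((ρ i : M → ℝ) • X)) x := fun i x ↦ (hr i x).smul_section (hX x)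
  have hvan : ∀ i x, x ∉ tsupport (ρ i) → divergence ((ρ i : M → ℝ) • X) x = 0 := by
    intro i x hx
    have h : ((ρ i : M → ℝ) • X) =ᶠ[𝓝 x] fun y ↦ (0 : TangentSpace 𝓘(ℝ, E) y) := by
      filter_upwards [(isClosed_tsupport (ρ i)).isOpen_compl.mem_nhds hx] with y hy
      rw [Pi.smul_apply', image_eq_zero_of_notMem_tsupport hy, zero_smul]
    rw [divergence_congr ((hρX i x).mdifferentiableAt (by simp)) h, divergence_zero]
  -- integrals over the chart at `i` of functions cut off by `ρ i`
  have hts : ∀ i (F : M → ℝ), tsupport (fun x ↦ ρ i x * F x) ⊆ (chartAt E i).source :=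
    fun i F ↦ (tsupport_mul_subset_left (f := ρ i) (g := F)).trans (hρ i)
  have hcd : ∀ i {F : M → ℝ}, (∀ x, CMDiffAt ∞ F x) →
      ContDiff ℝ 1 (chartFun (E := E) i fun x ↦ ρ i x * F x) := fun i F hF ↦
    contDiff_chartFun (hts i F) fun x _ ↦ (hr i x).mul (hF x)
  have hcs : ∀ i (F : M → ℝ), HasCompactSupport (chartFun (E := E) i fun x ↦ ρ i x * F x) :=
    fun i F ↦ (tsupport_chartFun_subset (hts i F)).1
  have hint : ∀ i {F : M → ℝ}, (∀ x, CMDiffAt ∞ F x) →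
      Integrable (chartFun (E := E) i fun x ↦ ρ i x * F x) μ := fun i F hF ↦
    (hcd i hF).continuous.integrable_of_hasCompactSupport (hcs i F)
  have hdiv : ∀ i x, CMDiffAt ∞ (divergence ((ρ i : M → ℝ) • X)) x := fun i ↦
    contMDiffAt_divergence (hρX i)
  have hzero : ∑ i ∈ s, ∫ y, chartFun (E := E) i (fun x ↦ ρ i x * divergence X x) y ∂μ = 0 := by
    have h1 : ∀ i, ∫ y, chartFun (E := E) i (fun x ↦ ρ i x * divergence X x) y ∂μ =
        ∑ j ∈ s, ∫ y, chartFun (E := E) i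
          (fun x ↦ ρ i x * divergence ((ρ j : M → ℝ) • X) x) y ∂μ := by
      intro i
      rw [← integral_finsetSum _ fun j _ ↦ hint i (hdiv j)]
      congr 1
      funext y
      simp only [chartFun, divergence_eq_sum_smul s hr hsum hX, indicator]
      split_ifs
      · rw [Finset.mul_sum, Finset.sum_mul]
      · simp
    have h2 : ∀ i j, ∫ y, chartFun (E := E) i
        (fun x ↦ ρ i x * divergence ((ρ j : M → ℝ) • X) x) y ∂μ =
        ∫ y, chartFun (E := E) j (fun x ↦ ρ i x * divergence ((ρ j : M → ℝ) • X) x) y ∂μ := by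
      intro i j
      refine integral_chartFun_eq μ (fun x hx ↦ ?_) (fun x hx ↦ ?_)
      · rw [image_eq_zero_of_notMem_tsupport fun h ↦ hx (hρ i h), zero_mul]
      · rw [hvan j x fun h ↦ hx (hρ j h), mul_zero]
    have hint' : ∀ i j, Integrable (chartFun (E := E) j
        fun x ↦ ρ i x * divergence ((ρ j : M → ℝ) • X) x) μ := by
      intro i j
      have ht : tsupport (fun x ↦ ρ i x * divergence ((ρ j : M → ℝ) • X) x) ⊆
          (chartAt E j).source := by
        refine (closure_minimal (fun x hx ↦ ?_) (isClosed_tsupport (ρ j))).trans (hρ j)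
        by_contra h
        exact hx (by simp [hvan j x h])
      have hc := (contDiff_chartFun ht fun x _ ↦ (hr i x).mul (hdiv j x)).continuous
      exact hc.integrable_of_hasCompactSupport (tsupport_chartFun_subset ht).1
    rw [Finset.sum_congr rfl fun i _ ↦ (h1 i).trans (Finset.sum_congr rfl fun j _ ↦ h2 i j),
      Finset.sum_comm]
    refine Finset.sum_eq_zero fun j _ ↦ ?_
    rw [← integral_finsetSum _ fun i _ ↦ hint' i j,
      ← integral_chartFun_divergence μ (hρX j) (isClosed_tsupport (ρ j)) (hρ j)
        (fun x hx ↦ by rw [Pi.smul_apply', image_eq_zero_of_notMem_tsupport hx, zero_smul])]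
    congr 1
    funext y
    simp only [chartFun, indicator]
    split_ifs
    · rw [← Finset.sum_mul, ← Finset.sum_mul, hsum, one_mul]
    · simp
  have hnonneg : ∀ i, 0 ≤ chartFun (E := E) i fun x ↦ ρ i x * divergence X x := by
    intro i y
    refine indicator_nonneg (fun y hy ↦ ?_) y
    exact mul_nonneg (mul_nonneg (ρ.nonneg i _) (hpos _).le)
      (density_pos ((chartAt E i).map_target hy)).le
  obtain ⟨x₀⟩ := ‹Nonempty M›
  obtain ⟨i, hi⟩ := ρ.exists_pos_of_mem (mem_univ x₀)
  have his : i ∈ s := by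
    simp only [s, Finite.mem_toFinset, mem_ofPred_eq]
    exact ⟨x₀, hi.ne'⟩
  have hisrc : x₀ ∈ (chartAt E i).source := hρ i (subset_tsupport _ hi.ne')
  have hX' := contMDiffAt_divergence hX
  have hgt : 0 < ∫ y, chartFun (E := E) i (fun x ↦ ρ i x * divergence X x) y ∂μ := by
    refine (hcd i hX').continuous.integral_pos_of_hasCompactSupport_nonneg_nonzero (hcs i _)
      (hnonneg i) (x := chartAt E i x₀) ?_
    rw [chartFun, indicator_of_mem ((chartAt E i).map_source hisrc), (chartAt E i).left_inv hisrc]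
    exact (mul_pos (mul_pos hi (hpos x₀)) (density_pos hisrc)).ne'
  have := Finset.sum_pos' (fun i _ ↦ integral_nonneg (μ := μ) (hnonneg i)) ⟨i, his, hgt⟩
  exact this.ne' hzero

end DivergenceTheorem

/-! ### Orthogonal complex structures -/

section QuaternionicTriples

variable {V : Type*} [NormedAddCommGroup V] [InnerProductSpace ℝ V] {J₁ J₂ J₃ : V →L[ℝ] V}

lemma inner_endo_skew {J : V →L[ℝ] V} (sq : ∀ v, J (J v) = -v)
    (orth : ∀ u v, ⟪J u, J v⟫_ℝ = ⟪u, v⟫_ℝ) (u v : V) : ⟪J u, v⟫_ℝ = -⟪u, J v⟫_ℝ := by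
  rw [← orth (J u) v, sq, inner_neg_left]

lemma inner_endo_self {J : V →L[ℝ] V} (sq : ∀ v, J (J v) = -v)
    (orth : ∀ u v, ⟪J u, J v⟫_ℝ = ⟪u, v⟫_ℝ) (u : V) : ⟪J u, u⟫_ℝ = 0 := by
  have h := inner_endo_skew sq orth u u
  have h' := real_inner_comm u (J u)
  linarith

lemma sum_inner_endo_sq [FiniteDimensional ℝ V] {ι : Type*} [Fintype ι] (b : OrthonormalBasis ι ℝ V)
    {J : V →L[ℝ] V} (sq : ∀ v, J (J v) = -v)
    (orth : ∀ u v, ⟪J u, J v⟫_ℝ = ⟪u, v⟫_ℝ) (x : V) :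
    ∑ i, ⟪x, J (b i)⟫_ℝ ^ 2 = ‖x‖ ^ 2 := by
  have h : ∀ i, ⟪x, J (b i)⟫_ℝ = -⟪b i, J x⟫_ℝ := fun i ↦ by
    rw [real_inner_comm, inner_endo_skew sq orth]
  simp only [h, neg_sq]
  rw [b.sum_sq_inner_right, ← real_inner_self_eq_norm_sq, orth, real_inner_self_eq_norm_sq]

end QuaternionicTriples

/-! ### Non-existence for the symmetric part of the equation -/

section NoSolution

set_option linter.unusedSectionVars false

variable {E : Type*} [NormedAddCommGroup E] [NormedSpace ℝ E] [FiniteDimensional ℝ E]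
  {M : Type*} [TopologicalSpace M] [ChartedSpace E M] [IsManifold 𝓘(ℝ, E) ∞ M]

lemma mvfderiv_eq_zero_of_isLocalMax {f : M → ℝ} {x : M} (hf : MDiffAt f x) (h : IsLocalMax f x)
    (u : TangentSpace 𝓘(ℝ, E) x) : d% f x u = 0 := by
  have hx := mem_chart_source E x
  rw [← sum_coord_smul hx u, map_sum]
  refine Finset.sum_eq_zero fun i _ ↦ ?_
  have hl : IsLocalMax (f ∘ (chartAt E x).symm) (chartAt E x x) := by
    have ht : Filter.Tendsto (chartAt E x).symm (𝓝 (chartAt E x x)) (𝓝 x) :=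
      (chartAt E x).tendsto_symm hx
    have : ∀ᶠ y in 𝓝 (chartAt E x x), f ((chartAt E x).symm y) ≤ f x := ht.eventually h
    simpa [IsLocalMax, IsMaxFilter, (chartAt E x).left_inv hx] using this
  rw [map_smul, mvfderiv_coordFrame hx hf, hl.fderiv_eq_zero]
  simp

variable [RiemannianBundle (fun x : M ↦ TangentSpace 𝓘(ℝ, E) x)]
  [IsContMDiffRiemannianBundle 𝓘(ℝ, E) ∞ E (fun x : M ↦ TangentSpace 𝓘(ℝ, E) x)]

/-- The symmetric part of the equation for `∇φ`, written for the dual field `X`, has no global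
solution. With `m = dim M`, its trace is `div X = |X|² - m ν / 2`, so `ν` is continuous. At a
maximum of `|X|²` on the open and closed set `{ν > 0}` the equation in the direction `X` reads
`|X|² (|X|² + ν) = 0`, so `X` and `ν` vanish there, and the set is empty. Hence `ν < 0` and
`div X > 0` everywhere. -/
theorem not_exists_vectorField [T2Space M] [CompactSpace M] [Nonempty M]
    {X : Π x : M, TangentSpace 𝓘(ℝ, E) x} {ν : M → ℝ} (hE : 0 < finrank ℝ E)
    (hX : ∀ x, CMDiffAt ∞ (T% X) x) (hν : ∀ x, ν x ≠ 0)
    (h : ∀ x, ∃ J₁ J₂ J₃ : TangentSpace 𝓘(ℝ, E) x →L[ℝ] TangentSpace 𝓘(ℝ, E) x,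
      IsQuaternionicTriple J₁ J₂ J₃ ∧ ∀ u : TangentSpace 𝓘(ℝ, E) x,
        ⟪leviCivita 𝓘(ℝ, E) M X x u, u⟫_ℝ = (1 / 2) * (-⟪X x, u⟫_ℝ ^ 2
          + (⟪X x, J₁ u⟫_ℝ ^ 2 + ⟪X x, J₂ u⟫_ℝ ^ 2 + ⟪X x, J₃ u⟫_ℝ ^ 2) - ν x * ‖u‖ ^ 2)) :
    False := by
  set f : M → ℝ := fun x ↦ ⟪X x, X x⟫_ℝ with hf
  have hfs : ∀ x, CMDiffAt ∞ f x := fun x ↦ ContMDiffAt.inner_bundle (F := E)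
    (E := fun x : M ↦ TangentSpace 𝓘(ℝ, E) x) (hX x) (hX x)
  have hdiv : ∀ x, divergence X x = f x - finrank ℝ E / 2 * ν x := by
    intro x
    obtain ⟨J₁, J₂, J₃, hJ, hx⟩ := h x
    let b := stdOrthonormalBasis ℝ (TangentSpace 𝓘(ℝ, E) x)
    have hT : divergence X x = ∑ i, ⟪leviCivita 𝓘(ℝ, E) M X x (b i), b i⟫_ℝ := by
      refine (LinearMap.trace_eq_sum_inner _ b).trans ?_
      exact Finset.sum_congr rfl fun i _ ↦ real_inner_comm _ _
    rw [hT]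
    simp only [hx]
    rw [← Finset.mul_sum, Finset.sum_sub_distrib, Finset.sum_add_distrib, Finset.sum_add_distrib,
      Finset.sum_add_distrib, Finset.sum_neg_distrib, sum_inner_endo_sq b hJ.sq₁ hJ.orth₁,
      sum_inner_endo_sq b hJ.sq₂ hJ.orth₂, sum_inner_endo_sq b hJ.sq₃ hJ.orth₃,
      b.sum_sq_inner_left]
    simp only [b.norm_eq_one, hf, real_inner_self_eq_norm_sq]
    simp
    rw [show finrank ℝ (TangentSpace 𝓘(ℝ, E) x) = finrank ℝ E from rfl]
    ring
  have hm : (0 : ℝ) < finrank ℝ E := by exact_mod_cast hE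
  have hfc : Continuous f := continuous_iff_continuousAt.2 fun x ↦ (hfs x).continuousAt
  have hνc : Continuous ν := by
    have e : ν = fun x ↦ 2 / finrank ℝ E * (f x - divergence X x) := by
      funext x; rw [hdiv]; field_simp; ring
    rw [e]
    exact continuous_const.mul (hfc.sub (continuous_iff_continuousAt.2 fun x ↦
      (contMDiffAt_divergence hX x).continuousAt))
  set C : Set M := {x | 0 < ν x} with hC
  have hopen : IsOpen C := isOpen_lt continuous_const hνc
  have hclosed : IsClosed C := by
    have : C = {x | 0 ≤ ν x} := by
      ext x; exact ⟨fun h : 0 < ν x ↦ h.le, fun h : 0 ≤ ν x ↦ lt_of_le_of_ne h (hν x).symm⟩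
    rw [this]
    exact isClosed_le continuous_const hνc
  have hempty : C = ∅ := by
    by_contra hne
    obtain ⟨x₀, hx₀, hmax⟩ := hclosed.isCompact.exists_isMaxOn (nonempty_iff_ne_empty.2 hne)
      hfc.continuousOn
    have hloc : IsLocalMax f x₀ := hmax.isLocalMax (hopen.mem_nhds hx₀)
    have hd := mvfderiv_eq_zero_of_isLocalMax ((hfs x₀).mdifferentiableAt (by simp)) hloc (X x₀)
    have hXd := (hX x₀).mdifferentiableAt (by simp)
    rw [leviCivita_metric hXd hXd, real_inner_comm _ (X x₀)] at hd
    obtain ⟨J₁, J₂, J₃, hJ, hx⟩ := h x₀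
    have h1 := hx (X x₀)
    have e₁ := (real_inner_comm _ _).trans (inner_endo_self hJ.sq₁ hJ.orth₁ (X x₀))
    have e₂ := (real_inner_comm _ _).trans (inner_endo_self hJ.sq₂ hJ.orth₂ (X x₀))
    have e₃ := (real_inner_comm _ _).trans (inner_endo_self hJ.sq₃ hJ.orth₃ (X x₀))
    rw [e₁, e₂, e₃, ← real_inner_self_eq_norm_sq] at h1
    have hf0 : f x₀ = 0 := by
      have h2 : f x₀ * (f x₀ + ν x₀) = 0 := by
        simp only [hf]
        linarith
      rcases mul_eq_zero.1 h2 with h3 | h3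
      · exact h3
      · have h4 : 0 ≤ f x₀ := real_inner_self_nonneg
        have h5 : 0 < ν x₀ := hx₀
        linarith
    have hX0 : X =ᶠ[𝓝 x₀] fun y ↦ (0 : TangentSpace 𝓘(ℝ, E) y) := by
      filter_upwards [hopen.mem_nhds hx₀] with y hy
      have h4 : f y ≤ f x₀ := hmax hy
      have h5 : 0 ≤ f y := real_inner_self_nonneg
      have h6 : ⟪X y, X y⟫_ℝ = 0 := le_antisymm (h4.trans hf0.le) h5
      exact (inner_self_eq_zero (𝕜 := ℝ) (E := TangentSpace 𝓘(ℝ, E) y)).1 h6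
    have h6 := hdiv x₀
    rw [divergence_congr hXd hX0, divergence_zero, hf0] at h6
    have h7 : 0 < ν x₀ := hx₀
    nlinarith [mul_pos hm h7]
  refine not_forall_divergence_pos hX fun x ↦ ?_
  rw [hdiv]
  have h1 : 0 ≤ f x := real_inner_self_nonneg
  have h2 : ν x < 0 := by
    refine lt_of_le_of_ne (not_lt.1 fun hx ↦ ?_) (hν x)
    have : x ∈ C := hx
    simp [hempty] at this
  nlinarith [mul_pos hm (neg_pos.2 h2)]

end NoSolution

/-! ### Curvature tensors of quaternionic type -/

section QuaternionicAlgebra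

variable {V : Type*} [NormedAddCommGroup V] [InnerProductSpace ℝ V] {I J K : V →L[ℝ] V}

lemma IsQuaternionicTriple.mul_eq₁₂ (h : IsQuaternionicTriple I J K) (v : V) : I (J v) = K v := by
  have h1 := h.prod (K v)
  rw [h.sq₃, map_neg, map_neg] at h1
  exact neg_injective h1

lemma IsQuaternionicTriple.mul_eq₂₃ (h : IsQuaternionicTriple I J K) (v : V) : J (K v) = I v := by
  have h1 := congrArg I (h.prod v)
  rw [h.sq₁, map_neg] at h1
  exact neg_injective h1

/-- The relations are invariant under cyclic permutation. -/
lemma IsQuaternionicTriple.rotate (h : IsQuaternionicTriple I J K) :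
    IsQuaternionicTriple J K I where
  sq₁ := h.sq₂
  sq₂ := h.sq₃
  sq₃ := h.sq₁
  prod v := by rw [h.mul_eq₂₃, h.sq₁]
  orth₁ := h.orth₂
  orth₂ := h.orth₃
  orth₃ := h.orth₁

lemma IsQuaternionicTriple.mul_eq₃₁ (h : IsQuaternionicTriple I J K) (v : V) : K (I v) = J v :=
  h.rotate.mul_eq₂₃ v

lemma IsQuaternionicTriple.mul_eq₂₁ (h : IsQuaternionicTriple I J K) (v : V) : J (I v) = -K v := by
  rw [← h.mul_eq₂₃, h.sq₂]

lemma IsQuaternionicTriple.mul_eq₃₂ (h : IsQuaternionicTriple I J K) (v : V) : K (J v) = -I v :=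
  h.rotate.mul_eq₂₁ v

lemma IsQuaternionicTriple.mul_eq₁₃ (h : IsQuaternionicTriple I J K) (v : V) : I (K v) = -J v :=
  h.rotate.rotate.mul_eq₂₁ v

lemma IsQuaternionicTriple.inner_left₁ (h : IsQuaternionicTriple I J K) (u v : V) :
    ⟪I u, v⟫_ℝ = -⟪u, I v⟫_ℝ := inner_endo_skew h.sq₁ h.orth₁ u v

lemma IsQuaternionicTriple.inner_left₂ (h : IsQuaternionicTriple I J K) (u v : V) :
    ⟪J u, v⟫_ℝ = -⟪u, J v⟫_ℝ := h.rotate.inner_left₁ u v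

lemma IsQuaternionicTriple.inner_left₃ (h : IsQuaternionicTriple I J K) (u v : V) :
    ⟪K u, v⟫_ℝ = -⟪u, K v⟫_ℝ := h.rotate.rotate.inner_left₁ u v

lemma IsQuaternionicTriple.inner_self₁ (h : IsQuaternionicTriple I J K) (u : V) :
    ⟪u, I u⟫_ℝ = 0 := by
  rw [real_inner_comm]; exact inner_endo_self h.sq₁ h.orth₁ u

/-- The commutator relations `[R, I] = C J - B K`, `[R, J] = A K - C I`, `[R, K] = B I - A J`
for the endomorphisms `R = R(u, v)`, in terms of the 4-tensor `r`. -/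
structure CommutatorRelations (r : V →ₗ[ℝ] V →ₗ[ℝ] V →ₗ[ℝ] V →ₗ[ℝ] ℝ) (I J K : V →L[ℝ] V)
    (A B C : V → V → ℝ) : Prop where
  rel₁ : ∀ u v w z, r u v (I w) z + r u v w (I z) = C u v * ⟪J w, z⟫_ℝ - B u v * ⟪K w, z⟫_ℝ
  rel₂ : ∀ u v w z, r u v (J w) z + r u v w (J z) = A u v * ⟪K w, z⟫_ℝ - C u v * ⟪I w, z⟫_ℝ
  rel₃ : ∀ u v w z, r u v (K w) z + r u v w (K z) = B u v * ⟪I w, z⟫_ℝ - A u v * ⟪J w, z⟫_ℝ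

/-- The symmetries of a curvature tensor. -/
structure IsCurvatureTensor (r : V →ₗ[ℝ] V →ₗ[ℝ] V →ₗ[ℝ] V →ₗ[ℝ] ℝ) : Prop where
  swap_left : ∀ u v w z, r u v w z = -r v u w z
  swap_right : ∀ u v w z, r u v w z = -r u v z w
  bianchi : ∀ u v w z, r u v w z + r v w u z + r w u v z = 0
  pair : ∀ u v w z, r u v w z = r w z u v

variable {r : V →ₗ[ℝ] V →ₗ[ℝ] V →ₗ[ℝ] V →ₗ[ℝ] ℝ} {A B C : V → V → ℝ} {n : ℕ}

lemma CommutatorRelations.rotate (h : CommutatorRelations r I J K A B C) :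
    CommutatorRelations r J K I B C A where
  rel₁ := h.rel₂
  rel₂ := h.rel₃
  rel₃ := h.rel₁

variable {ι : Type*} [Fintype ι] (b : OrthonormalBasis ι ℝ V)

lemma sum_mul_inner (f : V →ₗ[ℝ] ℝ) (x : V) : ∑ i, f (b i) * ⟪x, b i⟫_ℝ = f x := by
  conv_rhs => rw [← b.sum_repr x]
  simp only [map_sum, map_smul, smul_eq_mul, b.repr_apply_apply]
  exact Finset.sum_congr rfl fun i _ ↦ by rw [real_inner_comm, mul_comm]

lemma sum_mul_inner' (f : V →ₗ[ℝ] ℝ) (x : V) : ∑ i, f (b i) * ⟪b i, x⟫_ℝ = f x := by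
  simpa only [real_inner_comm] using sum_mul_inner b f x

/-- The metric trace of a bilinear form is invariant under orthogonal complex structures. -/
lemma sum_apply_endo (F : V →ₗ[ℝ] V →ₗ[ℝ] ℝ) (sq : ∀ v, J (J v) = -v)
    (orth : ∀ u v, ⟪J u, J v⟫_ℝ = ⟪u, v⟫_ℝ) : ∑ i, F (J (b i)) (J (b i)) = ∑ i, F (b i) (b i) := by
  have h : ∀ i, F (J (b i)) (J (b i)) = -∑ j, F (b j) (J (b i)) * ⟪b i, J (b j)⟫_ℝ := by
    intro i
    refine (sum_mul_inner b (F.flip (J (b i))) (J (b i))).symm.trans ?_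
    rw [← Finset.sum_neg_distrib]
    exact Finset.sum_congr rfl fun j _ ↦ by
      rw [inner_endo_skew sq orth, LinearMap.flip_apply]; ring
  simp only [h]
  rw [Finset.sum_neg_distrib, Finset.sum_comm, ← Finset.sum_neg_distrib]
  refine Finset.sum_congr rfl fun j _ ↦ ?_
  have := sum_mul_inner' b ((F (b j)) ∘ₗ (J : V →ₗ[ℝ] V)) (J (b j))
  simp only [LinearMap.comp_apply, ContinuousLinearMap.coe_coe] at this
  rw [this, sq, map_neg, neg_neg]

/-- The Ricci contraction of a 4-tensor. -/
def ricciContraction (r : V →ₗ[ℝ] V →ₗ[ℝ] V →ₗ[ℝ] V →ₗ[ℝ] ℝ) (v w : V) : ℝ :=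
  ∑ i, r (b i) v w (b i)

variable {b}

/-- The coefficient `A` is the trace of `-R(u, v) I`, up to a factor. -/
lemma CommutatorRelations.sum_eq (h : CommutatorRelations r I J K A B C)
    (hT : IsQuaternionicTriple I J K) (hι : Fintype.card ι = 4 * n) (u v : V) :
    ∑ i, r u v (b i) (I (b i)) = 2 * n * A u v := by
  have h1 : ∀ i, r u v (J (b i)) (I (J (b i))) + r u v (b i) (I (b i)) = A u v := by
    intro i
    have h2 := h.rel₂ u v (b i) (K (b i))
    rw [hT.mul_eq₂₃, hT.orth₃, real_inner_self_eq_norm_sq, b.norm_eq_one, hT.inner_left₁,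
      hT.mul_eq₁₃, inner_neg_right, hT.rotate.inner_self₁] at h2
    rw [hT.mul_eq₁₂, h2]
    ring
  have h2 := sum_apply_endo b ((r u v).compl₂ (I : V →ₗ[ℝ] V)) hT.sq₂ hT.orth₂
  simp only [LinearMap.compl₂_apply, ContinuousLinearMap.coe_coe] at h2
  have h3 := Finset.sum_congr rfl fun i (_ : i ∈ Finset.univ) ↦ h1 i
  rw [Finset.sum_add_distrib, h2, Finset.sum_const, Finset.card_univ, hι] at h3
  simp only [nsmul_eq_mul] at h3
  push_cast at h3
  linarith

lemma CommutatorRelations.skew (h : CommutatorRelations r I J K A B C)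
    (hT : IsQuaternionicTriple I J K) (hr : IsCurvatureTensor r)
    (hι : Fintype.card ι = 4 * n) (hn : 1 ≤ n) (b : OrthonormalBasis ι ℝ V) (u v : V) :
    A u v = -A v u := by
  have h1 := h.sum_eq (b := b) hT hι u v
  have h2 := h.sum_eq (b := b) hT hι v u
  rw [Finset.sum_congr rfl fun i _ ↦ hr.swap_left v u _ _, Finset.sum_neg_distrib, h1] at h2
  have hn' : (0 : ℝ) < n := by exact_mod_cast hn
  have h3 : 2 * (n : ℝ) * (A u v + A v u) = 0 := by linarith
  rcases mul_eq_zero.1 h3 with h4 | h4 <;> linarith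

lemma CommutatorRelations.exists_linear (h : CommutatorRelations r I J K A B C)
    (hT : IsQuaternionicTriple I J K)
    (hι : Fintype.card ι = 4 * n) (hn : 1 ≤ n) (b : OrthonormalBasis ι ℝ V) (v : V) :
    ∃ f : V →ₗ[ℝ] ℝ, ∀ u, f u = A u v := by
  have hn' : (0 : ℝ) < n := by exact_mod_cast hn
  refine ⟨(2 * n : ℝ)⁻¹ • ∑ i, ((r.flip v).flip (b i)).flip (I (b i)), fun u ↦ ?_⟩
  rw [LinearMap.smul_apply, LinearMap.sum_apply]
  simp only [LinearMap.flip_apply]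
  rw [h.sum_eq (b := b) hT hι u v, smul_eq_mul, inv_mul_cancel_left₀ (by positivity)]

/-- The contracted Bianchi identity for the coefficients of the commutator relations. -/
lemma CommutatorRelations.ricci_eq (h : CommutatorRelations r I J K A B C)
    (hT : IsQuaternionicTriple I J K) (hr : IsCurvatureTensor r)
    (hι : Fintype.card ι = 4 * n) (hn : 1 ≤ n) (u v : V) :
    n * A (I v) u + B (J v) u + C (K v) u = ricciContraction b r u v := by
  -- by the Bianchi identity, `n A(u, w) = ∑ r(e, u, I e, w)`
  have h1 : ∀ w, ∑ i, r (b i) u (I (b i)) w = n * A u w := by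
    intro w
    have k1 : ∀ i, r u w (b i) (I (b i)) = -r (I (b i)) u (b i) w + r (b i) u (I (b i)) w := by
      intro i
      have k2 := hr.bianchi (b i) (I (b i)) u w
      rw [hr.pair u w]
      rw [hr.swap_left u (b i)] at k2
      linarith
    let F : V →ₗ[ℝ] V →ₗ[ℝ] ℝ := ((r.flip u).flip.flip.compl₂ (I : V →ₗ[ℝ] V)).compr₂
      (LinearMap.applyₗ w)
    have k3 := sum_apply_endo b F hT.sq₁ hT.orth₁
    have k4 : ∀ x y, F x y = r x u (I y) w := fun x y ↦ rfl
    simp only [k4, hT.sq₁, map_neg, LinearMap.neg_apply, Finset.sum_neg_distrib] at k3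
    have k5 := h.sum_eq (b := b) hT hι u w
    rw [Finset.sum_congr rfl fun i _ ↦ k1 i, Finset.sum_add_distrib, Finset.sum_neg_distrib,
      k3] at k5
    linarith
  obtain ⟨fC, hC⟩ := h.rotate.rotate.exists_linear hT.rotate.rotate hι hn b u
  obtain ⟨fB, hB⟩ := h.rotate.exists_linear hT.rotate hι hn b u
  have h2 : ∑ i, r (b i) u v (b i) + ∑ i, r (b i) u (I (b i)) (I v) =
      C (K v) u + B (J v) u := by
    rw [← Finset.sum_add_distrib, ← hC, ← hB, ← sum_mul_inner b fC, ← sum_mul_inner b fB,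
      ← Finset.sum_add_distrib]
    refine Finset.sum_congr rfl fun i _ ↦ ?_
    have k := h.rel₁ (b i) u (I v) (b i)
    rw [hT.sq₁, hT.mul_eq₂₁, hT.mul_eq₃₁, hr.swap_right (b i) u (I v)] at k
    simp only [map_neg, LinearMap.neg_apply, inner_neg_left] at k
    rw [hC, hB]
    linarith
  have h3 := h.skew hT hr hι hn b u (I v)
  rw [h1, h3] at h2
  rw [ricciContraction]
  linarith

/-- For `n > 1` the commutator relations force the metric to be Einstein and determine their
coefficients: the three identities `ricci_eq` give `A(I v, u) = B(J v, u) = C(K v, u) = ρ(u, v)`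
with `ρ = Ric / (n + 2)`, and the pair symmetry of `r` makes `ρ` a multiple of the metric. -/
lemma CommutatorRelations.apply_self (h : CommutatorRelations r I J K A B C)
    (hT : IsQuaternionicTriple I J K) (hr : IsCurvatureTensor r)
    (hι : Fintype.card ι = 4 * n) (hn : 1 < n) (u : V) :
    A u (I u) = -((∑ i, ricciContraction b r (b i) (b i)) / (4 * n * (n + 2))) * ‖u‖ ^ 2 := by
  have hn1 : (1 : ℝ) < n := by exact_mod_cast hn
  set ρ : V → V → ℝ := fun u v ↦ ricciContraction b r u v / (n + 2) with hρ
  have hABC : ∀ u v, A (I v) u = ρ u v ∧ B (J v) u = ρ u v ∧ C (K v) u = ρ u v := by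
    intro u v
    have e1 := h.ricci_eq (b := b) hT hr hι hn.le u v
    have e2 := h.rotate.ricci_eq (b := b) hT.rotate hr hι hn.le u v
    have e3 := h.rotate.rotate.ricci_eq (b := b) hT.rotate.rotate hr hι hn.le u v
    have d1 : (n - 1 : ℝ) * (A (I v) u - B (J v) u) = 0 := by linarith
    have d2 : (n - 1 : ℝ) * (A (I v) u - C (K v) u) = 0 := by linarith
    have d1' := (mul_eq_zero.1 d1).resolve_left (by linarith)
    have d2' := (mul_eq_zero.1 d2).resolve_left (by linarith)
    have e : ρ u v = A (I v) u := by
      rw [hρ]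
      simp only
      rw [div_eq_iff (by positivity)]
      linear_combination -e1 - d1' - d2'
    exact ⟨e.symm, by linarith, by linarith⟩
  have hA : ∀ u v, A u v = ρ u (I v) := by
    intro u v
    rw [h.skew hT hr hι hn.le b u v, ← (hABC u (I v)).1, hT.sq₁]
    obtain ⟨f, hf⟩ := h.exists_linear hT hι hn.le b u
    rw [← hf, ← hf, map_neg]
  have hB : ∀ u v, B u v = ρ u (J v) := by
    intro u v
    rw [h.rotate.skew hT.rotate hr hι hn.le b u v, ← (hABC u (J v)).2.1, hT.sq₂]
    obtain ⟨f, hf⟩ := h.rotate.exists_linear hT.rotate hι hn.le b u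
    rw [← hf, ← hf, map_neg]
  have hC : ∀ u v, C u v = ρ u (K v) := by
    intro u v
    rw [h.rotate.rotate.skew hT.rotate.rotate hr hι hn.le b u v, ← (hABC u (K v)).2.2, hT.sq₃]
    obtain ⟨f, hf⟩ := h.rotate.rotate.exists_linear hT.rotate.rotate hι hn.le b u
    rw [← hf, ← hf, map_neg]
  have hneg : ∀ u v, ρ u (-v) = -ρ u v := by
    intro u v
    simp [hρ, ricciContraction, Finset.sum_neg_distrib, neg_div]
  have hsymm : ∀ u v, ρ u v = ρ v u := by
    intro u v
    simp only [hρ, ricciContraction]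
    congr 1
    refine Finset.sum_congr rfl fun i _ ↦ ?_
    rw [hr.pair, hr.swap_left, hr.swap_right, neg_neg]
  have hinv : ∀ u v, ρ (I u) (I v) = ρ u v := by
    intro u v
    have := h.skew hT hr hι hn.le b (I u) v
    rw [hA, hA, hT.sq₁, hneg, neg_neg, hsymm v u] at this
    exact this
  -- `I`-rotation of one pair of arguments of `r`
  have hrot : ∀ u v w z, r u v (I w) (I z) =
      r u v w z + ρ u (K v) * ⟪w, K z⟫_ℝ + ρ u (J v) * ⟪w, J z⟫_ℝ := by
    intro u v w z
    have k := h.rel₁ u v w (I z)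
    rw [hT.sq₁, map_neg, hT.inner_left₂, hT.inner_left₃, hT.mul_eq₂₁, hT.mul_eq₃₁, inner_neg_right,
      hB, hC] at k
    linarith
  have hfour : ∀ u v w z, r (I u) (I v) (I w) (I z) = r u v w z
      + ρ w (K z) * ⟪u, K v⟫_ℝ + ρ w (J z) * ⟪u, J v⟫_ℝ
      - ρ u (K v) * ⟪w, K z⟫_ℝ - ρ u (J v) * ⟪w, J z⟫_ℝ := by
    intro u v w z
    have e1 : ρ (I u) (K (I v)) = -ρ u (K v) := by
      rw [hT.mul_eq₃₁, ← hinv u, hT.mul_eq₁₃, hneg, neg_neg]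
    have e2 : ρ (I u) (J (I v)) = -ρ u (J v) := by
      rw [hT.mul_eq₂₁, ← hinv u, hT.mul_eq₁₂, hneg]
    rw [hrot, hr.pair (I u), hrot, hr.pair w, e1, e2]
    ring
  -- exchanging the two pairs in `hfour` leaves only the terms in `ρ`
  have hprop : ∀ u w, ρ w w * ‖u‖ ^ 2 = ρ u u * ‖w‖ ^ 2 := by
    intro u w
    have e1 := hfour u (-K u) w (-K w)
    have e2 := hfour w (-K w) u (-K u)
    rw [hr.pair, hr.pair u] at e1
    simp only [map_neg, hT.sq₃, hT.mul_eq₂₃, neg_neg, inner_neg_right, hT.inner_self₁,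
      real_inner_self_eq_norm_sq, LinearMap.neg_apply] at e1 e2
    linarith
  have hsum : ∑ i, ρ (b i) (b i) * ‖u‖ ^ 2 = 4 * n * ρ u u := by
    rw [Finset.sum_congr rfl fun i _ ↦ hprop u (b i)]
    simp [b.norm_eq_one, hι]
  rw [hA, hT.sq₁, hneg]
  rw [← Finset.sum_mul] at hsum
  simp only [hρ, ← Finset.sum_div] at hsum ⊢
  have hn0 : (0 : ℝ) < n := by linarith
  field_simp at hsum ⊢
  linarith

end QuaternionicAlgebra

/-! ### Multilinearity of the curvature, and dimension four -/

section CurvatureAlgebra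

variable {V : Type*} [NormedAddCommGroup V] [InnerProductSpace ℝ V] {I J K : V →L[ℝ] V}
  {A B C : V → V → ℝ} {n : ℕ} {ι : Type*} [Fintype ι] {b : OrthonormalBasis ι ℝ V}

/-- A map with the symmetries of a Riemannian curvature is multilinear and pair symmetric. -/
lemma exists_isCurvatureTensor {R : V → V → V → V} (swap : ∀ u v w, R u v w = -R v u w)
    (skew : ∀ u v w z, ⟪R u v w, z⟫_ℝ = -⟪R u v z, w⟫_ℝ)
    (bianchi : ∀ u v w, R u v w + R v w u + R w u v = 0) :
    ∃ r : V →ₗ[ℝ] V →ₗ[ℝ] V →ₗ[ℝ] V →ₗ[ℝ] ℝ,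
      IsCurvatureTensor r ∧ ∀ u v w z, r u v w z = ⟪R u v w, z⟫_ℝ := by
  have sw : ∀ u v w z, ⟪R u v w, z⟫_ℝ = -⟪R v u w, z⟫_ℝ := fun u v w z ↦ by
    rw [swap, inner_neg_left]
  have bi : ∀ u v w z, ⟪R u v w, z⟫_ℝ + ⟪R v w u, z⟫_ℝ + ⟪R w u v, z⟫_ℝ = 0 := fun u v w z ↦ by
    rw [← inner_add_left, ← inner_add_left, bianchi, inner_zero_left]
  have pair : ∀ u v w z, ⟪R u v w, z⟫_ℝ = ⟪R w z u, v⟫_ℝ := by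
    intro u v w z
    linarith [bi u v w z, bi v w z u, bi w z u v, bi z u v w, skew u v w z, skew v w u z,
      skew w u v z, skew v w z u, skew w z v u, skew z v w u, skew w z u v, skew z u w v,
      skew u w z v, skew z u v w, skew u v z w, skew v z u w, sw u v w z, sw v w u z, sw w u v z,
      sw z v w u, sw u w z v, sw v z u w, sw w z u v, sw u z v w]
  have add₄ : ∀ u v w z z', ⟪R u v w, z + z'⟫_ℝ = ⟪R u v w, z⟫_ℝ + ⟪R u v w, z'⟫_ℝ :=
    fun u v w z z' ↦ inner_add_right _ _ _
  have smul₄ : ∀ (c : ℝ) u v w z, ⟪R u v w, c • z⟫_ℝ = c * ⟪R u v w, z⟫_ℝ :=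
    fun c u v w z ↦ real_inner_smul_right _ _ _
  have add₃ : ∀ u v w w' z, ⟪R u v (w + w'), z⟫_ℝ = ⟪R u v w, z⟫_ℝ + ⟪R u v w', z⟫_ℝ :=
    fun u v w w' z ↦ by rw [skew, add₄, skew u v w, skew u v w']; ring
  have smul₃ : ∀ (c : ℝ) u v w z, ⟪R u v (c • w), z⟫_ℝ = c * ⟪R u v w, z⟫_ℝ :=
    fun c u v w z ↦ by rw [skew, smul₄, skew u v w]; ring
  have add₂ : ∀ u v v' w z, ⟪R u (v + v') w, z⟫_ℝ = ⟪R u v w, z⟫_ℝ + ⟪R u v' w, z⟫_ℝ :=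
    fun u v v' w z ↦ by rw [pair, add₄, pair u v, pair u v']
  have smul₂ : ∀ (c : ℝ) u v w z, ⟪R u (c • v) w, z⟫_ℝ = c * ⟪R u v w, z⟫_ℝ :=
    fun c u v w z ↦ by rw [pair, smul₄, pair u v]
  have add₁ : ∀ u u' v w z, ⟪R (u + u') v w, z⟫_ℝ = ⟪R u v w, z⟫_ℝ + ⟪R u' v w, z⟫_ℝ :=
    fun u u' v w z ↦ by rw [pair, add₃, pair u v, pair u' v]
  have smul₁ : ∀ (c : ℝ) u v w z, ⟪R (c • u) v w, z⟫_ℝ = c * ⟪R u v w, z⟫_ℝ :=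
    fun c u v w z ↦ by rw [pair, smul₃, pair u v]
  let r₂ : V → V → V →ₗ[ℝ] V →ₗ[ℝ] ℝ := fun u v ↦ LinearMap.mk₂ ℝ (fun w z ↦ ⟪R u v w, z⟫_ℝ)
    (add₃ u v) (fun c ↦ smul₃ c u v) (add₄ u v) (fun c ↦ smul₄ c u v)
  let r : V →ₗ[ℝ] V →ₗ[ℝ] V →ₗ[ℝ] V →ₗ[ℝ] ℝ := LinearMap.mk₂ ℝ r₂
    (fun u u' v ↦ LinearMap.ext₂ fun w z ↦ add₁ u u' v w z)
    (fun c u v ↦ LinearMap.ext₂ fun w z ↦ smul₁ c u v w z)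
    (fun u v v' ↦ LinearMap.ext₂ fun w z ↦ add₂ u v v' w z)
    (fun c u v ↦ LinearMap.ext₂ fun w z ↦ smul₂ c u v w z)
  exact ⟨r, ⟨sw, skew, bi, pair⟩, fun _ _ _ _ ↦ rfl⟩

/-- For `n = 1` the coefficients of the commutator relations are determined by the vanishing of the
contraction of the Weyl tensor with `I` and the Einstein condition. -/
lemma CommutatorRelations.apply_self_of_weyl {r : V →ₗ[ℝ] V →ₗ[ℝ] V →ₗ[ℝ] V →ₗ[ℝ] ℝ}
    (h : CommutatorRelations r I J K A B C)
    (hT : IsQuaternionicTriple I J K) (hr : IsCurvatureTensor r) (hι : Fintype.card ι = 4)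
    {c : ℝ} (hE : ∀ u v, ricciContraction b r u v = c * ⟪u, v⟫_ℝ)
    (hW : ∀ u v, ∑ i, ∑ j, (r (b i) (b j) u v
      - (1 / 2) * (⟪b j, u⟫_ℝ * ricciContraction b r (b i) v
        + ricciContraction b r (b j) u * ⟪b i, v⟫_ℝ
        - ⟪b i, u⟫_ℝ * ricciContraction b r (b j) v - ricciContraction b r (b i) u * ⟪b j, v⟫_ℝ)
      + (∑ k, ricciContraction b r (b k) (b k)) / 6 *
        (⟪b j, u⟫_ℝ * ⟪b i, v⟫_ℝ - ⟪b i, u⟫_ℝ * ⟪b j, v⟫_ℝ)) * ⟪I (b i), b j⟫_ℝ = 0) (u : V) :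
    A u (I u) = -((∑ i, ricciContraction b r (b i) (b i)) / 12) * ‖u‖ ^ 2 := by
  have hs : ∑ k, ricciContraction b r (b k) (b k) = 4 * c := by
    simp [hE, b.norm_eq_one, hι]
  have h0 := hW u (I u)
  rw [hs] at h0 ⊢
  simp only [hE] at h0
  have h1 : ∀ i, ∑ j, r (b i) (b j) u (I u) * ⟪I (b i), b j⟫_ℝ = r u (I u) (b i) (I (b i)) := by
    intro i
    rw [hr.pair u]
    exact sum_mul_inner b (((r (b i)).flip u).flip (I u)) (I (b i))
  have h2 : ∀ i w, ∑ j, ⟪b j, w⟫_ℝ * ⟪I (b i), b j⟫_ℝ = ⟪I (b i), w⟫_ℝ := by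
    intro i w
    have := b.sum_inner_mul_inner (I (b i)) w
    rw [← this]
    exact Finset.sum_congr rfl fun j _ ↦ mul_comm _ _
  have h3 : ∀ w z, ∑ i, ⟪b i, w⟫_ℝ * ⟪I (b i), z⟫_ℝ = -⟪w, I z⟫_ℝ := by
    intro w z
    rw [← b.sum_inner_mul_inner w (I z), ← Finset.sum_neg_distrib]
    refine Finset.sum_congr rfl fun i _ ↦ ?_
    rw [hT.inner_left₁, real_inner_comm]; ring
  have h4 : ∀ i, ∑ j, (r (b i) (b j) u (I u)
      - (1 / 2) * (⟪b j, u⟫_ℝ * (c * ⟪b i, I u⟫_ℝ) + (c * ⟪b j, u⟫_ℝ) * ⟪b i, I u⟫_ℝ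
        - ⟪b i, u⟫_ℝ * (c * ⟪b j, I u⟫_ℝ) - (c * ⟪b i, u⟫_ℝ) * ⟪b j, I u⟫_ℝ)
      + (4 * c) / 6 * (⟪b j, u⟫_ℝ * ⟪b i, I u⟫_ℝ - ⟪b i, u⟫_ℝ * ⟪b j, I u⟫_ℝ)) * ⟪I (b i), b j⟫_ℝ =
      r u (I u) (b i) (I (b i)) - c / 3 * (⟪b i, I u⟫_ℝ * ⟪I (b i), u⟫_ℝ)
        + c / 3 * (⟪b i, u⟫_ℝ * ⟪I (b i), I u⟫_ℝ) := by
    intro i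
    rw [← h1 i, ← h2 i u, ← h2 i (I u)]
    simp only [Finset.mul_sum]
    rw [← Finset.sum_sub_distrib, ← Finset.sum_add_distrib]
    exact Finset.sum_congr rfl fun j _ ↦ by ring
  rw [Finset.sum_congr rfl fun i _ ↦ h4 i, Finset.sum_add_distrib, Finset.sum_sub_distrib,
    ← Finset.mul_sum, ← Finset.mul_sum, h3, h3, h.sum_eq (n := 1) hT (by simpa using hι),
    hT.sq₁, hT.orth₁, inner_neg_right, real_inner_self_eq_norm_sq] at h0
  push_cast at h0
  linarith

end CurvatureAlgebra

/-! ### Connection forms of almost hypercomplex structures -/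

section ConnectionForms

variable {V : Type*} [NormedAddCommGroup V] [InnerProductSpace ℝ V] {I J K : V →L[ℝ] V}

lemma IsQuaternionicTriple.inner_right₂ (h : IsQuaternionicTriple I J K) (u : V) :
    ⟪u, J u⟫_ℝ = 0 := h.rotate.inner_self₁ u

lemma IsQuaternionicTriple.inner_right₃ (h : IsQuaternionicTriple I J K) (u : V) :
    ⟪u, K u⟫_ℝ = 0 := h.rotate.rotate.inner_self₁ u

lemma IsQuaternionicTriple.inner_cross (h : IsQuaternionicTriple I J K) (u : V) :
    ⟪I u, J u⟫_ℝ = 0 ∧ ⟪J u, K u⟫_ℝ = 0 ∧ ⟪I u, K u⟫_ℝ = 0 := by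
  refine ⟨?_, ?_, ?_⟩
  · rw [h.inner_left₁, h.mul_eq₁₂, h.inner_right₃, neg_zero]
  · rw [h.inner_left₂, h.mul_eq₂₃, h.inner_self₁, neg_zero]
  · rw [h.inner_left₁, h.mul_eq₁₃, inner_neg_right, h.inner_right₂, neg_zero, neg_zero]

lemma IsQuaternionicTriple.coeff_eq_zero (h : IsQuaternionicTriple I J K) {p q r s : ℝ} {v : V}
    (hv : v ≠ 0) (e : p • v + q • I v + r • J v + s • K v = 0) : p = 0 ∧ q = 0 ∧ r = 0 ∧ s = 0 := by
  have hv' : ⟪v, v⟫_ℝ ≠ 0 := inner_self_ne_zero.2 hv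
  obtain ⟨c1, c2, c3⟩ := h.inner_cross v
  have d1 := h.inner_self₁ v
  have d2 := h.inner_right₂ v
  have d3 := h.inner_right₃ v
  have k0 := congrArg (fun x ↦ ⟪v, x⟫_ℝ) e
  have k1 := congrArg (fun x ↦ ⟪I v, x⟫_ℝ) e
  have k2 := congrArg (fun x ↦ ⟪J v, x⟫_ℝ) e
  have k3 := congrArg (fun x ↦ ⟪K v, x⟫_ℝ) e
  have s1 := (real_inner_comm v (I v)).trans d1
  have s2 := (real_inner_comm v (J v)).trans d2
  have s3 := (real_inner_comm v (K v)).trans d3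
  have s4 := (real_inner_comm (I v) (J v)).trans c1
  have s5 := (real_inner_comm (J v) (K v)).trans c2
  have s6 := (real_inner_comm (I v) (K v)).trans c3
  simp only [inner_add_right, real_inner_smul_right, inner_zero_right, h.orth₁, h.orth₂, h.orth₃,
    d1, d2, d3, c1, c2, c3, s1, s2, s3, s4, s5, s6, mul_zero, zero_add, add_zero] at k0 k1 k2 k3
  exact ⟨(mul_eq_zero.1 k0).resolve_right hv', (mul_eq_zero.1 k1).resolve_right hv',
    (mul_eq_zero.1 k2).resolve_right hv', (mul_eq_zero.1 k3).resolve_right hv'⟩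

/-- In dimension four a skew endomorphism that anticommutes with `I` is a combination of `J`
and `K`. -/
lemma IsQuaternionicTriple.exists_of_finrank_eq_four (h : IsQuaternionicTriple I J K)
    (hV : finrank ℝ V = 4) {S : V → V} (skew : ∀ v w, ⟪S v, w⟫_ℝ = -⟪v, S w⟫_ℝ)
    (anti : ∀ v, S (I v) = -I (S v)) : ∃ q r : ℝ, ∀ v, S v = q • J v + r • K v := by
  have : FiniteDimensional ℝ V := FiniteDimensional.of_finrank_pos (by omega)
  have : Nontrivial V := Module.nontrivial_of_finrank_pos (R := ℝ) (by omega)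
  obtain ⟨e, he⟩ := exists_norm_eq V zero_le_one
  have hee : ⟪e, e⟫_ℝ = 1 := by rw [real_inner_self_eq_norm_sq, he]; norm_num
  have he0 : e ≠ 0 := by rintro rfl; simp at he
  -- `e`, `I e`, `J e`, `K e` span
  have hspan : ∀ x, ⟪x, e⟫_ℝ = 0 → ⟪x, I e⟫_ℝ = 0 → ⟪x, J e⟫_ℝ = 0 → ⟪x, K e⟫_ℝ = 0 → x = 0 := by
    intro x x0 x1 x2 x3
    have hli : LinearIndependent ℝ ![e, I e, J e, K e] := by
      rw [Fintype.linearIndependent_iff]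
      intro g hg
      simp only [Fin.sum_univ_four, Matrix.cons_val] at hg
      obtain ⟨g0, g1, g2, g3⟩ := h.coeff_eq_zero he0 hg
      intro i; fin_cases i <;> assumption
    have htop := hli.span_eq_top_of_card_eq_finrank (by simp [hV])
    have hx : x ∈ Submodule.span ℝ (Set.range ![e, I e, J e, K e]) := htop ▸ Submodule.mem_top
    have : ∀ y ∈ Submodule.span ℝ (Set.range ![e, I e, J e, K e]), ⟪x, y⟫_ℝ = 0 := by
      intro y hy
      induction hy using Submodule.span_induction with
      | mem y hy =>
        obtain ⟨i, rfl⟩ := hy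
        fin_cases i <;> assumption
      | zero => exact inner_zero_right _
      | add y z _ _ hy hz => rw [inner_add_right, hy, hz, add_zero]
      | smul c y _ hy => rw [real_inner_smul_right, hy, mul_zero]
    exact inner_self_eq_zero.1 (this x hx)
  have self : ∀ (T : V → V), (∀ v w, ⟪T v, w⟫_ℝ = -⟪v, T w⟫_ℝ) → (∀ v, T (I v) = -I (T v)) →
      ∀ v, ⟪T v, v⟫_ℝ = 0 ∧ ⟪T v, I v⟫_ℝ = 0 := by
    intro T hT hTI v
    constructor
    · linarith [hT v v, real_inner_comm (T v) v]
    · have k := hT v (I v)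
      rw [hTI, inner_neg_right, neg_neg] at k
      have k' := h.inner_left₁ v (T v)
      linarith [real_inner_comm (T v) (I v)]
  obtain ⟨c1, c2, c3⟩ := h.inner_cross e
  set q := ⟪S e, J e⟫_ℝ with hq
  set r := ⟪S e, K e⟫_ℝ with hr
  let T : V → V := fun v ↦ S v - (q • J v + r • K v)
  have hT : ∀ v w, ⟪T v, w⟫_ℝ = -⟪v, T w⟫_ℝ := by
    intro v w
    simp only [T, inner_sub_left, inner_add_left, inner_sub_right, inner_add_right,
      real_inner_smul_left, real_inner_smul_right, skew v w, h.inner_left₂ v w, h.inner_left₃ v w]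
    ring
  have hTI : ∀ v, T (I v) = -I (T v) := by
    intro v
    simp only [T, anti, map_sub, map_add, map_smul, h.mul_eq₁₂, h.mul_eq₁₃, h.mul_eq₂₁, h.mul_eq₃₁]
    module
  have hTJ : ∀ v, ⟪T v, J e⟫_ℝ = ⟪S v, J e⟫_ℝ - (q * ⟪J v, J e⟫_ℝ + r * ⟪K v, J e⟫_ℝ) := fun v ↦ by
    simp only [T, inner_sub_left, inner_add_left, real_inner_smul_left]
  have hTK : ∀ v, ⟪T v, K e⟫_ℝ = ⟪S v, K e⟫_ℝ - (q * ⟪J v, K e⟫_ℝ + r * ⟪K v, K e⟫_ℝ) := fun v ↦ by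
    simp only [T, inner_sub_left, inner_add_left, real_inner_smul_left]
  have t0 : T e = 0 := by
    refine hspan _ (self T hT hTI e).1 (self T hT hTI e).2 ?_ ?_
    · rw [hTJ, h.orth₂, hee, real_inner_comm (J e) (K e), c2, ← hq]; ring
    · rw [hTK, h.orth₃, hee, c2, ← hr]; ring
  have t1 : T (I e) = 0 := by rw [hTI, t0, map_zero, neg_zero]
  have t2 : T (J e) = 0 := by
    refine hspan _ ?_ ?_ (self T hT hTI (J e)).1 ?_
    · rw [hT, t0, inner_zero_right, neg_zero]
    · rw [hT, t1, inner_zero_right, neg_zero]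
    · rw [← h.mul_eq₁₂]; exact (self T hT hTI (J e)).2
  have t3 : T (K e) = 0 := by rw [← h.mul_eq₁₂, hTI, t2, map_zero, neg_zero]
  refine ⟨q, r, fun v ↦ sub_eq_zero.1 (hspan (T v) ?_ ?_ ?_ ?_)⟩
  · rw [hT, t0, inner_zero_right, neg_zero]
  · rw [hT, t1, inner_zero_right, neg_zero]
  · rw [hT, t2, inner_zero_right, neg_zero]
  · rw [hT, t3, inner_zero_right, neg_zero]

/-- An element of the span of a quaternionic triple that anticommutes with `I` is a combination of
`J` and `K`. -/
lemma IsQuaternionicTriple.exists_of_mem_span [Nontrivial V] (h : IsQuaternionicTriple I J K)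
    {B : V →L[ℝ] V} (hB : B ∈ Submodule.span ℝ {I, J, K}) (anti : ∀ v, B (I v) = -I (B v)) :
    ∃ q r : ℝ, ∀ v, B v = q • J v + r • K v := by
  obtain ⟨p, q, r, rfl⟩ := Submodule.mem_span_triple.1 hB
  obtain ⟨e, he⟩ := exists_ne (0 : V)
  have k := anti e
  simp only [add_apply, smul_apply, map_add, map_smul, h.sq₁, h.mul_eq₂₁, h.mul_eq₃₁, h.mul_eq₁₂,
    h.mul_eq₁₃] at k
  have k' : (-(2 * p)) • e + (0 : ℝ) • I e + (0 : ℝ) • J e + (0 : ℝ) • K e = 0 := by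
    linear_combination (norm := module) k
  have hp : p = 0 := by linarith [(h.coeff_eq_zero he k').1]
  exact ⟨q, r, fun v ↦ by simp [hp]⟩

/-- The connection forms, in a fixed direction, of an almost hypercomplex structure with covariant
derivatives `S₁`, `S₂`, `S₃`. Only the third derivative is constrained by the product rule for
`K = I J`; that makes the coefficient matrix skew. -/
lemma IsQuaternionicTriple.exists_connectionForms [Nontrivial V] (h : IsQuaternionicTriple I J K)
    {S₁ S₂ S₃ : V → V} (prod : ∀ v, S₃ v = S₁ (J v) + I (S₂ v))
    (h₁ : ∃ q r : ℝ, ∀ v, S₁ v = q • J v + r • K v)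
    (h₂ : ∃ q r : ℝ, ∀ v, S₂ v = q • K v + r • I v)
    (h₃ : ∃ q r : ℝ, ∀ v, S₃ v = q • I v + r • J v) :
    ∃ a b c : ℝ, ∀ v, S₁ v = c • J v - b • K v ∧ S₂ v = a • K v - c • I v ∧
      S₃ v = b • I v - a • J v := by
  obtain ⟨q₁, r₁, e₁⟩ := h₁
  obtain ⟨q₂, r₂, e₂⟩ := h₂
  obtain ⟨q₃, r₃, e₃⟩ := h₃
  obtain ⟨e, he⟩ := exists_ne (0 : V)
  have k := prod e
  simp only [e₁, e₂, e₃, map_add, map_smul, h.sq₁, h.sq₂, h.mul_eq₁₃, h.mul_eq₃₂] at k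
  have k' : (q₁ + r₂) • e + (q₃ + r₁) • I e + (r₃ + q₂) • J e + (0 : ℝ) • K e = 0 := by
    linear_combination (norm := module) k
  obtain ⟨d0, d1, d2, -⟩ := h.coeff_eq_zero he k'
  refine ⟨q₂, -r₁, q₁, fun v ↦ ⟨by rw [e₁]; module, ?_, ?_⟩⟩
  · rw [e₂, show r₂ = -q₁ by linarith]; module
  · rw [e₃, show q₃ = -r₁ by linarith, show r₃ = -q₂ by linarith]; module

end ConnectionForms

/-! ### Lee forms -/

section LeeForms

variable {V : Type*} [NormedAddCommGroup V] [InnerProductSpace ℝ V] {I J K : V →L[ℝ] V}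

/-- If the three Lee forms agree, they determine the connection forms: the Lee forms of `I`, `J`,
`K` are the halves of `c ∘ K + b ∘ J`, `a ∘ I + c ∘ K` and `b ∘ J + a ∘ I`, whence
`a ∘ I = b ∘ J = c ∘ K = φ`. -/
lemma IsQuaternionicTriple.connectionForms_eq [Nontrivial V] [FiniteDimensional ℝ V]
    (h : IsQuaternionicTriple I J K)
    {D₁ D₂ D₃ : V → V →L[ℝ] V} {φ : V →L[ℝ] ℝ}
    (hD : ∀ u, ∃ a b c : ℝ, ∀ v, D₁ v u = c • J v - b • K v ∧ D₂ v u = a • K v - c • I v ∧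
      D₃ v u = b • I v - a • J v)
    (h₁ : ∀ v, (1 / 2) * LinearMap.trace ℝ V (I ∘L D₁ v : V →L[ℝ] V) = φ v)
    (h₂ : ∀ v, (1 / 2) * LinearMap.trace ℝ V (J ∘L D₂ v : V →L[ℝ] V) = φ v)
    (h₃ : ∀ v, (1 / 2) * LinearMap.trace ℝ V (K ∘L D₃ v : V →L[ℝ] V) = φ v) (u v : V) :
    D₁ v u = φ (J u) • K v - φ (K u) • J v ∧ D₂ v u = φ (K u) • I v - φ (I u) • K v ∧
      D₃ v u = φ (I u) • J v - φ (J u) • I v := by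
  choose a b c hD using hD
  obtain ⟨e, he⟩ := exists_ne (0 : V)
  have hee : ⟪e, e⟫_ℝ ≠ 0 := inner_self_ne_zero.2 he
  obtain ⟨c1, c2, c3⟩ := h.inner_cross e
  -- the forms are linear, because they are components of `D₁`, `D₂`
  have lin : ∀ (D : V →L[ℝ] V) (w : V), ∃ f : V →ₗ[ℝ] ℝ, ∀ u, f u = (⟪e, e⟫_ℝ)⁻¹ * ⟪w, D u⟫_ℝ :=
    fun D w ↦ ⟨((⟪e, e⟫_ℝ)⁻¹ • innerSL ℝ w ∘L D : V →L[ℝ] ℝ), fun u ↦ by simp⟩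
  obtain ⟨fc, hfc⟩ := lin (D₁ e) (J e)
  obtain ⟨fb, hfb⟩ := lin (D₁ e) (-K e)
  obtain ⟨fa, hfa⟩ := lin (D₂ e) (K e)
  have hc : ∀ u, fc u = c u := fun u ↦ by
    rw [hfc, (hD u e).1, inner_sub_right, real_inner_smul_right, real_inner_smul_right, h.orth₂, c2]
    field_simp; ring
  have hb : ∀ u, fb u = b u := fun u ↦ by
    rw [hfb, (hD u e).1, inner_sub_right, real_inner_smul_right, real_inner_smul_right,
      inner_neg_left, inner_neg_left, h.orth₃, real_inner_comm (J e) (K e), c2]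
    field_simp; ring
  have ha : ∀ u, fa u = a u := fun u ↦ by
    rw [hfa, (hD u e).2.1, inner_sub_right, real_inner_smul_right, real_inner_smul_right, h.orth₃,
      real_inner_comm (I e) (K e), c3]
    field_simp; ring
  let o := stdOrthonormalBasis ℝ V
  have key : ∀ (T : V →L[ℝ] V) (f g : V →ₗ[ℝ] ℝ) (w z : V), (∀ u, T u = f u • w + g u • z) →
      LinearMap.trace ℝ V (T : V →L[ℝ] V) = f w + g z := by
    intro T f g w z hT
    rw [LinearMap.trace_eq_sum_inner _ o, ← sum_mul_inner' o f, ← sum_mul_inner' o g,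
      ← Finset.sum_add_distrib]
    refine Finset.sum_congr rfl fun i _ ↦ ?_
    rw [ContinuousLinearMap.coe_coe, hT, inner_add_right, real_inner_smul_right,
      real_inner_smul_right]
  have k₁ : ∀ v, (1 / 2) * (fc (K v) + fb (J v)) = φ v := fun v ↦ by
    rw [← h₁ v, key _ fc fb (K v) (J v)]
    intro u
    rw [ContinuousLinearMap.comp_apply, (hD u v).1, map_sub, map_smul, map_smul, h.mul_eq₁₂,
      h.mul_eq₁₃, hc, hb]
    module
  have k₂ : ∀ v, (1 / 2) * (fa (I v) + fc (K v)) = φ v := fun v ↦ by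
    rw [← h₂ v, key _ fa fc (I v) (K v)]
    intro u
    rw [ContinuousLinearMap.comp_apply, (hD u v).2.1, map_sub, map_smul, map_smul, h.mul_eq₂₃,
      h.mul_eq₂₁, hc, ha]
    module
  have k₃ : ∀ v, (1 / 2) * (fb (J v) + fa (I v)) = φ v := fun v ↦ by
    rw [← h₃ v, key _ fb fa (J v) (I v)]
    intro u
    rw [ContinuousLinearMap.comp_apply, (hD u v).2.2, map_sub, map_smul, map_smul, h.mul_eq₃₁,
      h.mul_eq₃₂, hb, ha]
    module
  have ea : a u = -φ (I u) := by
    have e1 := k₁ (I u); have e2 := k₂ (I u); have e3 := k₃ (I u)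
    rw [h.sq₁, map_neg] at e2 e3
    rw [← ha]; linarith
  have eb : b u = -φ (J u) := by
    have e1 := k₁ (J u); have e2 := k₂ (J u); have e3 := k₃ (J u)
    rw [h.sq₂, map_neg] at e1 e3
    rw [← hb]; linarith
  have ec : c u = -φ (K u) := by
    have e1 := k₁ (K u); have e2 := k₂ (K u); have e3 := k₃ (K u)
    rw [h.sq₃, map_neg] at e1 e2
    rw [← hc]; linarith
  obtain ⟨d1, d2, d3⟩ := hD u v
  rw [d1, d2, d3, ea, eb, ec]
  refine ⟨?_, ?_, ?_⟩ <;> module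

/-- The symmetric part `D(u, u)` of `∇φ` is recovered from the sums `D(u, u) + D(I u, I u)` and the
analogues for `J` and `K`, as `D(J u, J u) + D(K u, K u)` is the first sum at `J u`. -/
lemma IsQuaternionicTriple.apply_self_eq (h : IsQuaternionicTriple I J K) {D : V → V → ℝ}
    {φ : V →L[ℝ] ℝ} {s : ℝ}
    (h₁ : ∀ u, D u u + D (I u) (I u) = φ (J u) ^ 2 + φ (K u) ^ 2 - s * ‖u‖ ^ 2)
    (h₂ : ∀ u, D u u + D (J u) (J u) = φ (K u) ^ 2 + φ (I u) ^ 2 - s * ‖u‖ ^ 2)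
    (h₃ : ∀ u, D u u + D (K u) (K u) = φ (I u) ^ 2 + φ (J u) ^ 2 - s * ‖u‖ ^ 2) (u : V) :
    D u u = (1 / 2) * (-φ u ^ 2 + (φ (I u) ^ 2 + φ (J u) ^ 2 + φ (K u) ^ 2) - s * ‖u‖ ^ 2) := by
  have e := h₁ (J u)
  rw [h.mul_eq₁₂, h.sq₂, h.mul_eq₃₂, map_neg, map_neg, neg_sq, neg_sq, ← real_inner_self_eq_norm_sq,
    h.orth₂, real_inner_self_eq_norm_sq] at e
  linarith [h₂ u, h₃ u]

end LeeForms

/-! ### Covariant derivatives of almost complex structures -/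

section CovariantDerivatives

set_option linter.unusedSectionVars false

variable {E : Type*} [NormedAddCommGroup E] [NormedSpace ℝ E] [FiniteDimensional ℝ E]
  {H : Type*} [TopologicalSpace H] {I : ModelWithCorners ℝ E H}
  {M : Type*} [TopologicalSpace M] [ChartedSpace H M] [IsManifold I ∞ M]
  [RiemannianBundle (fun x : M ↦ TangentSpace I x)]
  [IsContMDiffRiemannianBundle I ∞ E (fun x : M ↦ TangentSpace I x)]
  {A B C : Π x : M, TangentSpace I x →L[ℝ] TangentSpace I x} {U : Set M} {x : M}

lemma leviCivita_neg {S : Π x : M, TangentSpace I x} (hS : MDiffAt (T% S) x)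
    (u : TangentSpace I x) : leviCivita I M (fun y ↦ -S y) x u = -leviCivita I M S x u := by
  have h := leviCivita_smul (f := fun _ : M ↦ (-1 : ℝ)) (mdifferentiableAt_const (x := x)) hS u
  rw [mvfderiv_const] at h
  simpa [Pi.smul_def'] using h

lemma leviCivita_endo_endo_apply (hA : SmoothEndOn I U A) (hB : SmoothEndOn I U B) (hU : U ∈ 𝓝 x)
    {S : Π x : M, TangentSpace I x} (hS : MDiffAt (T% S) x) (u : TangentSpace I x) :
    leviCivita I M (fun y ↦ A y (B y (S y))) x u =
      covDerivEnd I A x (B x (S x)) u + A x (covDerivEnd I B x (S x) u)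
        + A x (B x (leviCivita I M S x u)) := by
  rw [leviCivita_endo_apply hA hU (hB.mdifferentiableAt_apply hU hS) u,
    leviCivita_endo_apply hB hU hS, map_add, add_assoc]

lemma covDerivEnd_mul (hA : SmoothEndOn I U A) (hB : SmoothEndOn I U B) (hC : SmoothEndOn I U C)
    (hU : U ∈ 𝓝 x) (h : ∀ y ∈ U, ∀ v, A y (B y v) = C y v) (v u : TangentSpace I x) :
    covDerivEnd I C x v u = covDerivEnd I A x (B x v) u + A x (covDerivEnd I B x v u) := by
  have hS : MDiffAt (T% (extend E v)) x := mdifferentiableAt_extend I E v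
  have e : (fun y ↦ C y (extend E v y)) =ᶠ[𝓝 x] fun y ↦ A y (B y (extend E v y)) := by
    filter_upwards [hU] with y hy using (h y hy _).symm
  have h1 := leviCivita_endo_apply hC hU hS u
  rw [leviCivita_congr (hC.mdifferentiableAt_apply hU hS) e,
    leviCivita_endo_endo_apply hA hB hU hS, h x (mem_of_mem_nhds hU), extend_apply_self] at h1
  exact (add_right_cancel h1).symm

lemma covDerivEnd_anti (hA : SmoothEndOn I U A) (hU : U ∈ 𝓝 x)
    (h : ∀ y ∈ U, ∀ v, A y (A y v) = -v) (v u : TangentSpace I x) :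
    covDerivEnd I A x (A x v) u = -A x (covDerivEnd I A x v u) := by
  have hS : MDiffAt (T% (extend E v)) x := mdifferentiableAt_extend I E v
  have e : (fun y ↦ A y (A y (extend E v y))) =ᶠ[𝓝 x] fun y ↦ -extend E v y := by
    filter_upwards [hU] with y hy using h y hy _
  have h1 := leviCivita_endo_endo_apply hA hA hU hS u
  rw [leviCivita_congr (hA.mdifferentiableAt_apply hU (hA.mdifferentiableAt_apply hU hS)) e,
    leviCivita_neg hS, h x (mem_of_mem_nhds hU), extend_apply_self] at h1
  rw [right_eq_add] at h1
  exact eq_neg_of_add_eq_zero_left h1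

lemma covDerivEnd_skew (hA : SmoothEndOn I U A) (hU : U ∈ 𝓝 x)
    (h : ∀ y ∈ U, ∀ v w, ⟪A y v, w⟫_ℝ = -⟪v, A y w⟫_ℝ) (v w u : TangentSpace I x) :
    ⟪covDerivEnd I A x v u, w⟫_ℝ = -⟪v, covDerivEnd I A x w u⟫_ℝ := by
  have hv : MDiffAt (T% (extend E v)) x := mdifferentiableAt_extend I E v
  have hw : MDiffAt (T% (extend E w)) x := mdifferentiableAt_extend I E w
  have e : (fun y ↦ ⟪A y (extend E v y), extend E w y⟫_ℝ + ⟪extend E v y, A y (extend E w y)⟫_ℝ)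
      =ᶠ[𝓝 x] fun _ ↦ 0 := by
    filter_upwards [hU] with y hy
    rw [h y hy]; ring
  have hAv := hA.mdifferentiableAt_apply hU hv
  have hAw := hA.mdifferentiableAt_apply hU hw
  have h1 := congrArg (fun L ↦ L u) (mvfderiv_congr e)
  rw [mvfderiv_fun_add (mdiff_inner hAv hw) (mdiff_inner hv hAw), mvfderiv_const] at h1
  simp only [add_apply, zero_apply] at h1
  rw [leviCivita_metric hAv hw, leviCivita_metric hv hAw, leviCivita_endo_apply hA hU hv,
    leviCivita_endo_apply hA hU hw] at h1
  simp only [extend_apply_self, inner_add_left, inner_add_right] at h1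
  have hx := h x (mem_of_mem_nhds hU)
  rw [hx, hx] at h1
  linarith

end CovariantDerivatives

/-! ### The commutator of the curvature with a complex structure -/

section Commutator

set_option linter.unusedSectionVars false

variable {E : Type*} [NormedAddCommGroup E] [NormedSpace ℝ E] [FiniteDimensional ℝ E]
  {H : Type*} [TopologicalSpace H] {I : ModelWithCorners ℝ E H}
  {M : Type*} [TopologicalSpace M] [ChartedSpace H M] [IsManifold I ∞ M]
  [RiemannianBundle (fun x : M ↦ TangentSpace I x)]
  [IsContMDiffRiemannianBundle I ∞ E (fun x : M ↦ TangentSpace I x)]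
  {J₁ J₂ J₃ : Π x : M, TangentSpace I x →L[ℝ] TangentSpace I x} {U : Set M} {x : M}
  {φ : Π x : M, TangentSpace I x →L[ℝ] ℝ}

/-- The product rule for the derivative of `φ(A V)`. -/
lemma mvfderiv_form_endo {A : Π x : M, TangentSpace I x →L[ℝ] TangentSpace I x}
    (hφ : SmoothForm I φ) (hA : SmoothEndOn I U A) (hU : U ∈ 𝓝 x)
    {V : Π x : M, TangentSpace I x} (hV : MDiffAt (T% V) x) (u : TangentSpace I x) :
    d% (fun y ↦ φ y (A y (V y))) x u = covDerivForm I φ x u (A x (V x))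
      + φ x (covDerivEnd I A x (V x) u) + φ x (A x (leviCivita I M V x u)) := by
  have hX := (contMDiffAt_sharp hφ x).mdifferentiableAt (by simp)
  have h := leviCivita_metric hX (hA.mdifferentiableAt_apply hU hV) u
  simp only [inner_sharp] at h
  rw [h, covDerivForm_eq hφ, leviCivita_endo_apply hA hU hV, map_add]
  ring

lemma leviCivita_comb {f g : M → ℝ} {S T W : Π x : M, TangentSpace I x} (hf : MDiffAt f x)
    (hg : MDiffAt g x) (hS : MDiffAt (T% S) x) (hT : MDiffAt (T% T) x) (hW : MDiffAt (T% W) x)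
    (u : TangentSpace I x) :
    leviCivita I M (f • S - g • T + W) x u = f x • leviCivita I M S x u + d% f x u • S x
      - (g x • leviCivita I M T x u + d% g x u • T x) + leviCivita I M W x u := by
  have e : f • S - g • T + W = f • S + ((fun y ↦ -g y) • T + W) := by
    funext y
    simp only [Pi.add_apply, Pi.sub_apply, Pi.smul_apply', neg_smul]
    abel
  have hg' : MDiffAt (fun y ↦ -g y) x := hg.neg
  have h1 := hf.smul_section hS
  have h2 := hg'.smul_section hT
  have hn : d% (fun y ↦ -g y) x = -d% g x := mvfderiv_neg
  rw [e, leviCivita_add h1 (mdifferentiableAt_add_section h2 hW), leviCivita_add h2 hW,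
    add_apply, add_apply, leviCivita_smul hf hS, leviCivita_smul hg' hT, hn, neg_apply]
  module

/-- The commutator of the curvature with `J₁`, for an almost hypercomplex structure whose connection
forms are `-φ ∘ J₁`, `-φ ∘ J₂`, `-φ ∘ J₃`. -/
lemma curvature_endo_sub (hφ : SmoothForm I φ) (h₁ : SmoothEndOn I U J₁) (h₂ : SmoothEndOn I U J₂)
    (h₃ : SmoothEndOn I U J₃) (hUo : IsOpen U) (hx : x ∈ U)
    (d₁ : ∀ y ∈ U, ∀ v u, covDerivEnd I J₁ y v u = φ y (J₂ y u) • J₃ y v - φ y (J₃ y u) • J₂ y v)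
    (d₂ : ∀ y ∈ U, ∀ v u, covDerivEnd I J₂ y v u = φ y (J₃ y u) • J₁ y v - φ y (J₁ y u) • J₃ y v)
    (d₃ : ∀ y ∈ U, ∀ v u, covDerivEnd I J₃ y v u = φ y (J₁ y u) • J₂ y v - φ y (J₂ y u) • J₁ y v)
    (u v w : TangentSpace I x) :
    curvature I x u v (J₁ x w) - J₁ x (curvature I x u v w) =
      (-covDerivForm I φ x u (J₃ x v) + covDerivForm I φ x v (J₃ x u)
        + φ x (J₂ x u) * φ x (J₁ x v) - φ x (J₁ x u) * φ x (J₂ x v)) • J₂ x w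
      - (-covDerivForm I φ x u (J₂ x v) + covDerivForm I φ x v (J₂ x u)
        + φ x (J₁ x u) * φ x (J₃ x v) - φ x (J₃ x u) * φ x (J₁ x v)) • J₃ x w := by
  have hU : U ∈ 𝓝 x := hUo.mem_nhds hx
  have md : ∀ {A : Π x : M, TangentSpace I x}, CMDiffAt ∞ (T% A) x → MDiffAt (T% A) x :=
    fun h ↦ h.mdifferentiableAt (by simp)
  have mf : ∀ {f : M → ℝ}, CMDiffAt ∞ f x → MDiffAt f x := fun h ↦ h.mdifferentiableAt (by simp)
  set W := extend E w with hWdef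
  have hW : CMDiffAt ∞ (T% W) x := contMDiffAt_extend I E w
  have hWx : W x = w := extend_apply_self ..
  -- second covariant derivatives of `J₁ W`
  have key : ∀ {P Q : Π x : M, TangentSpace I x}, CMDiffAt ∞ (T% P) x → CMDiffAt ∞ (T% Q) x →
      leviCivita I M (fun y ↦ leviCivita I M (fun z ↦ J₁ z (W z)) y (Q y)) x (P x) =
        φ x (J₂ x (Q x)) • (covDerivEnd I J₃ x w (P x) + J₃ x (leviCivita I M W x (P x)))
        + (covDerivForm I φ x (P x) (J₂ x (Q x)) + φ x (covDerivEnd I J₂ x (Q x) (P x))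
          + φ x (J₂ x (leviCivita I M Q x (P x)))) • J₃ x w
        - (φ x (J₃ x (Q x)) • (covDerivEnd I J₂ x w (P x) + J₂ x (leviCivita I M W x (P x)))
        + (covDerivForm I φ x (P x) (J₃ x (Q x)) + φ x (covDerivEnd I J₃ x (Q x) (P x))
          + φ x (J₃ x (leviCivita I M Q x (P x)))) • J₂ x w)
        + (covDerivEnd I J₁ x (leviCivita I M W x (Q x)) (P x)
          + J₁ x (leviCivita I M (fun y ↦ leviCivita I M W y (Q y)) x (P x))) := by
    intro P Q hP hQ
    have hJW := h₁.contMDiffAt_apply hU hW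
    have e : (fun y ↦ leviCivita I M (fun z ↦ J₁ z (W z)) y (Q y)) =ᶠ[𝓝 x]
        (fun y ↦ φ y (J₂ y (Q y))) • (fun y ↦ J₃ y (W y))
          - (fun y ↦ φ y (J₃ y (Q y))) • (fun y ↦ J₂ y (W y))
          + fun y ↦ J₁ y (leviCivita I M W y (Q y)) := by
      filter_upwards [hU, eventually_mdifferentiableAt hW] with y hy hWy
      rw [leviCivita_endo_apply h₁ (hUo.mem_nhds hy) hWy, d₁ y hy]
      rfl
    have hWQ := contMDiffAt_leviCivita hQ hW
    rw [leviCivita_congr (md (contMDiffAt_leviCivita hQ hJW)) e,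
      leviCivita_comb (mf (hφ.contMDiffAt_apply (h₂.contMDiffAt_apply hU hQ)))
        (mf (hφ.contMDiffAt_apply (h₃.contMDiffAt_apply hU hQ)))
        (h₃.mdifferentiableAt_apply hU (md hW)) (h₂.mdifferentiableAt_apply hU (md hW))
        (h₁.mdifferentiableAt_apply hU (md hWQ)),
      leviCivita_endo_apply h₃ hU (md hW), leviCivita_endo_apply h₂ hU (md hW),
      leviCivita_endo_apply h₁ hU (md hWQ), mvfderiv_form_endo hφ h₂ hU (md hQ),
      mvfderiv_form_endo hφ h₃ hU (md hQ), hWx]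
  set P := extend E u with hPdef
  set Q := extend E v with hQdef
  have hP : CMDiffAt ∞ (T% P) x := contMDiffAt_extend I E u
  have hQ : CMDiffAt ∞ (T% Q) x := contMDiffAt_extend I E v
  have hPx : P x = u := extend_apply_self ..
  have hQx : Q x = v := extend_apply_self ..
  have k1 := key hP hQ
  have k2 := key hQ hP
  have k3 := leviCivita_endo_apply h₁ hU (md hW) (mlieBracket I P Q x)
  have k4 := leviCivita_sub_swap (md hP) (md hQ)
  have c1 := fieldCurvature_extend u v (h₁.contMDiffAt_apply hU hW)
  have c2 := fieldCurvature_extend u v hW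
  simp only [hWx, ← hPdef, ← hQdef, fieldCurvature] at c1 c2
  rw [← c1, ← c2, k1, k2, k3, ← k4]
  simp only [hWx, hPx, hQx, d₁ x hx, d₂ x hx, d₃ x hx, map_sub, map_smul, smul_eq_mul]
  module

end Commutator

/-! ### Hypercomplex structures on quaternionic Kähler manifolds -/

section LocalStructure

set_option linter.unusedSectionVars false

variable {n : ℕ} {M : Type*} [TopologicalSpace M]
  [ChartedSpace (EuclideanSpace ℝ (Fin (4 * n))) M] [IsManifold (𝓡 (4 * n)) ∞ M]
  [RiemannianBundle (fun x : M ↦ TangentSpace (𝓡 (4 * n)) x)]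
  {Q : Π x : M, Submodule ℝ (TangentSpace (𝓡 (4 * n)) x →L[ℝ] TangentSpace (𝓡 (4 * n)) x)}
  {U : Set M} {J₁ J₂ J₃ : Π x : M, TangentSpace (𝓡 (4 * n)) x →L[ℝ] TangentSpace (𝓡 (4 * n)) x}

lemma finrank_tangentSpace (x : M) : finrank ℝ (TangentSpace (𝓡 (4 * n)) x) = 4 * n :=
  (finrank_euclideanSpace_fin (𝕜 := ℝ) (n := 4 * n) :)

lemma IsLocalFrame.rotate (h : IsLocalFrame Q U J₁ J₂ J₃) : IsLocalFrame Q U J₂ J₃ J₁ where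
  smooth₁ := h.smooth₂
  smooth₂ := h.smooth₃
  smooth₃ := h.smooth₁
  frame x hx := by
    refine ⟨(h.frame x hx).1.rotate, (h.frame x hx).2.trans ?_⟩
    rw [Set.insert_comm, Set.pair_comm, Set.insert_comm]

variable [IsContMDiffRiemannianBundle (𝓡 (4 * n)) ∞ (EuclideanSpace ℝ (Fin (4 * n)))
  (fun x : M ↦ TangentSpace (𝓡 (4 * n)) x)]

/-- The covariant derivatives of the first member of a local frame are combinations of the other
two: for `n > 1` because `Q` is parallel, for `n = 1` by linear algebra. -/
lemma IsQuaternionicKahler.covDerivEnd_eq (hQ : IsQuaternionicKahler Q) (hn : 1 ≤ n)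
    (h : IsLocalFrame Q U J₁ J₂ J₃) (hU : IsOpen U) {x : M} (hx : x ∈ U)
    (u : TangentSpace (𝓡 (4 * n)) x) :
    ∃ q r : ℝ, ∀ v, covDerivEnd (𝓡 (4 * n)) J₁ x v u = q • J₂ x v + r • J₃ x v := by
  have hf := h.frame x hx
  have hxU := hU.mem_nhds hx
  have anti := covDerivEnd_anti h.smooth₁ hxU fun y hy ↦ (h.frame y hy).1.sq₁
  have : Nontrivial (TangentSpace (𝓡 (4 * n)) x) :=
    Module.nontrivial_of_finrank_pos (R := ℝ) (by rw [finrank_tangentSpace]; omega)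
  rcases hn.lt_or_eq with hn | rfl
  · obtain ⟨B, hB, hBv⟩ := hQ.parallel hn U J₁ hU h.smooth₁
      (fun y hy ↦ by rw [(h.frame y hy).2]; exact Submodule.subset_span (by simp)) x hx u
    rw [hf.2] at hB
    simp only [hBv] at anti ⊢
    exact hf.1.exists_of_mem_span hB fun v ↦ by rw [← hBv, ← hBv, anti]
  · exact hf.1.exists_of_finrank_eq_four (finrank_tangentSpace x)
      (S := fun v ↦ covDerivEnd (𝓡 (4 * 1)) J₁ x v u)
      (fun v w ↦ covDerivEnd_skew h.smooth₁ hxU (fun y hy ↦ (h.frame y hy).1.inner_left₁) v w u)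
      fun v ↦ anti v u

lemma IsQuaternionicKahler.exists_connectionForms (hQ : IsQuaternionicKahler Q) (hn : 1 ≤ n)
    (h : IsLocalFrame Q U J₁ J₂ J₃) (hU : IsOpen U) {x : M} (hx : x ∈ U)
    (u : TangentSpace (𝓡 (4 * n)) x) :
    ∃ a b c : ℝ, ∀ v, covDerivEnd (𝓡 (4 * n)) J₁ x v u = c • J₂ x v - b • J₃ x v ∧
      covDerivEnd (𝓡 (4 * n)) J₂ x v u = a • J₃ x v - c • J₁ x v ∧
      covDerivEnd (𝓡 (4 * n)) J₃ x v u = b • J₁ x v - a • J₂ x v := by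
  have hxU := hU.mem_nhds hx
  have : Nontrivial (TangentSpace (𝓡 (4 * n)) x) :=
    Module.nontrivial_of_finrank_pos (R := ℝ) (by rw [finrank_tangentSpace]; omega)
  exact (h.frame x hx).1.exists_connectionForms
    (fun v ↦ covDerivEnd_mul h.smooth₁ h.smooth₂ h.smooth₃ hxU
      (fun y hy ↦ (h.frame y hy).1.mul_eq₁₂) v u)
    (hQ.covDerivEnd_eq hn h hU hx u) (hQ.covDerivEnd_eq hn h.rotate hU hx u)
    (hQ.covDerivEnd_eq hn h.rotate.rotate hU hx u)

/-- The coefficients of the commutator relations of a quaternionic Kähler curvature. -/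
lemma IsQuaternionicKahler.commutator_apply_self (hQ : IsQuaternionicKahler Q) (hn : 1 ≤ n)
    {x : M} {I J K : TangentSpace (𝓡 (4 * n)) x →L[ℝ] TangentSpace (𝓡 (4 * n)) x}
    (hT : IsQuaternionicTriple I J K) (hI : I ∈ Q x)
    {A B C : TangentSpace (𝓡 (4 * n)) x → TangentSpace (𝓡 (4 * n)) x → ℝ}
    {r : TangentSpace (𝓡 (4 * n)) x →ₗ[ℝ] TangentSpace (𝓡 (4 * n)) x →ₗ[ℝ]
      TangentSpace (𝓡 (4 * n)) x →ₗ[ℝ] TangentSpace (𝓡 (4 * n)) x →ₗ[ℝ] ℝ}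
    (hr : IsCurvatureTensor r) (hrc : ∀ u v w z, r u v w z = ⟪curvature (𝓡 (4 * n)) x u v w, z⟫_ℝ)
    (h : CommutatorRelations r I J K A B C) (u : TangentSpace (𝓡 (4 * n)) x) :
    A u (I u) = -reducedScalarCurvature n x * ‖u‖ ^ 2 := by
  have hric : ∀ v w, ricciContraction (stdOrthonormalBasis ℝ (TangentSpace (𝓡 (4 * n)) x)) r v w =
      ricci (𝓡 (4 * n)) x v w := fun v w ↦ Finset.sum_congr rfl fun i _ ↦ hrc ..
  have hs : ∑ i, ricciContraction (stdOrthonormalBasis ℝ (TangentSpace (𝓡 (4 * n)) x)) r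
      (stdOrthonormalBasis ℝ (TangentSpace (𝓡 (4 * n)) x) i)
      (stdOrthonormalBasis ℝ (TangentSpace (𝓡 (4 * n)) x) i) = scalarCurvature (𝓡 (4 * n)) x :=
    Finset.sum_congr rfl fun i _ ↦ hric ..
  rcases hn.lt_or_eq with hn | rfl
  · have k := h.apply_self (b := stdOrthonormalBasis ℝ (TangentSpace (𝓡 (4 * n)) x)) hT hr
      (by rw [Fintype.card_fin]; exact finrank_tangentSpace x) hn u
    rw [k, hs, reducedScalarCurvature]
  · obtain ⟨c, hc⟩ := hQ.einstein rfl
    have k := h.apply_self_of_weyl (b := stdOrthonormalBasis ℝ (TangentSpace (𝓡 (4 * 1)) x)) hT hr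
      (by rw [Fintype.card_fin]; exact finrank_tangentSpace x)
      (fun u v ↦ (hric u v).trans (hc x u v))
      (fun u v ↦ by
        simp only [hric, hrc]
        exact hQ.selfDual rfl x I hI u v) u
    rw [k, hs, reducedScalarCurvature]
    norm_num

/-- A hypercomplex structure with Lee form `φ` solves the symmetric part of the equation
for `∇φ`. -/
lemma IsQuaternionicKahler.leviCivita_sharp_leeForm (hQ : IsQuaternionicKahler Q) (hn : 1 ≤ n)
    (h : IsLocalFrame Q U J₁ J₂ J₃) (hU : IsOpen U)
    {φ : Π x : M, TangentSpace (𝓡 (4 * n)) x →L[ℝ] ℝ} (hφ : SmoothForm (𝓡 (4 * n)) φ)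
    (hL : ∀ y ∈ U, ∀ v : TangentSpace (𝓡 (4 * n)) y, leeForm (𝓡 (4 * n)) J₁ y v = φ y v ∧
      leeForm (𝓡 (4 * n)) J₂ y v = φ y v ∧ leeForm (𝓡 (4 * n)) J₃ y v = φ y v)
    {x : M} (hx : x ∈ U) (u : TangentSpace (𝓡 (4 * n)) x) :
    ⟪leviCivita (𝓡 (4 * n)) M (sharp φ) x u, u⟫_ℝ = (1 / 2) * (-φ x u ^ 2
      + (φ x (J₁ x u) ^ 2 + φ x (J₂ x u) ^ 2 + φ x (J₃ x u) ^ 2)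
      - reducedScalarCurvature n x * ‖u‖ ^ 2) := by
  have hd : ∀ y ∈ U, ∀ v u, covDerivEnd (𝓡 (4 * n)) J₁ y v u =
        φ y (J₂ y u) • J₃ y v - φ y (J₃ y u) • J₂ y v ∧
      covDerivEnd (𝓡 (4 * n)) J₂ y v u = φ y (J₃ y u) • J₁ y v - φ y (J₁ y u) • J₃ y v ∧
      covDerivEnd (𝓡 (4 * n)) J₃ y v u = φ y (J₁ y u) • J₂ y v - φ y (J₂ y u) • J₁ y v := by
    intro y hy v u
    have : Nontrivial (TangentSpace (𝓡 (4 * n)) y) :=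
      Module.nontrivial_of_finrank_pos (R := ℝ) (by rw [finrank_tangentSpace]; omega)
    exact (h.frame y hy).1.connectionForms_eq (hQ.exists_connectionForms hn h hU hy)
      (fun v ↦ (hL y hy v).1) (fun v ↦ (hL y hy v).2.1) (fun v ↦ (hL y hy v).2.2) u v
  have d₁ := fun y hy v u ↦ (hd y hy v u).1
  have d₂ := fun y hy v u ↦ (hd y hy v u).2.1
  have d₃ := fun y hy v u ↦ (hd y hy v u).2.2
  have hT := (h.frame x hx).1
  obtain ⟨r, hr, hrc⟩ := exists_isCurvatureTensor (curvature_swap (I := 𝓡 (4 * n)) x)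
    (inner_curvature_swap_right x) (curvature_bianchi x)
  have conv : ∀ {J S T : TangentSpace (𝓡 (4 * n)) x →L[ℝ] TangentSpace (𝓡 (4 * n)) x} {p q : ℝ}
      {u v w : TangentSpace (𝓡 (4 * n)) x} (z : TangentSpace (𝓡 (4 * n)) x),
      (∀ a b, ⟪J a, b⟫_ℝ = -⟪a, J b⟫_ℝ) →
      curvature (𝓡 (4 * n)) x u v (J w) - J (curvature (𝓡 (4 * n)) x u v w) = p • S w - q • T w →
      r u v (J w) z + r u v w (J z) = p * ⟪S w, z⟫_ℝ - q * ⟪T w, z⟫_ℝ := by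
    intro J S T p q u v w z hJ e
    have e' := congrArg (fun a ↦ ⟪a, z⟫_ℝ) e
    simp only [inner_sub_left, real_inner_smul_left, hJ] at e'
    rw [hrc, hrc, ← e']
    ring
  have hrel : CommutatorRelations r (J₁ x) (J₂ x) (J₃ x)
      (fun u v ↦ -covDerivForm (𝓡 (4 * n)) φ x u (J₁ x v) + covDerivForm (𝓡 (4 * n)) φ x v (J₁ x u)
        + φ x (J₃ x u) * φ x (J₂ x v) - φ x (J₂ x u) * φ x (J₃ x v))
      (fun u v ↦ -covDerivForm (𝓡 (4 * n)) φ x u (J₂ x v) + covDerivForm (𝓡 (4 * n)) φ x v (J₂ x u)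
        + φ x (J₁ x u) * φ x (J₃ x v) - φ x (J₃ x u) * φ x (J₁ x v))
      (fun u v ↦ -covDerivForm (𝓡 (4 * n)) φ x u (J₃ x v) + covDerivForm (𝓡 (4 * n)) φ x v (J₃ x u)
        + φ x (J₂ x u) * φ x (J₁ x v) - φ x (J₁ x u) * φ x (J₂ x v)) :=
    { rel₁ := fun u v w z ↦ conv z hT.inner_left₁
        (curvature_endo_sub hφ h.smooth₁ h.smooth₂ h.smooth₃ hU hx d₁ d₂ d₃ u v w)
      rel₂ := fun u v w z ↦ conv z hT.inner_left₂
        (curvature_endo_sub hφ h.smooth₂ h.smooth₃ h.smooth₁ hU hx d₂ d₃ d₁ u v w)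
      rel₃ := fun u v w z ↦ conv z hT.inner_left₃
        (curvature_endo_sub hφ h.smooth₃ h.smooth₁ h.smooth₂ hU hx d₃ d₁ d₂ u v w) }
  have mem : ∀ i : TangentSpace (𝓡 (4 * n)) x →L[ℝ] TangentSpace (𝓡 (4 * n)) x,
      i ∈ ({J₁ x, J₂ x, J₃ x} : Set _) → i ∈ Q x := fun i hi ↦ by
    rw [(h.frame x hx).2]; exact Submodule.subset_span hi
  have r₁ := hQ.commutator_apply_self hn hT (mem _ (by simp)) hr hrc hrel
  have r₂ := hQ.commutator_apply_self hn hT.rotate (mem _ (by simp)) hr hrc hrel.rotate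
  have r₃ := hQ.commutator_apply_self hn hT.rotate.rotate (mem _ (by simp)) hr hrc
    hrel.rotate.rotate
  simp only [hT.sq₁, hT.sq₂, hT.sq₃, hT.mul_eq₁₂, hT.mul_eq₂₃, hT.mul_eq₃₁, hT.mul_eq₂₁,
    hT.mul_eq₃₂, hT.mul_eq₁₃, covDerivForm_eq hφ, inner_neg_right, map_neg] at r₁ r₂ r₃
  exact hT.apply_self_eq (D := fun u v ↦ ⟪leviCivita (𝓡 (4 * n)) M (sharp φ) x u, v⟫_ℝ)
    (fun u ↦ by linarith [r₁ u]) (fun u ↦ by linarith [r₂ u]) (fun u ↦ by linarith [r₃ u]) u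

end LocalStructure

end QuatKaehler

end

theorem proposition5 {n : ℕ} (hn : 1 ≤ n) {M : Type*} [TopologicalSpace M]
    [ChartedSpace (EuclideanSpace ℝ (Fin (4 * n))) M] [IsManifold (𝓡 (4 * n)) ∞ M]
    [T2Space M] [CompactSpace M] [Nonempty M]
    [RiemannianBundle (fun x : M ↦ TangentSpace (𝓡 (4 * n)) x)]
    [IsContMDiffRiemannianBundle (𝓡 (4 * n)) ∞ (EuclideanSpace ℝ (Fin (4 * n)))
      (fun x : M ↦ TangentSpace (𝓡 (4 * n)) x)]
    (Q : Π x : M, Submodule ℝ (TangentSpace (𝓡 (4 * n)) x →L[ℝ] TangentSpace (𝓡 (4 * n)) x))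
    (hQ : QuatKaehler.IsQuaternionicKahler Q) :
    (¬ ∃ φ : Π x : M, TangentSpace (𝓡 (4 * n)) x →L[ℝ] ℝ,
      QuatKaehler.SmoothForm (𝓡 (4 * n)) φ ∧ QuatKaehler.SolvesLeeEquation Q φ) ∧
    ¬ ∃ φ : Π x : M, TangentSpace (𝓡 (4 * n)) x →L[ℝ] ℝ,
      QuatKaehler.SmoothForm (𝓡 (4 * n)) φ ∧
        QuatKaehler.LocallyHypercomplexWithLeeForm Q φ := by
  have hν : ∀ x : M, QuatKaehler.reducedScalarCurvature n x ≠ 0 := fun x ↦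
    div_ne_zero (hQ.scalarCurvature_ne_zero x) (by positivity)
  have hE : 0 < finrank ℝ (EuclideanSpace ℝ (Fin (4 * n))) := by
    rw [finrank_euclideanSpace_fin]; omega
  constructor
  · rintro ⟨φ, hφ, Φ, hΦ, heq⟩
    refine QuatKaehler.not_exists_vectorField hE (QuatKaehler.contMDiffAt_sharp hφ) hν fun x ↦ ?_
    obtain ⟨U, -, hx, J₁, J₂, J₃, hJ⟩ := hQ.almostQuaternionicHermitian x
    refine ⟨J₁ x, J₂ x, J₃ x, (hJ.frame x hx).1, fun u ↦ ?_⟩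
    -- the 2-form `Φ` does not contribute to the symmetric part
    have h0 : Φ x u u = 0 := by linarith [(hΦ x u u).1]
    have h1 := heq x _ _ _ (hJ.frame x hx) u u
    rw [QuatKaehler.covDerivForm_eq hφ, h0, QuatKaehler.opL, real_inner_self_eq_norm_sq] at h1
    simp only [QuatKaehler.inner_sharp]
    rw [h1]
    ring
  · rintro ⟨φ, hφ, h⟩
    refine QuatKaehler.not_exists_vectorField hE (QuatKaehler.contMDiffAt_sharp hφ) hν fun x ↦ ?_
    obtain ⟨U, hU, hx, J₁, J₂, J₃, hJ, -, -, -, hL⟩ := h x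
    refine ⟨J₁ x, J₂ x, J₃ x, (hJ.frame x hx).1, fun u ↦ ?_⟩
    simp only [QuatKaehler.inner_sharp]
    exact hQ.leviCivita_sharp_leeForm hn hJ hU hφ hL hx u
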